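/- Let $d>2$, and let $\mathbb R^d$ carry the flat Euclidean metric. For $D>0$ and a fluctuation $h(x,p)$ (a smooth function on $\mathbb R^d\times\mathbb R^d$ vanishing for $x$ outside a compact set), let $$\mathcal A[D-p^2+eh]=\mathrm{Tr}\,\theta(H*)=(2\pi\hbar)^{-d}\int d^dx\,d^dp\;\theta\big((D-p^2+eh)*\big)$$ be the "quantized volume" action of $H=D-p^2+eh$, expanded as a formal power series in $e$ and in $\hbar$ (semiclassical expansion with respect to the Weyl–Moyal star product; at each order it is an $x$-integral of $p$-integrals of $\theta^{(n)}(D-p^2)$ times star-product coefficients). Let $\mathcal A_{2,k}^D[h]$ be the coefficient of $e^2\hbar^{k-d}$. The quadratic part of the action around $H=-p^2$ is the $D^0$-term, as $D\to0^+$, of $\sum_k\hbar^{k-d}\mathcal A_{2,k}^D[h]$. With $\rho^2=\Box q^2-(q\partial)^2$, $\rho'^2=\Box q'^2-(q'\partial)^2$, $\tau=\Box(qq')-(q\partial)(q'\partial)$, $\nu=\frac{d-3}2$ and $U_\lambda(z)=z^{-\lambda}J_\lambda(z)$, the spin-$s$ deformed conformal higher spin theory with parameter $\mu^2=\mu^2(\Box)$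 is the quadratic action $$A[h]=\int d^dx\,\Big\{h(x,p)\,P\big(\overleftarrow{\partial_p},\overrightarrow{\partial_{p'}},\partial\big)h(x,p')\Big\}_{p=p'=0},\qquad P=\alpha_s(\Box)\,P^{(s)}_\mu,$$ $$P^{(s)}_\mu(q,q',\partial)=U_{s+\nu}\big(\tfrac{\mu}{\sqrt\Box}\rho\big)\,U_{s+\nu}\big(\tfrac{\mu}{\sqrt\Box}\rho'\big)\,\frac{\Gamma(\nu)}{\Gamma(s+\nu)}(\rho\rho')^s\,C_s^{\nu}\big(\tfrac{\tau}{\rho\rho'}\big),$$ where $C^\nu_s$ is the Gegenbauer polynomial (for $\nu=0$ the limit $\nu\to0$ is meant) and $\alpha_s(\Box)$ is a function of $\Box$. Expressions are expanded in powers of $\mu^2/\Box$. Then: 1. For every $s\ge 0$, $P^{(s)}_\mu$ satisfies the conditions of invariance under $\delta h=-2(p^2+\mu^2)a-2p\partial_x\epsilon$, namely $P(q,q',\partial)=P(q',q,-\partial)$, $(\partial_q\partial)P=0$ and $(\partial_q^2+\mu^2)P=0$, as identities of formal power series in $\mu^2/\Box$. 2. If $d$ is even, then the limit $D\to0^+$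 of $\mathcal A^D_{2,k}[h]$ exists for all $k$ and $h$, and the quadratic part of the action around $H=-p^2$ is a sum of deformed conformal higher spin theories of all spins $s=0,1,2,\dots$ with $\mu^2=-\frac{\hbar^2}4\Box$: there are real constants $\alpha_s\ne0$, depending only on $d$ and $s$, such that for all $h$, order by order in $\hbar$, $$\lim_{D\to0^+}\sum_k\hbar^{k-d}\mathcal A^D_{2,k}[h]=\sum_{s=0}^\infty\int d^dx\,\Big\{h(x,p)\,\alpha_s\,\hbar^{2s-4}\,\Box^{\frac d2-2}\,P^{(s)}_{\mu}\big(\overleftarrow{\partial_p},\overrightarrow{\partial_{p'}},\partial\big)\,h(x,p')\Big\}_{p=p'=0},\quad \mu^2=-\tfrac{\hbar^2}4\Box .$$ 3. If $d$ is odd, then the sum is trivial: every $\mathcal A^D_{2,k}[h]$ equals a finite linear combination of the powers $D^{-j-1/2}$, $j=0,1,2,\dots$, up to a term that tends to $0$ as $D\to0^+$, so that its $D^0$-term, and with it the quadratic action, vanishes. -/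

import Mathlib

open scoped ContDiff Topology
open Filter MeasureTheory

/-! Conventions. `Phase d` is the flat Euclidean space in which positions `x` and momenta `p` take
values.  A symbol is a complex function of `(x, p)`. -/

noncomputable section

namespace QuantizedVolume

/-- The flat Euclidean space `ℝ^d`. -/
abbrev Phase (d : ℕ) : Type := EuclideanSpace ℝ (Fin d)

/-- Functions `f (x, p)` on the phase space. -/
abbrev Symbol (d : ℕ) : Type := Phase d → Phase d → ℂ

variable {d : ℕ}

/-- `∂f/∂xⁱ`. -/
def dx (i : Fin d) (f : Symbol d) : Symbol d :=
  fun x p => lineDeriv ℝ (fun y => f y p) x (EuclideanSpace.single i (1 : ℝ))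

/-- `∂f/∂pᵢ`. -/
def dp (i : Fin d) (f : Symbol d) : Symbol d :=
  fun x p => lineDeriv ℝ (fun r => f x r) p (EuclideanSpace.single i (1 : ℝ))

/-! ### The Weyl-Moyal star product, order by order in `ħ` -/

/-- `f ∇^m g`, where `∇ = ∑ᵢ (←∂/∂xⁱ →∂/∂pᵢ - ←∂/∂pᵢ →∂/∂xⁱ)`. -/
def nablaPow : ℕ → Symbol d → Symbol d → Symbol d
  | 0, f, g => fun x p => f x p * g x p
  | m + 1, f, g => fun x p =>
      ∑ i : Fin d, (nablaPow m (dx i f) (dp i g) x p - nablaPow m (dp i f) (dx i g) x p)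

/-- Formal power series in `e` (counting fluctuations) and in `ħ`: `A l k` is the coefficient of
`e^l ħ^k`. -/
abbrev FormalSymbol (d : ℕ) : Type := ℕ → ℕ → Symbol d

/-- The star product `A * B = A exp ((iħ/2) ∇) B` of formal power series in `e` and `ħ`. -/
def star (A B : FormalSymbol d) : FormalSymbol d := fun l k x p =>
  ∑ a ∈ Finset.HasAntidiagonal.antidiagonal l, ∑ b ∈ Finset.HasAntidiagonal.antidiagonal k, ∑ c ∈ Finset.HasAntidiagonal.antidiagonal b.1,
    ((Complex.I / 2) ^ b.2 / (b.2.factorial : ℂ)) * nablaPow b.2 (A a.1 c.1) (B a.2 c.2) x p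

/-- The constant `z`, as a formal symbol. -/
def const (z : ℂ) : FormalSymbol d
  | 0, 0 => fun _ _ => z
  | _, _ => fun _ _ => 0

/-- The star power `(A*)^n`. -/
def starPow (A : FormalSymbol d) : ℕ → FormalSymbol d
  | 0 => const 1
  | n + 1 => star (starPow A n) A

/-! ### The quantized volume and its perturbative expansion -/

/-- The background `D - p²`. -/
def background (D : ℝ) (p : Phase d) : ℝ := D - ‖p‖ ^ 2

/-- The Hamiltonian `H = D - p² + e h(x, p)`. -/
def hamiltonian (D : ℝ) (h : Symbol d) : FormalSymbol d
  | 0, 0 => fun _ p => (background D p : ℂ)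
  | 1, 0 => h
  | _, _ => fun _ _ => 0

/-- A star function has the expansion
`F(H*)(z) = ∑ₙ F⁽ⁿ⁾(c) / n! · ((H - c)*)^n (z)` about the value `c` of the background at the point `z`
(for polynomials and for exponentials `F` this is the definition by Taylor series).
This is the coefficient of `F⁽ⁿ⁾(D - p²) e^l ħ^k` in `F((D - p² + e h)*)` at the point `(x, p)`. -/
def starTaylor (D : ℝ) (h : Symbol d) (l k n : ℕ) : Symbol d := fun x p =>
  starPow (hamiltonian D h - const (background D p : ℂ)) n l k x p / (n.factorial : ℂ)

/-- `∫ d^dp θ⁽ⁿ⁾(D - p²) w(p)`, the distributions `θ' = δ, θ'' = δ', …` being evaluated by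
differentiation of the integral over the domain `D + σ - p² > 0` with respect to `σ`. -/
def stepIntegral (D : ℝ) (n : ℕ) (w : Phase d → ℂ) : ℂ :=
  iteratedDeriv n
    (fun σ : ℝ => ∫ p in {p : Phase d | 0 < background D p + σ}, w p) 0

/-- The coefficient of `e^l ħ^(k-d)` in the Lagrangian `(2πħ)^(-d) ∫ d^dp θ((D - p² + e h)*)`.
Since `H - c` is `O(e)` at the point `z` unless it is differentiated, and since the order `ħ^k`
contains `2k` derivatives, `starTaylor D h l k n` vanishes for `n > 2k + l`. -/
def lagrangian (D : ℝ) (h : Symbol d) (l k : ℕ) (x : Phase d) : ℂ :=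
  (((2 * Real.pi) ^ d : ℝ) : ℂ)⁻¹ *
    ∑ n ∈ Finset.range (2 * k + l + 1), stepIntegral D n (starTaylor D h l k n x)

/-- The coefficient of `e² ħ^(k-d)` in the quantized-volume action
`Tr θ(H*) = (2πħ)^(-d) ∫ d^dx d^dp θ(H*)` of `H = D - p² + e h`. -/
def quadraticAction (D : ℝ) (h : Symbol d) (k : ℕ) : ℂ :=
  ∫ x : Phase d, lagrangian D h 2 k x

/-- Admissible fluctuations: smooth, with compact support in `x`. -/
structure IsFluctuation (h : Symbol d) : Prop where
  smooth : ContDiff ℝ ∞ (fun z : Phase d × Phase d => h z.1 z.2)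
  support : ∃ C : Set (Phase d), IsCompact C ∧ ∀ x ∉ C, ∀ p, h x p = 0

/-! ### Quadratic actions and their generating functions -/

/-- Polynomials in the components of three vectors `q`, `q'`, `∂`, numbered `0`, `1`, `2`. -/
abbrev GenPoly (d : ℕ) : Type := MvPolynomial (Fin 3 × Fin d) ℝ

variable (d) in
/-- The scalar product of the vectors number `a` and `b`. -/
def dot (a b : Fin 3) : GenPoly d := ∑ i : Fin d, MvPolynomial.X (a, i) * MvPolynomial.X (b, i)

variable (d) in
/-- `□ = ∂²`. -/
def box : GenPoly d := dot d 2 2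

variable (d) in
/-- `ρ² = □ q² - (q∂)²` for `a = 0`, and `ρ'² = □ q'² - (q'∂)²` for `a = 1`. -/
def rhoSq (a : Fin 3) : GenPoly d := box d * dot d a a - dot d a 2 ^ 2

variable (d) in
/-- `τ = □ (qq') - (q∂)(q'∂)`. -/
def tau : GenPoly d := box d * dot d 0 1 - dot d 0 2 * dot d 1 2

/-- Iterated derivatives `∏ᵢ (∂/∂xⁱ)^(m i)`. -/
def dxIter (m : Fin d → ℕ) (f : Symbol d) : Symbol d :=
  (List.finRange d).foldr (fun i g => (dx i)^[m i] g) f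

/-- Iterated derivatives `∏ᵢ (∂/∂pᵢ)^(m i)`. -/
def dpIter (m : Fin d → ℕ) (f : Symbol d) : Symbol d :=
  (List.finRange d).foldr (fun i g => (dp i)^[m i] g) f

/-- The quadratic action with generating function `P(q, q', ∂)`:
`∫ d^dx { h(x,p) P(←∂/∂p, →∂/∂p', ∂) h(x,p') }` at `p = p' = 0`, where `∂` acts on the right factor. -/
def generatedAction (P : GenPoly d) (h : Symbol d) : ℂ :=
  ∫ x : Phase d, ∑ m ∈ P.support, ((P.coeff m : ℝ) : ℂ) *
    (dpIter (fun i => m (0, i)) h x 0 *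
      dxIter (fun i => m (2, i)) (dpIter (fun i => m (1, i)) h) x 0)

/-! ### Deformed conformal higher spin theories -/

/-- The coefficients of `U_ν(z) = z^(-ν) J_ν(z) = ∑ⱼ besselCoeff ν j · (z²)^j`. -/
def besselCoeff (ν : ℝ) (j : ℕ) : ℝ :=
  (-1) ^ j / (4 ^ j * 2 ^ ν * (j.factorial : ℝ) * Real.Gamma (ν + j + 1))

variable (d) in
/-- `Γ(ν)/Γ(s+ν) · (ρρ')^s C_s^ν(τ/(ρρ'))` with the Gegenbauer polynomial `C_s^ν`, `ν = (d-3)/2`;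
written out it is a polynomial in `τ` and `ρ²ρ'²`, also for `ν = 0`. -/
def undressedGen (s : ℕ) : GenPoly d :=
  ∑ k ∈ Finset.range (s / 2 + 1),
    MvPolynomial.C ((-1) ^ k * 2 ^ (s - 2 * k) /
      ((k.factorial : ℝ) * ((s - 2 * k).factorial : ℝ) *
        ∏ i ∈ Finset.range k, (((d : ℝ) - 3) / 2 + s - (i + 1)))) *
      tau d ^ (s - 2 * k) * (rhoSq d 0 * rhoSq d 1) ^ k

variable (d) in
/-- The dressing factor `U_{s+(d-3)/2}(μ ρ / √□)`, as a power series in `κ = μ²/□`; `ρ` is built with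
the vector number `a`. -/
def dressing (s : ℕ) (a : Fin 3) : PowerSeries (GenPoly d) :=
  PowerSeries.mk fun j =>
    MvPolynomial.C (besselCoeff (s + ((d : ℝ) - 3) / 2) j) * rhoSq d a ^ j

variable (d) in
/-- The generating function `P⁽ˢ⁾_μ(q, q', ∂)` of the spin-`s` deformed conformal higher spin theory, as
a power series in `κ = μ²/□`, up to multiplication by functions of `□`. -/
def deformedGen (s : ℕ) : PowerSeries (GenPoly d) :=
  dressing d s 0 * dressing d s 1 * PowerSeries.C (undressedGen d s)

/-- The quadratic action with generating function `P = ∑ₘ κ^m Pₘ`, `κ = μ²/□`, is invariant under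
`δh = -2(p² + μ²)a - 2p∂ε`: one has `P(q,q',∂) = P(q',q,-∂)`, `(∂_q ∂) P = 0` and `(∂_q² + μ²) P = 0`
(hence the same for `q'`). -/
structure IsDeformedGaugeInvariant (P : PowerSeries (GenPoly d)) : Prop where
  symm : ∀ m, MvPolynomial.aeval (fun v : Fin 3 × Fin d =>
      if v.1 = 2 then -(MvPolynomial.X v : GenPoly d)
      else MvPolynomial.X (Equiv.swap 0 1 v.1, v.2)) (PowerSeries.coeff m P) = PowerSeries.coeff m P
  transverse : ∀ m, ∑ i : Fin d,
      MvPolynomial.X (2, i) * MvPolynomial.pderiv (0, i) (PowerSeries.coeff m P) = 0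
  trace_zero : ∑ i : Fin d, MvPolynomial.pderiv (0, i)
      (MvPolynomial.pderiv (0, i) (PowerSeries.coeff 0 P)) = 0
  trace_succ : ∀ m, ∑ i : Fin d, MvPolynomial.pderiv (0, i)
      (MvPolynomial.pderiv (0, i) (PowerSeries.coeff (m + 1) P)) + box d * PowerSeries.coeff m P = 0

/-- For even `d ≥ 4`, the coefficient of `ħ^(k-d)` in the sum over all spins `s` of the actions with
generating functions `α_s(□) P⁽ˢ⁾_μ(q, q', ∂)`, where `μ² = -ħ²□/4` (so `κ = -ħ²/4`) and
`α_s(□) = α s · ħ^(2s-4) □^(d/2-2)`. -/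
def deformedSum (α : ℕ → ℝ) (h : Symbol d) (k : ℕ) : ℂ :=
  ∑ s ∈ Finset.range (k + 1), ∑ m ∈ Finset.range (k + 1),
    if 2 * s + 2 * m + (d - 4) = k then
      (α s : ℂ) * (-1 / 4) ^ m *
        generatedAction (box d ^ (d / 2 - 2) * PowerSeries.coeff m (deformedGen d s)) h
    else 0

end QuantizedVolume

end

noncomputable section

namespace QuantizedVolume

variable {d : ℕ}

/-! ### The algebra of smooth symbols -/

/-! All expressions bilinear in `h` are encoded as polynomials in the momentum and in formal
derivatives of the two factors (`BiPoly`, `bi`). Star multiplication by `c - p²` is then a Bopp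
shift, multiplication by `c - (p ± iħ∂/2)²` (`shiftedSeries_background`,
`map_rightPart_shiftedSeries_pow`), so the `e²` part of each star power has an explicit symbol
(`starPow_second`). With `c` frozen at its value at the evaluation point, only differences `p² - (p
+ iħv/2)²` survive and `D` disappears (`starTaylor_two`). Under the integral over `x` total
derivatives drop out. With `k` the position derivative of the right factor and `q` the total
momentum derivative, the symbol of the star power `N + 2` becomes `(2iħ pk + ħ²k²)^N exp(-iħ qk/2)`
(`map_byParts_quadraticIncrement`).

The momentum integrals are handled by rescaling to the unit ball and Taylor expansion in `√D`. Odd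
orders vanish by parity and even ones give Laplacians at `p = 0`, so the integral of `θ⁽ⁿ⁾(D - p²)
W` is a sum of terms `D^(d/2+r-n) Δ^r W(x, 0)` up to a vanishing remainder
(`tendsto_integral_stepIntegral_sub`). For odd `d` all exponents are half-integers, which is the
third claim. For even `d` the coefficients of negative powers are zero (`stepCoeff_even_of_lt`), so
the limit exists and is read off from `r = n - d/2` (`evenLimit`).

To sum over the star powers, the Laplacians are evaluated on the generating function `exp(v pk)`, on
which `Δ` acts as `(q + vk)²`. Heuristically, with `U = 2iħ pk + ħ²k²`, the sum of `θ⁽ᴺ⁺²⁾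
U^N/(N+2)!` is the integral over `0 ≤ s ≤ 1` of `(1-s) θ''(D - p² + sU)`, and `-p² + sU = -(p -
iħsk)² + ħ²s(1-s)k²`; the exponential moves the shift `s` to `s - 1/2`. This explains the moments
`weightedMoment`. The proof itself compares coefficients (`expansion_coefficient`, `sum_evenLimit`).
With `m = d/2 - 2`, the order `ħ^(2(m+N))` relative to `ħ^(-d)` is a constant independent of `N`
times `(k²)^m (k²q² - (qk)²)^N / (16^N N! Γ(m+N+3/2))` (`sum_evenLimit_even`).

Since `q` is the sum of the two momentum derivatives, `k²q² - (qk)² = ρ² + ρ'² + 2τ`, and these are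
the Taylor terms of a Bessel function of index `ν = (d-3)/2 = m + 1/2`. Gegenbauer's addition
theorem (`sum_spins`, resting on the finite identity `sum_additionTerm`) splits them into spins,
with the nonzero weights `spinWeight`.

Gauge invariance is a separate algebraic fact. The generating functions are polynomials in `ρ²`,
`ρ'²`, `τ`, which are transverse; the Gegenbauer recursion makes the undressed part traceless, and
the Bessel recursion turns the trace of the dressing into `-μ²`. -/

variable (d) in
/-- The algebra of smooth functions on the phase space. -/
def smoothSymbols : Subalgebra ℂ (Symbol d) where
  carrier := {f | ContDiff ℝ ∞ (fun z : Phase d × Phase d => f z.1 z.2)}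
  mul_mem' {f g} hf hg := by
    rw [Set.mem_ofPred_eq] at *
    exact ContDiff.mul hf hg
  add_mem' {f g} hf hg := by
    rw [Set.mem_ofPred_eq] at *
    exact ContDiff.add hf hg
  algebraMap_mem' c := by
    rw [Set.mem_ofPred_eq]
    exact contDiff_const (c := c)

/-- The derivative of a smooth function on the phase space in the direction `v`. -/
def dirDeriv (v : Phase d × Phase d) (f : Symbol d) : Symbol d :=
  fun x p => fderiv ℝ (fun z : Phase d × Phase d => f z.1 z.2) (x, p) v

theorem dirDeriv_mem (v : Phase d × Phase d) {f : Symbol d} (hf : f ∈ smoothSymbols d) :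
    dirDeriv v f ∈ smoothSymbols d := by
  have hf' : ContDiff ℝ ∞ (fun z : Phase d × Phase d => f z.1 z.2) := hf
  exact (hf'.fderiv_right (m := ∞) (by simp)).clm_apply contDiff_const

theorem smoothSymbols.differentiable {f : Symbol d} (hf : f ∈ smoothSymbols d) :
    Differentiable ℝ (fun z : Phase d × Phase d => f z.1 z.2) :=
  ContDiff.differentiable (n := ∞) hf (by simp)

theorem dx_eq_dirDeriv {f : Symbol d} (hf : f ∈ smoothSymbols d) (i : Fin d) :
    dx i f = dirDeriv (EuclideanSpace.single i 1, 0) f := by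
  funext x p
  rw [dirDeriv, ← (smoothSymbols.differentiable hf _).lineDeriv_eq_fderiv]
  simp [dx, lineDeriv]

theorem dp_eq_dirDeriv {f : Symbol d} (hf : f ∈ smoothSymbols d) (i : Fin d) :
    dp i f = dirDeriv (0, EuclideanSpace.single i 1) f := by
  funext x p
  rw [dirDeriv, ← (smoothSymbols.differentiable hf _).lineDeriv_eq_fderiv]
  simp [dp, lineDeriv]

theorem dirDeriv_comm (v w : Phase d × Phase d) {f : Symbol d} (hf : f ∈ smoothSymbols d) :
    dirDeriv v (dirDeriv w f) = dirDeriv w (dirDeriv v f) := by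
  funext x p
  have hf' : ContDiff ℝ ∞ (fun z : Phase d × Phase d => f z.1 z.2) := hf
  have hd : Differentiable ℝ (fderiv ℝ (fun z : Phase d × Phase d => f z.1 z.2)) :=
    (hf'.fderiv_right (m := ∞) (by simp)).differentiable (by simp)
  have key : ∀ v w : Phase d × Phase d, dirDeriv v (dirDeriv w f) x p =
      fderiv ℝ (fderiv ℝ (fun z : Phase d × Phase d => f z.1 z.2)) (x, p) v w := by
    intro v w
    simp only [dirDeriv]
    rw [fderiv_clm_apply (hd _) (differentiableAt_const _)]
    simp
  rw [key, key]
  refine (hf'.contDiffAt.isSymmSndFDerivAt ?_).eq v w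
  rw [minSmoothness_of_isRCLikeNormedField]
  exact WithTop.coe_le_coe.2 le_top

/-- `dirDeriv v` as a derivation of the algebra of smooth symbols. -/
def dirDerivation (v : Phase d × Phase d) :
    Derivation ℂ (smoothSymbols d) (smoothSymbols d) where
  toFun f := ⟨dirDeriv v f, dirDeriv_mem v f.2⟩
  map_add' f g := by
    ext x p
    exact congrArg (fun L => L v) (fderiv_add (smoothSymbols.differentiable f.2 (x, p))
      (smoothSymbols.differentiable g.2 (x, p)))
  map_smul' c f := by
    ext x p
    exact congrArg (fun L => L v)
      (fderiv_const_smul (smoothSymbols.differentiable f.2 (x, p)) c)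
  map_one_eq_zero' := by
    ext x p
    exact congrArg (fun L => L v) (fderiv_const_apply (𝕜 := ℝ) (x := (x, p)) (1 : ℂ))
  leibniz' f g := by
    ext x p
    exact congrArg (fun L => L v) (fderiv_mul (smoothSymbols.differentiable f.2 (x, p))
      (smoothSymbols.differentiable g.2 (x, p)))

/-- `∂/∂xⁱ` on smooth symbols. -/
def dX (i : Fin d) : Derivation ℂ (smoothSymbols d) (smoothSymbols d) :=
  dirDerivation (EuclideanSpace.single i 1, 0)

/-- `∂/∂pᵢ` on smooth symbols. -/
def dP (i : Fin d) : Derivation ℂ (smoothSymbols d) (smoothSymbols d) :=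
  dirDerivation (0, EuclideanSpace.single i 1)

theorem coe_dX (i : Fin d) (f : smoothSymbols d) : (dX i f : Symbol d) = dx i f :=
  (dx_eq_dirDeriv f.2 i).symm

theorem coe_dP (i : Fin d) (f : smoothSymbols d) : (dP i f : Symbol d) = dp i f :=
  (dp_eq_dirDeriv f.2 i).symm

theorem dirDerivation_comm (v w : Phase d × Phase d) (f : smoothSymbols d) :
    dirDerivation v (dirDerivation w f) = dirDerivation w (dirDerivation v f) :=
  Subtype.ext (dirDeriv_comm v w f.2)

/-- The coordinate function `pᵢ`. -/
def pCoord (i : Fin d) : smoothSymbols d :=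
  ⟨fun _ p => ((p i : ℝ) : ℂ), by
    change ContDiff ℝ ∞ (fun z : Phase d × Phase d => ((z.2 i : ℝ) : ℂ))
    exact Complex.ofRealCLM.contDiff.comp
      ((EuclideanSpace.proj (𝕜 := ℝ) i).contDiff.comp contDiff_snd)⟩

theorem dirDerivation_pCoord (v : Phase d × Phase d) (i : Fin d) :
    dirDerivation v (pCoord i) = algebraMap ℂ _ ((v.2 i : ℝ) : ℂ) := by
  ext x p
  change fderiv ℝ (fun z : Phase d × Phase d => ((z.2 i : ℝ) : ℂ)) (x, p) v = ((v.2 i : ℝ) : ℂ)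
  have : HasFDerivAt (fun z : Phase d × Phase d => ((z.2 i : ℝ) : ℂ))
      (Complex.ofRealCLM.comp ((EuclideanSpace.proj (𝕜 := ℝ) i).comp
        (ContinuousLinearMap.snd ℝ (Phase d) (Phase d)))) (x, p) :=
    ContinuousLinearMap.hasFDerivAt (Complex.ofRealCLM.comp
      ((EuclideanSpace.proj (𝕜 := ℝ) i).comp (ContinuousLinearMap.snd ℝ (Phase d) (Phase d))))
  rw [this.fderiv]
  simp

@[simp] theorem dX_pCoord (i j : Fin d) : dX i (pCoord j) = 0 := by
  simp [dX, dirDerivation_pCoord]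

theorem dP_pCoord (i j : Fin d) : dP i (pCoord j) = if j = i then 1 else 0 := by
  rw [dP, dirDerivation_pCoord]
  by_cases h : j = i <;> simp [h, PiLp.single_apply]

/-- The partial derivatives: number `0` is `∂/∂p`, number `1` is `∂/∂x`. -/
def partialEnd (v : Fin 2 × Fin d) : Module.End ℂ (smoothSymbols d) :=
  if v.1 = 0 then (dP v.2).toLinearMap else (dX v.2).toLinearMap

theorem partialEnd_comm (v w : Fin 2 × Fin d) :
    partialEnd v * partialEnd w = partialEnd w * partialEnd v := by
  refine LinearMap.ext fun f => ?_
  simp only [partialEnd, Module.End.mul_apply]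
  split_ifs <;> exact dirDerivation_comm _ _ f

open Algebra in
open scoped IsMulCommutative in
/-- Constant-coefficient differential operators. -/
def act : MvPolynomial (Fin 2 × Fin d) ℂ →ₐ[ℂ] Module.End ℂ (smoothSymbols d) :=
  -- Evaluation of polynomials needs a commutative target, so it takes place in the subalgebra
  -- generated by the commuting partial derivatives.
  haveI : IsMulCommutative (adjoin ℂ (Set.range (partialEnd (d := d)))) :=
    isMulCommutative_adjoin ℂ (by rintro _ ⟨v, rfl⟩ _ ⟨w, rfl⟩; exact partialEnd_comm v w)
  (adjoin ℂ (Set.range (partialEnd (d := d)))).val.comp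
    (MvPolynomial.aeval fun v => ⟨partialEnd v, subset_adjoin ⟨v, rfl⟩⟩)

theorem act_X (v : Fin 2 × Fin d) : act (MvPolynomial.X v) = partialEnd v := by
  simp [act]

theorem act_X_zero (i : Fin d) (f : smoothSymbols d) :
    act (MvPolynomial.X (0, i)) f = dP i f := by
  simp [act_X, partialEnd]

theorem act_X_one (i : Fin d) (f : smoothSymbols d) :
    act (MvPolynomial.X (1, i)) f = dX i f := by
  simp [act_X, partialEnd]

theorem act_mul (P Q : MvPolynomial (Fin 2 × Fin d) ℂ) (f : smoothSymbols d) :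
    act (P * Q) f = act P (act Q f) := by simp

/-! ### Bidifferential operators with polynomial coefficients -/

/-- Symbols of bidifferential operators. The variables number `0`, …, `4` stand for the momentum
derivatives of the left and the right factor, the position derivatives of the right and the left
factor, and the momentum. -/
abbrev BiPoly (d : ℕ) : Type := MvPolynomial (Fin 5 × Fin d) ℂ

/-- The bidifferential operator whose symbol is a monomial. -/
def biMonomial (f g : smoothSymbols d) (m : Fin 5 × Fin d →₀ ℕ) : smoothSymbols d :=
  (∏ i, pCoord i ^ m (4, i)) *
    act ((∏ i, MvPolynomial.X (0, i) ^ m (0, i)) * ∏ i, MvPolynomial.X (1, i) ^ m (3, i)) f *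
    act ((∏ i, MvPolynomial.X (0, i) ^ m (1, i)) * ∏ i, MvPolynomial.X (1, i) ^ m (2, i)) g

/-- The bidifferential operator with a given symbol. -/
def bi (f g : smoothSymbols d) : BiPoly d →ₗ[ℂ] smoothSymbols d :=
  (MvPolynomial.basisMonomials _ ℂ).constr ℂ (biMonomial f g)

theorem bi_monomial (f g : smoothSymbols d) (m : Fin 5 × Fin d →₀ ℕ) (c : ℂ) :
    bi f g (MvPolynomial.monomial m c) = c • biMonomial f g m := by
  have : MvPolynomial.monomial m c = c • MvPolynomial.basisMonomials (Fin 5 × Fin d) ℂ m := by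
    simp [MvPolynomial.smul_monomial]
  rw [this, map_smul, bi, Module.Basis.constr_basis]

theorem prod_pow_single_add {A : Type*} [CommMonoid A] (y : Fin d → A) (a b : Fin 5) (j : Fin d)
    (m : Fin 5 × Fin d →₀ ℕ) :
    ∏ i, y i ^ (Finsupp.single (a, j) 1 + m : Fin 5 × Fin d →₀ ℕ) (b, i) =
      (if a = b then y j else 1) * ∏ i, y i ^ m (b, i) := by
  simp only [Finsupp.add_apply, pow_add, Finset.prod_mul_distrib]
  congr 1
  split_ifs with h
  · subst h
    rw [Finset.prod_eq_single j]
    · simp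
    · intro i _ hi
      simp [hi.symm]
    · simp
  · refine Finset.prod_eq_one fun i _ => ?_
    simp [h]

/-- In a monomial the momenta stand in front and the derivatives act directly on `f` and `g`, so one
more variable changes only one ingredient. Together with `bi_C`, the resulting rules determine `bi`
and allow induction over symbols. -/
theorem bi_X_mul_aux {f g f' g' : smoothSymbols d} {s : smoothSymbols d} {v : Fin 5 × Fin d}
    (h : ∀ m, biMonomial f g (Finsupp.single v 1 + m) = s * biMonomial f' g' m) (r : BiPoly d) :
    bi f g (MvPolynomial.X v * r) = s * bi f' g' r := by
  induction r using MvPolynomial.induction_on' with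
  | monomial m c => rw [MvPolynomial.X, MvPolynomial.monomial_mul, bi_monomial, bi_monomial, h,
      one_mul, mul_smul_comm]
  | add p q hp hq => rw [mul_add, map_add, map_add, hp, hq, mul_add]

theorem bi_X_zero_mul (f g : smoothSymbols d) (i : Fin d) (r : BiPoly d) :
    bi f g (MvPolynomial.X (0, i) * r) = bi (dP i f) g r := by
  rw [bi_X_mul_aux (s := 1) (f' := dP i f) (g' := g), one_mul]
  intro m
  simp only [biMonomial, prod_pow_single_add, ← act_X_zero, ← act_mul, Fin.reduceEq, if_true,
    if_false, one_mul]
  rw [mul_assoc (MvPolynomial.X (0, i)), mul_comm (MvPolynomial.X (0, i))]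

theorem bi_X_one_mul (f g : smoothSymbols d) (i : Fin d) (r : BiPoly d) :
    bi f g (MvPolynomial.X (1, i) * r) = bi f (dP i g) r := by
  rw [bi_X_mul_aux (s := 1) (f' := f) (g' := dP i g), one_mul]
  intro m
  simp only [biMonomial, prod_pow_single_add, ← act_X_zero, ← act_mul, Fin.reduceEq, if_true,
    if_false, one_mul]
  rw [mul_assoc (MvPolynomial.X (0, i)), mul_comm (MvPolynomial.X (0, i))]

theorem bi_X_two_mul (f g : smoothSymbols d) (i : Fin d) (r : BiPoly d) :
    bi f g (MvPolynomial.X (2, i) * r) = bi f (dX i g) r := by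
  rw [bi_X_mul_aux (s := 1) (f' := f) (g' := dX i g), one_mul]
  intro m
  simp only [biMonomial, prod_pow_single_add, ← act_X_one, ← act_mul, Fin.reduceEq, if_true,
    if_false, one_mul]
  congr 3
  ring

theorem bi_X_three_mul (f g : smoothSymbols d) (i : Fin d) (r : BiPoly d) :
    bi f g (MvPolynomial.X (3, i) * r) = bi (dX i f) g r := by
  rw [bi_X_mul_aux (s := 1) (f' := dX i f) (g' := g), one_mul]
  intro m
  simp only [biMonomial, prod_pow_single_add, ← act_X_one, ← act_mul, Fin.reduceEq, if_true,
    if_false, one_mul]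
  congr 4
  ring

theorem bi_X_four_mul (f g : smoothSymbols d) (i : Fin d) (r : BiPoly d) :
    bi f g (MvPolynomial.X (4, i) * r) = pCoord i * bi f g r := by
  rw [bi_X_mul_aux (s := pCoord i) (f' := f) (g' := g)]
  intro m
  simp only [biMonomial, prod_pow_single_add, Fin.reduceEq, if_true, if_false, one_mul]
  ring

theorem bi_one (f g : smoothSymbols d) : bi f g 1 = f * g := by
  have : (1 : BiPoly d) = MvPolynomial.monomial 0 1 := rfl
  rw [this, bi_monomial]
  simp [biMonomial]

theorem bi_C (f g : smoothSymbols d) (c : ℂ) : bi f g (MvPolynomial.C c) = c • (f * g) := by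
  rw [← bi_one, ← map_smul, MvPolynomial.smul_eq_C_mul, mul_one]

theorem bi_C_mul (f g : smoothSymbols d) (c : ℂ) (r : BiPoly d) :
    bi f g (MvPolynomial.C c * r) = c • bi f g r := by
  rw [← map_smul, MvPolynomial.smul_eq_C_mul]

/-- Two families of linear maps on symbols of bidifferential operators agree if they agree on
constants and behave in the same way under multiplication by the variables. -/
theorem biPoly_induction {motive : BiPoly d → Prop} (r : BiPoly d)
    (hC : ∀ c, motive (MvPolynomial.C c)) (hadd : ∀ p q, motive p → motive q → motive (p + q))
    (hX : ∀ a i p, motive p → motive (MvPolynomial.X (a, i) * p)) : motive r := by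
  induction r using MvPolynomial.induction_on with
  | C c => exact hC c
  | add p q hp hq => exact hadd p q hp hq
  | mul_X p v hp => rw [mul_comm]; exact hX v.1 v.2 p hp

/-- The coefficients depend on the momentum only, so the Leibniz rule produces just the derivatives
of the two arguments. -/
theorem dX_bi (f g : smoothSymbols d) (i : Fin d) (r : BiPoly d) :
    dX i (bi f g r) = bi f g ((MvPolynomial.X (2, i) + MvPolynomial.X (3, i)) * r) := by
  rw [add_mul, map_add, bi_X_two_mul, bi_X_three_mul]
  revert f g
  induction r using biPoly_induction with
  | hC c =>
    intro f g
    simp only [bi_C, Derivation.map_smul, Derivation.leibniz, smul_eq_mul, ← smul_add]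
    rw [mul_comm (dX i f)]
  | hadd p q hp hq =>
    intro f g
    simp only [map_add, hp, hq]
    abel
  | hX a j p hp =>
    intro f g
    fin_cases a
    · simp only [Fin.zero_eta, bi_X_zero_mul, hp]
      rw [dP, dX, dirDerivation_comm]
    · simp only [Fin.mk_one, bi_X_one_mul, hp]
      rw [dP, dX, dirDerivation_comm]
    · simp only [Fin.reduceFinMk, bi_X_two_mul, hp]
      rw [dX, dX, dirDerivation_comm]
    · simp only [Fin.reduceFinMk, bi_X_three_mul, hp]
      rw [dX, dX, dirDerivation_comm]
    · simp only [Fin.reduceFinMk, bi_X_four_mul, hp, Derivation.leibniz, dX_pCoord, smul_eq_mul,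
        mul_zero, add_zero, mul_add]

/-- Unlike a position derivative, a momentum derivative also meets the coefficients; this is the
commutator of `∂/∂pᵢ` with multiplication by `pᵢ`. -/
theorem dP_bi (f g : smoothSymbols d) (i : Fin d) (r : BiPoly d) :
    dP i (bi f g r) = bi f g (MvPolynomial.pderiv (4, i) r +
      (MvPolynomial.X (0, i) + MvPolynomial.X (1, i)) * r) := by
  rw [map_add, add_mul, map_add, bi_X_zero_mul, bi_X_one_mul]
  revert f g
  induction r using biPoly_induction with
  | hC c =>
    intro f g
    simp only [bi_C, Derivation.map_smul, Derivation.leibniz, smul_eq_mul, ← smul_add,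
      MvPolynomial.pderiv_C, map_zero, zero_add]
    rw [mul_comm (dP i f), add_comm]
  | hadd p q hp hq =>
    intro f g
    simp only [map_add, hp, hq]
    abel
  | hX a j p hp =>
    intro f g
    rw [MvPolynomial.pderiv_mul, MvPolynomial.pderiv_X]
    fin_cases a
    · simp only [Fin.zero_eta, bi_X_zero_mul, hp]
      rw [dP, dP, dirDerivation_comm]
      simp [bi_X_zero_mul, dP]
    · simp only [Fin.mk_one, bi_X_one_mul, hp]
      rw [dP, dP, dirDerivation_comm]
      simp [bi_X_one_mul, dP]
    · simp only [Fin.reduceFinMk, bi_X_two_mul, hp]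
      rw [dP, dX, dirDerivation_comm]
      simp [bi_X_two_mul, dX]
    · simp only [Fin.reduceFinMk, bi_X_three_mul, hp]
      rw [dP, dX, dirDerivation_comm]
      simp [bi_X_three_mul, dX]
    · simp only [Fin.reduceFinMk, bi_X_four_mul, hp, Derivation.leibniz, smul_eq_mul, dP_pCoord,
        map_add, mul_add]
      by_cases h : j = i
      · subst h
        simp only [if_true, Pi.single_eq_same, one_mul, mul_one]
        ring
      · simp [h]

theorem bi_swap (f g : smoothSymbols d) (r : BiPoly d) :
    bi f g r = bi g f (MvPolynomial.rename
      (fun v => ((![1, 0, 3, 2, 4] : Fin 5 → Fin 5) v.1, v.2)) r) := by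
  revert f g
  induction r using biPoly_induction with
  | hC c => intro f g; simp [bi_C, mul_comm]
  | hadd p q hp hq => intro f g; simp only [map_add, hp, hq]
  | hX a j p hp =>
    intro f g
    rw [map_mul (MvPolynomial.rename _), MvPolynomial.rename_X]
    fin_cases a
    · simp [bi_X_zero_mul, bi_X_one_mul, hp]
    · simp [bi_X_zero_mul, bi_X_one_mul, hp]
    · simp [bi_X_two_mul, bi_X_three_mul, hp]
    · simp [bi_X_two_mul, bi_X_three_mul, hp]
    · simp [bi_X_four_mul, hp]

variable (d) in
/-- Setting the derivatives of the right factor to zero. -/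
def leftPart : BiPoly d →ₐ[ℂ] BiPoly d :=
  MvPolynomial.aeval fun v => if v.1 = 1 ∨ v.1 = 2 then 0 else MvPolynomial.X v

theorem bi_zero_right (f : smoothSymbols d) (r : BiPoly d) : bi f 0 r = 0 := by
  induction r using MvPolynomial.induction_on' with
  | monomial m c => simp [bi_monomial, biMonomial]
  | add p q hp hq => rw [map_add, hp, hq, add_zero]

/-- Derivatives of the constant function 1 vanish, so only the part free of right derivatives
counts. That leaves the right slot open for the next factor of a star product. -/
theorem bi_one_right_mul (f g : smoothSymbols d) (r : BiPoly d) :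
    bi f 1 r * g = bi f g (leftPart d r) := by
  revert f
  induction r using biPoly_induction with
  | hC c => intro f; simp [bi_C, leftPart]
  | hadd p q hp hq => intro f; simp only [map_add, add_mul, hp]; simp only [hq]
  | hX a j p hp =>
    intro f
    rw [map_mul (leftPart d)]
    conv_rhs => enter [2, 1]; rw [leftPart, MvPolynomial.aeval_X]
    fin_cases a
    · simp [bi_X_zero_mul, hp]
    · simp [bi_X_one_mul, bi_zero_right]
    · simp [bi_X_two_mul, bi_zero_right]
    · simp [bi_X_three_mul, hp]
    · simp [bi_X_four_mul, hp, mul_assoc]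

theorem bi_leftPart (f : smoothSymbols d) (r : BiPoly d) : bi f 1 (leftPart d r) = bi f 1 r := by
  rw [← bi_one_right_mul, mul_one]

/-! ### Star products of bidifferential expressions -/

variable (d) in
/-- Scalar products of the vector variables of `BiPoly d`. -/
def pairing (a b : Fin 5) : BiPoly d := ∑ i, MvPolynomial.X (a, i) * MvPolynomial.X (b, i)

variable (d) in
/-- The action of `∇` on the momenta in the coefficients of the left factor. -/
def moyalDer : Derivation ℂ (BiPoly d) (BiPoly d) :=
  -∑ i, (MvPolynomial.X (2, i) : BiPoly d) • MvPolynomial.pderiv (4, i)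

variable (d) in
/-- The action of `∇` on the two factors of a bidifferential expression. -/
def moyalSym : BiPoly d := pairing d 3 1 - pairing d 2 0

variable (d) in
/-- The operator `∇` on bidifferential expressions. -/
def moyal : Module.End ℂ (BiPoly d) :=
  (moyalDer d).toLinearMap + LinearMap.mulLeft ℂ (moyalSym d)

theorem moyalDer_apply (r : BiPoly d) :
    moyalDer d r = -∑ i, MvPolynomial.X (2, i) * MvPolynomial.pderiv (4, i) r := by
  have h := map_sum (Derivation.coeFnAddMonoidHom (R := ℂ) (A := BiPoly d) (M := BiPoly d))
    (fun i => (MvPolynomial.X (2, i) : BiPoly d) • MvPolynomial.pderiv (4, i)) Finset.univ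
  have h' := congrFun h r
  simp only [Derivation.coeFnAddMonoidHom_apply, Finset.sum_apply] at h'
  simp only [moyalDer, Derivation.neg_apply, h', Derivation.smul_apply, smul_eq_mul]

theorem moyal_apply (r : BiPoly d) : moyal d r = moyalDer d r + moyalSym d * r := by
  simp [moyal]

theorem moyalDer_X_ne (a : Fin 5) (ha : a ≠ 4) (i : Fin d) :
    moyalDer d (MvPolynomial.X (a, i)) = 0 := by
  rw [moyalDer_apply, Finset.sum_eq_zero, neg_zero]
  intro j _
  rw [MvPolynomial.pderiv_X_of_ne (by simp [ha]), mul_zero]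

theorem moyalDer_X_four (i : Fin d) :
    moyalDer d (MvPolynomial.X (4, i)) = -MvPolynomial.X (2, i) := by
  rw [moyalDer_apply, Finset.sum_eq_single i]
  · simp
  · intro j _ hj
    rw [MvPolynomial.pderiv_X_of_ne (by simp [hj.symm]), mul_zero]
  · simp

/-- `∇` is a derivation plus a multiplication, so it is linear over the kernel of the derivation. -/
theorem moyal_pow_mul {z : BiPoly d} (hz : moyalDer d z = 0) (m : ℕ) (r : BiPoly d) :
    (moyal d ^ m) (z * r) = z * (moyal d ^ m) r := by
  induction m with
  | zero => simp
  | succ m ih =>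
    rw [pow_succ', Module.End.mul_apply, ih, Module.End.mul_apply, moyal_apply, moyal_apply,
      Derivation.leibniz, hz]
    simp
    ring

theorem leftPart_pderiv (i : Fin d) (r : BiPoly d) :
    leftPart d (MvPolynomial.pderiv (4, i) r) = MvPolynomial.pderiv (4, i) (leftPart d r) := by
  induction r using biPoly_induction with
  | hC c => simp [leftPart]
  | hadd p q hp hq => simp only [map_add, hp, hq]
  | hX a j p hp =>
    have h : leftPart d (MvPolynomial.pderiv (4, i) (MvPolynomial.X (a, j))) =
        MvPolynomial.pderiv (4, i) (leftPart d (MvPolynomial.X (a, j))) := by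
      rw [leftPart, MvPolynomial.aeval_X, MvPolynomial.pderiv_X]
      split_ifs with ha
      · rw [map_zero, Pi.single_eq_of_ne, map_zero]
        rintro ⟨⟩
        simp at ha
      · rw [MvPolynomial.pderiv_X]
        by_cases hv : (a, j) = ((4, i) : Fin 5 × Fin d)
        · rw [hv, Pi.single_eq_same, map_one]
        · rw [Pi.single_eq_of_ne hv, map_zero]
    simp only [MvPolynomial.pderiv_mul, map_mul (leftPart d), map_add, hp, h]

theorem sum_coe {ι : Type*} (s : Finset ι) (A : ι → smoothSymbols d) (x p : Phase d) :
    ∑ i ∈ s, (A i : Symbol d) x p = ((∑ i ∈ s, A i : smoothSymbols d) : Symbol d) x p := by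
  simp [Finset.sum_apply]

theorem sum_coe_sub (s : Finset (Fin d)) (A B : Fin d → smoothSymbols d) (x p : Phase d) :
    ∑ i ∈ s, ((A i : Symbol d) x p - (B i : Symbol d) x p) =
      ((∑ i ∈ s, (A i - B i) : smoothSymbols d) : Symbol d) x p := by
  simp [Finset.sum_apply]

/-- The position derivative of the left expression falls on `f` alone, while its momentum derivative
falls on `f` and on the coefficients. These three contributions are the terms of `moyal`, and the
recursion of `nablaPow` applies them once per step. -/
theorem nablaPow_bi (m : ℕ) (f g : smoothSymbols d) (r : BiPoly d) :
    nablaPow m (bi f 1 r : Symbol d) (g : Symbol d) =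
      (bi f g ((moyal d ^ m) (leftPart d r)) : Symbol d) := by
  induction m generalizing g r with
  | zero =>
    rw [pow_zero, Module.End.one_apply, ← bi_one_right_mul]
    rfl
  | succ m ih =>
    funext x p
    simp only [nablaPow, ← coe_dX, ← coe_dP, dX_bi, dP_bi, ih]
    rw [sum_coe_sub]
    refine congrFun (congrFun (congrArg Subtype.val ?_) x) p
    rw [pow_succ, Module.End.mul_apply, moyal_apply, moyalDer_apply, moyalSym, pairing, pairing]
    have h2 : ∀ i, leftPart d (MvPolynomial.X (2, i)) = 0 := fun i => by simp [leftPart]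
    have h3 : ∀ i, leftPart d (MvPolynomial.X (3, i)) = MvPolynomial.X (3, i) :=
      fun i => by simp [leftPart]
    have h0 : ∀ i, leftPart d (MvPolynomial.X (0, i)) = MvPolynomial.X (0, i) :=
      fun i => by simp [leftPart]
    have h1 : ∀ i, leftPart d (MvPolynomial.X (1, i)) = 0 := fun i => by simp [leftPart]
    have : -∑ i, MvPolynomial.X (2, i) * MvPolynomial.pderiv (4, i) (leftPart d r) +
        (∑ i, MvPolynomial.X (3, i) * MvPolynomial.X (1, i) -
          ∑ i, MvPolynomial.X (2, i) * MvPolynomial.X (0, i)) * leftPart d r =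
        ∑ i, (MvPolynomial.X (1, i) * (MvPolynomial.X (3, i) * leftPart d r) -
          MvPolynomial.X (2, i) * (MvPolynomial.pderiv (4, i) (leftPart d r) +
            MvPolynomial.X (0, i) * leftPart d r)) := by
      rw [← Finset.sum_sub_distrib, Finset.sum_mul, ← Finset.sum_neg_distrib,
        ← Finset.sum_add_distrib]
      exact Finset.sum_congr rfl fun i _ => by ring
    rw [this, map_sum (moyal d ^ m), map_sum (bi f g)]
    refine Finset.sum_congr rfl fun i _ => ?_
    rw [map_sub, map_sub, moyal_pow_mul (moyalDer_X_ne 1 (by decide) i),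
      moyal_pow_mul (moyalDer_X_ne 2 (by decide) i), bi_X_one_mul, bi_X_two_mul]
    simp only [map_add, map_mul (leftPart d), h0, h1, h2, h3, leftPart_pderiv, zero_add, add_zero]

theorem nablaPow_zero_right (m : ℕ) (f : Symbol d) : nablaPow m f 0 = 0 := by
  have h1 : ∀ i, dx i (0 : Symbol d) = 0 := fun i => by
    funext x p; simp [dx, lineDeriv]
  have h2 : ∀ i, dp i (0 : Symbol d) = 0 := fun i => by
    funext x p; simp [dp, lineDeriv]
  induction m generalizing f with
  | zero => funext x p; simp [nablaPow]
  | succ m ih => funext x p; simp [nablaPow, h1, h2, ih]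

variable (d) in
/-- The function `c - p²`. -/
def shiftedBackground (c : ℂ) : smoothSymbols d := algebraMap ℂ _ c - ∑ i, pCoord i ^ 2

theorem dX_shiftedBackground (c : ℂ) (i : Fin d) : dX i (shiftedBackground d c) = 0 := by
  simp [shiftedBackground, Derivation.leibniz_pow]

theorem dP_shiftedBackground (c : ℂ) (i : Fin d) :
    dP i (shiftedBackground d c) = (-2 : ℂ) • pCoord i := by
  simp only [shiftedBackground, map_sub, Derivation.map_algebraMap, map_sum,
    Derivation.leibniz_pow, dP_pCoord]
  rw [Finset.sum_eq_single i]
  · simp [two_smul]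
  · intro j _ hj
    simp [hj]
  · simp

variable (d) in
/-- The symbols of the operators `f ↦ f ∇^j (c - p²)`. -/
def backgroundSym (c : ℂ) : ℕ → BiPoly d
  | 0 => MvPolynomial.C c - pairing d 4 4
  | 1 => -2 * (pairing d 4 2 + pairing d 4 3)
  | 2 => -2 * (pairing d 2 2 + 2 * pairing d 2 3 + pairing d 3 3)
  | _ => 0

theorem bi_two_mul (f g : smoothSymbols d) (r : BiPoly d) :
    bi f g (-2 * r) = (-2 : ℂ) • bi f g r := by
  rw [← bi_C_mul]; simp [map_ofNat]

theorem nablaPow_smul_one (m : ℕ) (F : smoothSymbols d) (a : ℂ) :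
    nablaPow m (F : Symbol d) ((a • 1 : smoothSymbols d) : Symbol d) =
      ((if m = 0 then a • F else 0 : smoothSymbols d) : Symbol d) := by
  cases m with
  | zero =>
    funext x p
    simp [nablaPow, mul_comm]
  | succ m =>
    have h1 : ∀ i, dX i (a • 1 : smoothSymbols d) = 0 := fun i => by
      rw [Derivation.map_smul, Derivation.map_one_eq_zero, smul_zero]
    have h2 : ∀ i, dP i (a • 1 : smoothSymbols d) = 0 := fun i => by
      rw [Derivation.map_smul, Derivation.map_one_eq_zero, smul_zero]
    funext x p
    simp only [nablaPow, ← coe_dX, ← coe_dP, h1, h2, ZeroMemClass.coe_zero, nablaPow_zero_right]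
    simp

theorem nablaPow_smul_pCoord (m : ℕ) (F : smoothSymbols d) (a : ℂ) (j : Fin d) :
    nablaPow m (F : Symbol d) ((a • pCoord j : smoothSymbols d) : Symbol d) =
      ((if m = 0 then a • (pCoord j * F) else if m = 1 then a • dX j F else 0 :
        smoothSymbols d) : Symbol d) := by
  cases m with
  | zero =>
    funext x p
    simp [nablaPow, mul_comm, mul_left_comm]
  | succ m =>
    have h1 : ∀ i, dX i (a • pCoord j : smoothSymbols d) = 0 := fun i => by
      rw [Derivation.map_smul, dX_pCoord, smul_zero]
    have h2 : ∀ i, dP i (a • pCoord j : smoothSymbols d) = (if j = i then a else 0) • 1 :=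
      fun i => by
        rw [Derivation.map_smul, dP_pCoord]
        split_ifs <;> simp
    funext x p
    simp only [nablaPow, ← coe_dX, ← coe_dP, h1, h2, ZeroMemClass.coe_zero, nablaPow_zero_right,
      nablaPow_smul_one]
    rw [Finset.sum_eq_single j]
    · cases m <;> simp
    · intro i _ hi
      simp [hi.symm]
    · simp

theorem nablaPow_succ_background (c : ℂ) (m : ℕ) (F : smoothSymbols d) :
    nablaPow (m + 1) (F : Symbol d) (shiftedBackground d c : Symbol d) =
      ((∑ i, if m = 0 then (-2 : ℂ) • (pCoord i * dX i F) else
        if m = 1 then (-2 : ℂ) • dX i (dX i F) else 0 : smoothSymbols d) : Symbol d) := by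
  funext x p
  simp only [nablaPow, ← coe_dX, ← coe_dP, dX_shiftedBackground, dP_shiftedBackground,
    ZeroMemClass.coe_zero, nablaPow_zero_right, nablaPow_smul_pCoord]
  simp only [Pi.zero_apply, sub_zero, sum_coe]

/-- The right factor is independent of `x` and quadratic in `p`, so only `←∂ₓ →∂ₚ` acts and
everything beyond the second power vanishes. The derivative of the left expression is total, hence
the sum of the variables 2 and 3. -/
theorem nablaPow_background (c : ℂ) (j : ℕ) (f g : smoothSymbols d) (r : BiPoly d) :
    nablaPow j (bi f g r : Symbol d) (shiftedBackground d c : Symbol d) =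
      (bi f g (backgroundSym d c j * r) : Symbol d) := by
  match j with
  | 0 =>
    have : bi f g (backgroundSym d c 0 * r) = bi f g r * shiftedBackground d c := by
      simp only [backgroundSym, pairing, shiftedBackground, sub_mul, map_sub, Finset.sum_mul,
        map_sum, mul_assoc, bi_X_four_mul, bi_C_mul, mul_sub, Finset.mul_sum]
      rw [Algebra.algebraMap_eq_smul_one, mul_smul_comm, mul_one]
      congr 1
      exact Finset.sum_congr rfl fun i _ => by ring
    rw [this]
    rfl
  | 1 =>
    rw [nablaPow_succ_background]
    congr 1
    simp only [backgroundSym, pairing, mul_assoc, bi_two_mul, add_mul, map_add, Finset.sum_mul,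
      map_sum, bi_X_four_mul, dX_bi, if_true, ← Finset.smul_sum, mul_add, Finset.sum_add_distrib,
      smul_add]
  | 2 =>
    rw [nablaPow_succ_background]
    congr 1
    simp only [if_true, one_ne_zero, if_false, ← Finset.smul_sum, backgroundSym, mul_assoc,
      bi_two_mul, dX_bi]
    rw [← map_sum]
    congr 2
    simp only [pairing, Finset.mul_sum, add_mul, Finset.sum_mul, ← Finset.sum_add_distrib]
    exact Finset.sum_congr rfl fun i _ => by ring
  | m + 3 =>
    rw [nablaPow_succ_background]
    simp [backgroundSym]

/-! ### Star powers of the Hamiltonian -/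

/-- The coefficients of `exp (iħt/2)` as a power series in `ħ`. -/
def moyalCoeff (j : ℕ) : ℂ := (Complex.I / 2) ^ j / (j.factorial : ℂ)

theorem moyalCoeff_succ (j : ℕ) :
    moyalCoeff (j + 1) * ((j + 1 : ℕ) : ℂ) = Complex.I / 2 * moyalCoeff j := by
  have : ((j + 1 : ℕ) : ℂ) ≠ 0 := Nat.cast_ne_zero.2 j.succ_ne_zero
  have h2 : (j.factorial : ℂ) ≠ 0 := Nat.cast_ne_zero.2 j.factorial_ne_zero
  rw [moyalCoeff, moyalCoeff, Nat.factorial_succ, Nat.cast_mul, pow_succ]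
  field_simp

/-- The operator `exp (iħ∇/2)` on power series of bidifferential expressions. -/
def moyalExp (y : PowerSeries (BiPoly d)) : PowerSeries (BiPoly d) :=
  PowerSeries.mk fun k => ∑ b ∈ Finset.HasAntidiagonal.antidiagonal k,
    MvPolynomial.C (moyalCoeff b.2) * (moyal d ^ b.2) (PowerSeries.coeff b.1 y)

theorem moyalExp_add (y z : PowerSeries (BiPoly d)) :
    moyalExp (y + z) = moyalExp y + moyalExp z := by
  ext1 k
  simp [moyalExp, mul_add, Finset.sum_add_distrib]

/-- Multiplication by `w` before `exp (iħ∇/2)` amounts to multiplication by `w'` after it. -/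
def MoyalIntertwines (w w' : PowerSeries (BiPoly d)) : Prop :=
  ∀ y, moyalExp (w * y) = w' * moyalExp y

theorem MoyalIntertwines.add {w w' v v' : PowerSeries (BiPoly d)} (h : MoyalIntertwines w w')
    (h' : MoyalIntertwines v v') : MoyalIntertwines (w + v) (w' + v') := fun y => by
  rw [add_mul, moyalExp_add, h, h', add_mul]

theorem MoyalIntertwines.mul {w w' v v' : PowerSeries (BiPoly d)} (h : MoyalIntertwines w w')
    (h' : MoyalIntertwines v v') : MoyalIntertwines (w * v) (w' * v') := fun y => by
  rw [mul_assoc, h, h', mul_assoc]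

theorem moyalIntertwines_C {z : BiPoly d} (hz : moyalDer d z = 0) :
    MoyalIntertwines (PowerSeries.C z) (PowerSeries.C z) := fun y => by
  ext1 k
  simp only [moyalExp, PowerSeries.coeff_mk, PowerSeries.coeff_C_mul, moyal_pow_mul hz,
    Finset.mul_sum]
  exact Finset.sum_congr rfl fun b _ => by ring

theorem moyalIntertwines_X :
    MoyalIntertwines (PowerSeries.X : PowerSeries (BiPoly d)) PowerSeries.X := fun y => by
  ext1 k
  cases k with
  | zero => simp [moyalExp]
  | succ k =>
    simp only [moyalExp, PowerSeries.coeff_mk, PowerSeries.coeff_succ_X_mul,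
      Finset.Nat.sum_antidiagonal_succ, PowerSeries.coeff_zero_X_mul, map_zero, mul_zero, zero_add]

theorem MoyalIntertwines.sum {ι : Type*} (s : Finset ι) {w w' : ι → PowerSeries (BiPoly d)}
    (h : ∀ i ∈ s, MoyalIntertwines (w i) (w' i)) :
    MoyalIntertwines (∑ i ∈ s, w i) (∑ i ∈ s, w' i) := by
  classical
  induction s using Finset.induction_on with
  | empty =>
    intro y
    ext1 k
    simp [moyalExp]
  | insert a s ha ih =>
    rw [Finset.sum_insert ha, Finset.sum_insert ha]
    exact (h a (Finset.mem_insert_self a s)).add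
      (ih fun i hi => h i (Finset.mem_insert_of_mem hi))

/-- The commutator of `∇` with `pᵢ` is `-X (2, i)`, which commutes with `∇`; the commutator with a
power of `∇` is therefore obtained as for a derivative. -/
theorem moyal_pow_momentum (i : Fin d) (j : ℕ) (r : BiPoly d) :
    (moyal d ^ (j + 1)) (MvPolynomial.X (4, i) * r) =
      MvPolynomial.X (4, i) * (moyal d ^ (j + 1)) r -
        MvPolynomial.C ((j + 1 : ℕ) : ℂ) * (MvPolynomial.X (2, i) * (moyal d ^ j) r) := by
  have step : ∀ r : BiPoly d, moyal d (MvPolynomial.X (4, i) * r) =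
      MvPolynomial.X (4, i) * moyal d r - MvPolynomial.X (2, i) * r := fun r => by
    rw [moyal_apply, moyal_apply, Derivation.leibniz, moyalDer_X_four]
    simp
    ring
  induction j with
  | zero => simp [step]
  | succ j ih =>
    rw [pow_succ', Module.End.mul_apply, ih, map_sub, step]
    have h2 := moyal_pow_mul (moyalDer_X_ne 2 (by decide) i) 1 ((moyal d ^ j) r)
    have h3 : ∀ c : ℂ, ∀ r : BiPoly d, moyal d (MvPolynomial.C c * r) =
        MvPolynomial.C c * moyal d r := fun c r => by
      rw [← MvPolynomial.smul_eq_C_mul, map_smul, MvPolynomial.smul_eq_C_mul]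
    rw [pow_one] at h2
    have h4 : moyal d ((moyal d ^ j) r) = (moyal d ^ (j + 1)) r := by
      rw [pow_succ', Module.End.mul_apply]
    have h5 : moyal d ((moyal d ^ (j + 1)) r) = (moyal d ^ (j + 1 + 1)) r := by
      rw [pow_succ' _ (j + 1), Module.End.mul_apply]
    rw [h3, h2, h4, ← Module.End.mul_apply, ← pow_succ']
    push_cast
    simp only [map_add, map_one]
    ring

/-- Conjugation by `exp (iħ∇/2)` shifts `p` by `-iħ/2` times the position derivative of the right
factor; the commutator series stops after its first term. -/
theorem moyalIntertwines_momentum (i : Fin d) :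
    MoyalIntertwines (PowerSeries.C (MvPolynomial.X (4, i)))
      (PowerSeries.C (MvPolynomial.X (4, i)) -
        PowerSeries.X * PowerSeries.C (MvPolynomial.C (Complex.I / 2) *
          MvPolynomial.X (2, i))) := fun y => by
  ext1 k
  rw [sub_mul, mul_assoc, map_sub]
  cases k with
  | zero => simp [moyalExp, mul_left_comm]
  | succ k =>
    simp only [moyalExp, PowerSeries.coeff_mk, PowerSeries.coeff_C_mul,
      PowerSeries.coeff_succ_X_mul, Finset.Nat.sum_antidiagonal_succ', moyal_pow_momentum,
      pow_zero, Module.End.one_apply, mul_sub, Finset.sum_sub_distrib, Finset.mul_sum, mul_add]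
    have : ∀ b : ℕ × ℕ, MvPolynomial.C (moyalCoeff (b.2 + 1)) *
        (MvPolynomial.C ((b.2 + 1 : ℕ) : ℂ) * (MvPolynomial.X (2, i) *
          (moyal d ^ b.2) (PowerSeries.coeff b.1 y))) =
        MvPolynomial.C (Complex.I / 2) * MvPolynomial.X (2, i) * (MvPolynomial.C (moyalCoeff b.2) *
          (moyal d ^ b.2) (PowerSeries.coeff b.1 y)) := fun b => by
      rw [← mul_assoc, ← map_mul, moyalCoeff_succ, map_mul]
      ring
    simp only [this, mul_left_comm _ (MvPolynomial.X (4, i) : BiPoly d)]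
    ring

/-- `c - (p + iħv/2)²`. -/
def shiftedSeries (c : ℂ) (v : Fin d → BiPoly d) : PowerSeries (BiPoly d) :=
  PowerSeries.C (MvPolynomial.C c) - ∑ i, (PowerSeries.C (MvPolynomial.X (4, i)) +
    PowerSeries.X * PowerSeries.C (MvPolynomial.C (Complex.I / 2) * v i)) ^ 2

theorem shiftedSeries_eq (c : ℂ) (v : Fin d → BiPoly d) :
    shiftedSeries c v = PowerSeries.C (MvPolynomial.C c - pairing d 4 4) +
      PowerSeries.X * PowerSeries.C (-MvPolynomial.C Complex.I *
        ∑ i, MvPolynomial.X (4, i) * v i) +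
      PowerSeries.X ^ 2 * PowerSeries.C (MvPolynomial.C (1 / 4) * ∑ i, v i ^ 2) := by
  have e1 : (MvPolynomial.C Complex.I : BiPoly d) = 2 * MvPolynomial.C (Complex.I / 2) := by
    rw [← map_ofNat MvPolynomial.C 2, ← map_mul]; congr 1; ring
  have e2 : (MvPolynomial.C (1 / 4) : BiPoly d) = -MvPolynomial.C (Complex.I / 2) ^ 2 := by
    rw [← map_pow, ← map_neg, div_pow, Complex.I_sq]; congr 1; norm_num
  rw [shiftedSeries, e1, e2, pairing, map_sub, sub_eq_add_neg, sub_eq_add_neg, add_assoc, add_assoc]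
  congr 1
  simp only [map_sum, map_mul, map_neg, Finset.mul_sum, ← Finset.sum_neg_distrib,
    ← Finset.sum_add_distrib, map_pow, map_ofNat]
  exact Finset.sum_congr rfl fun i _ => by ring

theorem MoyalIntertwines.shiftedSeries (c : ℂ) {v : Fin d → BiPoly d}
    (hv : ∀ i, moyalDer d (v i) = 0) :
    MoyalIntertwines (shiftedSeries c v)
      (shiftedSeries c fun i => v i - MvPolynomial.X (2, i)) := by
  have hC : ∀ a : ℂ, moyalDer d (MvPolynomial.C a) = 0 := fun a => (moyalDer d).map_algebraMap a
  have h1 : ∀ i, MoyalIntertwines (PowerSeries.C (MvPolynomial.X (4, i)) +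
      PowerSeries.X * PowerSeries.C (MvPolynomial.C (Complex.I / 2) * v i))
      (PowerSeries.C (MvPolynomial.X (4, i)) + PowerSeries.X *
        PowerSeries.C (MvPolynomial.C (Complex.I / 2) * (v i - MvPolynomial.X (2, i)))) := by
    intro i
    have := (moyalIntertwines_momentum i).add ((moyalIntertwines_X (d := d)).mul
      (moyalIntertwines_C (z := MvPolynomial.C (Complex.I / 2) * v i)
        (by rw [Derivation.leibniz, hv, hC]; simp)))
    convert this using 1
    simp only [mul_sub, map_sub]
    ring
  have h2 : MoyalIntertwines (-1 : PowerSeries (BiPoly d)) (-1) := by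
    have := moyalIntertwines_C (z := (-1 : BiPoly d)) (by simp)
    simpa using this
  have h3 := (moyalIntertwines_C (hC c)).add
    (h2.mul (MoyalIntertwines.sum Finset.univ fun i _ => (h1 i).mul (h1 i)))
  simpa only [QuantizedVolume.shiftedSeries, neg_one_mul, ← sub_eq_add_neg, ← sq] using h3

theorem coeff_quadratic {A : Type*} [CommRing A] (a b c : A) (j : ℕ) :
    PowerSeries.coeff j (PowerSeries.C a + PowerSeries.X * PowerSeries.C b +
      PowerSeries.X ^ 2 * PowerSeries.C c) =
      if j = 0 then a else if j = 1 then b else if j = 2 then c else 0 := by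
  match j with
  | 0 => simp
  | 1 => simp [PowerSeries.coeff_X, PowerSeries.coeff_succ_X_mul, pow_two, mul_assoc]
  | 2 => simp [PowerSeries.coeff_X, PowerSeries.coeff_succ_X_mul, pow_two, mul_assoc]
  | j + 3 => simp [PowerSeries.coeff_X, PowerSeries.coeff_succ_X_mul, pow_two, mul_assoc]

/-- Summed over all powers of `∇`, right star multiplication by `c - p²` becomes the Bopp shift of
`p` by `iħ/2` times the total position derivative. -/
theorem shiftedSeries_background (c : ℂ) :
    shiftedSeries c (fun i => MvPolynomial.X (2, i) + MvPolynomial.X (3, i)) =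
      PowerSeries.mk fun j => MvPolynomial.C (moyalCoeff j) * backgroundSym d c j := by
  rw [shiftedSeries_eq]
  ext1 k
  rw [coeff_quadratic, PowerSeries.coeff_mk]
  match k with
  | 0 => simp [moyalCoeff, backgroundSym]
  | 1 =>
    have h : (-MvPolynomial.C Complex.I : BiPoly d) = MvPolynomial.C (moyalCoeff 1) * -2 := by
      rw [← map_ofNat MvPolynomial.C 2, ← map_neg, ← map_neg, ← map_mul]
      congr 1
      simp [moyalCoeff]
    rw [if_neg one_ne_zero, if_pos rfl, h, backgroundSym, mul_assoc, pairing, pairing,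
      ← Finset.sum_add_distrib]
    simp only [mul_add]
  | 2 =>
    have h : (MvPolynomial.C (1 / 4) : BiPoly d) = MvPolynomial.C (moyalCoeff 2) * -2 := by
      rw [← map_ofNat MvPolynomial.C 2, ← map_neg, ← map_mul]
      congr 1
      simp only [moyalCoeff, div_pow, Complex.I_sq, Nat.factorial]
      norm_num
    rw [if_neg two_ne_zero, if_neg (by decide), if_pos rfl, h, backgroundSym, mul_assoc, pairing,
      pairing, pairing]
    congr 1
    simp only [Finset.mul_sum, ← Finset.sum_add_distrib]
    exact Finset.sum_congr rfl fun i _ => by ring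
  | k + 3 => simp [backgroundSym]

/-- `moyalSym` contains no momenta, so the derivation part of `∇` never acts. -/
theorem moyalExp_one : moyalExp (1 : PowerSeries (BiPoly d)) =
    PowerSeries.mk fun k => MvPolynomial.C (moyalCoeff k) * moyalSym d ^ k := by
  have hs : moyalDer d (moyalSym d) = 0 := by
    simp only [moyalSym, pairing, map_sub, map_sum, Derivation.leibniz, moyalDer_X_ne 3 (by decide),
      moyalDer_X_ne 1 (by decide), moyalDer_X_ne 2 (by decide), moyalDer_X_ne 0 (by decide),
      smul_zero, add_zero, Finset.sum_const_zero, sub_zero]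
  have hp : ∀ k, (moyal d ^ k) 1 = moyalSym d ^ k := fun k => by
    induction k with
    | zero => simp
    | succ k ih =>
      rw [pow_succ, Module.End.mul_apply, moyal_apply, Derivation.map_one_eq_zero, zero_add,
        moyal_pow_mul hs, ih, pow_succ']
  ext1 k
  rw [moyalExp, PowerSeries.coeff_mk, PowerSeries.coeff_mk,
    Finset.sum_eq_single (0, k) _ (by simp)]
  · simp [hp]
  · rintro ⟨a, b⟩ hab hne
    have : a ≠ 0 := by
      rintro rfl
      simp at hab
      simp [hab] at hne
    simp [PowerSeries.coeff_one, this]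

variable (d) in
/-- Interchange of the two factors, after setting the derivatives of the left one to zero. -/
def rightPart : BiPoly d →ₐ[ℂ] BiPoly d :=
  (leftPart d).comp (MvPolynomial.rename
    (fun v => ((![1, 0, 3, 2, 4] : Fin 5 → Fin 5) v.1, v.2)))

theorem bi_rightPart (f : smoothSymbols d) (r : BiPoly d) :
    bi 1 f r = bi f 1 (rightPart d r) := by
  rw [bi_swap, ← bi_leftPart]
  rfl

theorem map_shiftedSeries (φ : BiPoly d →ₐ[ℂ] BiPoly d)
    (hφ : ∀ i, φ (MvPolynomial.X (4, i)) = MvPolynomial.X (4, i)) (c : ℂ) (v : Fin d → BiPoly d) :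
    PowerSeries.map (φ : BiPoly d →+* BiPoly d) (shiftedSeries c v) =
      shiftedSeries c fun i => φ (v i) := by
  have hC : ∀ a, φ (MvPolynomial.C a) = MvPolynomial.C a := fun a => φ.commutes a
  simp only [shiftedSeries, map_sub, map_sum, map_pow, map_add, map_mul, PowerSeries.map_C,
    PowerSeries.map_X, RingHom.coe_coe, hC, hφ]

theorem leftPart_X (a : Fin 5) (i : Fin d) : leftPart d (MvPolynomial.X (a, i)) =
    if a = 1 ∨ a = 2 then 0 else MvPolynomial.X (a, i) := by
  rw [leftPart, MvPolynomial.aeval_X]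

theorem rightPart_X (a : Fin 5) (i : Fin d) : rightPart d (MvPolynomial.X (a, i)) =
    (![0, MvPolynomial.X (0, i), MvPolynomial.X (3, i), 0, MvPolynomial.X (4, i)] :
      Fin 5 → BiPoly d) a := by
  rw [rightPart, AlgHom.comp_apply, MvPolynomial.rename_X, leftPart_X]
  fin_cases a <;> simp

/-- The left derivative part of the first-order star power. -/
def linearSeries (c : ℂ) : ℕ → PowerSeries (BiPoly d)
  | 0 => 0
  | n + 1 => shiftedSeries c (fun i => MvPolynomial.X (3, i)) * linearSeries c n +
      shiftedSeries c (fun i => -MvPolynomial.X (3, i)) ^ n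

/-- The image of `linearSeries` under `exp (iħ∇/2)`. -/
def middleSeries (c : ℂ) : ℕ → PowerSeries (BiPoly d)
  | 0 => 0
  | n + 1 => shiftedSeries c (fun i => MvPolynomial.X (3, i) - MvPolynomial.X (2, i)) *
      middleSeries c n +
      shiftedSeries c (fun i => -MvPolynomial.X (3, i) - MvPolynomial.X (2, i)) ^ n

/-- The second-order part of the star power. -/
def quadraticSeries (c : ℂ) : ℕ → PowerSeries (BiPoly d)
  | 0 => 0
  | n + 1 => shiftedSeries c (fun i => MvPolynomial.X (2, i) + MvPolynomial.X (3, i)) *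
      quadraticSeries c n + middleSeries c n * moyalExp 1

theorem MoyalIntertwines.pow {w w' : PowerSeries (BiPoly d)} (h : MoyalIntertwines w w') (n : ℕ) :
    MoyalIntertwines (w ^ n) (w' ^ n) := by
  induction n with
  | zero => intro y; simp
  | succ n ih => rw [pow_succ, pow_succ]; exact ih.mul h

theorem moyalExp_linearSeries (c : ℂ) (n : ℕ) :
    moyalExp (linearSeries (d := d) c n) = middleSeries c n * moyalExp 1 := by
  induction n with
  | zero =>
    ext1 k
    simp [linearSeries, middleSeries, moyalExp]
  | succ n ih =>
    have h3 := fun i => moyalDer_X_ne (d := d) 3 (by decide) i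
    have h := (MoyalIntertwines.shiftedSeries c (v := fun i : Fin d => -MvPolynomial.X (3, i))
      fun i => by rw [map_neg, h3, neg_zero]).pow n 1
    rw [mul_one] at h
    rw [linearSeries, moyalExp_add, MoyalIntertwines.shiftedSeries c h3, ih, middleSeries, h]
    ring

theorem map_leftPart_linearSeries (c : ℂ) (n : ℕ) :
    PowerSeries.map (leftPart d : BiPoly d →+* BiPoly d) (linearSeries c n) =
      linearSeries c n := by
  induction n with
  | zero => simp [linearSeries]
  | succ n ih =>
    rw [linearSeries, map_add, map_mul, ih, map_pow, map_shiftedSeries _ (by simp [leftPart_X]),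
      map_shiftedSeries _ (by simp [leftPart_X])]
    simp [leftPart_X]

/-- Star multiplication from the left by a power of `c - p²` is the Bopp shift with the opposite
sign. The remaining factor `moyalExp 1` reduces to 1, because the original left factor is constant.
-/
theorem map_rightPart_shiftedSeries_pow (c : ℂ) (n : ℕ) :
    PowerSeries.map (rightPart d : BiPoly d →+* BiPoly d)
      (moyalExp (shiftedSeries c (fun _ => 0) ^ n)) =
      shiftedSeries c (fun i => -MvPolynomial.X (3, i)) ^ n := by
  have h := (MoyalIntertwines.shiftedSeries c (v := fun _ : Fin d => 0)
      fun i => map_zero _).pow n 1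
  rw [mul_one] at h
  rw [h, map_mul, map_pow, map_shiftedSeries _ (by simp [rightPart_X])]
  have : PowerSeries.map (rightPart d : BiPoly d →+* BiPoly d) (moyalExp 1) = 1 := by
    rw [moyalExp_one]
    ext1 k
    have hs : rightPart d (moyalSym d) = 0 := by
      simp [moyalSym, pairing, rightPart_X]
    rw [PowerSeries.coeff_map, PowerSeries.coeff_mk, PowerSeries.coeff_one, RingHom.coe_coe,
      map_mul, map_pow, hs]
    cases k <;> simp [moyalCoeff]
  rw [this, mul_one]
  simp [rightPart_X]

/-! ### Perturbative expansion of star powers with a frozen background value -/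

/-- The Hamiltonian minus the value of the background at the momentum `q`. -/
def shiftedHamiltonian (D : ℝ) (h : Symbol d) (q : Phase d) : FormalSymbol d :=
  hamiltonian D h - const (background D q : ℂ)

theorem shiftedHamiltonian_zero (D : ℝ) (h : Symbol d) (q : Phase d) :
    shiftedHamiltonian D h q 0 0 = (shiftedBackground d ((‖q‖ ^ 2 : ℝ) : ℂ) : Symbol d) := by
  funext x p
  have : ((shiftedBackground d ((‖q‖ ^ 2 : ℝ) : ℂ) : smoothSymbols d) : Symbol d) x p =
      ((‖q‖ ^ 2 : ℝ) : ℂ) - ∑ i, ((p i : ℝ) : ℂ) ^ 2 := by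
    simp only [shiftedBackground, AddSubgroupClass.coe_sub, Pi.sub_apply, ← sum_coe]
    rfl
  rw [this]
  simp only [shiftedHamiltonian, hamiltonian, const, background, Pi.sub_apply]
  rw [EuclideanSpace.norm_sq_eq p]
  push_cast
  simp only [Real.norm_eq_abs, ← Complex.ofReal_pow, sq_abs]
  ring

theorem shiftedHamiltonian_one (D : ℝ) (h : Symbol d) (q : Phase d) :
    shiftedHamiltonian D h q 1 0 = h := by
  funext x p
  simp [shiftedHamiltonian, hamiltonian, const]

theorem shiftedHamiltonian_eq_zero (D : ℝ) (h : Symbol d) (q : Phase d) (a c : ℕ)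
    (hac : 1 < a ∨ c ≠ 0) : shiftedHamiltonian D h q a c = 0 := by
  funext x p
  match a, c, hac with
  | 0, 0, h => simp at h
  | 1, 0, h => simp at h
  | 0, c + 1, _ => simp [shiftedHamiltonian, hamiltonian, const]
  | 1, c + 1, _ => simp [shiftedHamiltonian, hamiltonian, const]
  | a + 2, c, _ => simp [shiftedHamiltonian, hamiltonian, const]

theorem star_shiftedHamiltonian_aux (B : FormalSymbol d) (D : ℝ) (h : Symbol d) (q : Phase d)
    (l a k : ℕ) (x p : Phase d) :
    ∑ b ∈ Finset.HasAntidiagonal.antidiagonal k, ∑ c ∈ Finset.HasAntidiagonal.antidiagonal b.1,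
      ((Complex.I / 2) ^ b.2 / (b.2.factorial : ℂ)) *
        nablaPow b.2 (B l c.1) (shiftedHamiltonian D h q a c.2) x p =
    ∑ b ∈ Finset.HasAntidiagonal.antidiagonal k, moyalCoeff b.2 *
        nablaPow b.2 (B l b.1) (shiftedHamiltonian D h q a 0) x p := by
  refine Finset.sum_congr rfl fun b _ => ?_
  rw [Finset.sum_eq_single (b.1, 0) _ (by simp)]
  · rfl
  · rintro ⟨c, e⟩ hce hne
    have : e ≠ 0 := by
      rintro rfl
      simp at hce
      simp [hce] at hne
    rw [shiftedHamiltonian_eq_zero D h q a e (Or.inr this), nablaPow_zero_right]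
    simp

theorem star_shiftedHamiltonian_zero (B : FormalSymbol d) (D : ℝ) (h : Symbol d) (q : Phase d)
    (k : ℕ) (x p : Phase d) :
    star B (shiftedHamiltonian D h q) 0 k x p =
      ∑ b ∈ Finset.HasAntidiagonal.antidiagonal k, moyalCoeff b.2 *
        nablaPow b.2 (B 0 b.1) (shiftedBackground d ((‖q‖ ^ 2 : ℝ) : ℂ) : Symbol d) x p := by
  simp only [star, star_shiftedHamiltonian_aux]
  simp [shiftedHamiltonian_zero]

theorem star_shiftedHamiltonian_succ (B : FormalSymbol d) (D : ℝ) (h : Symbol d) (q : Phase d)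
    (l k : ℕ) (x p : Phase d) :
    star B (shiftedHamiltonian D h q) (l + 1) k x p =
      ∑ b ∈ Finset.HasAntidiagonal.antidiagonal k, moyalCoeff b.2 *
        nablaPow b.2 (B (l + 1) b.1) (shiftedBackground d ((‖q‖ ^ 2 : ℝ) : ℂ) : Symbol d) x p +
      ∑ b ∈ Finset.HasAntidiagonal.antidiagonal k, moyalCoeff b.2 *
        nablaPow b.2 (B l b.1) h x p := by
  simp only [star, star_shiftedHamiltonian_aux]
  rw [Finset.Nat.sum_antidiagonal_succ', add_comm]
  simp only
  rw [Finset.sum_eq_single (l, 0) _ (by simp)]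
  · rw [shiftedHamiltonian_zero, shiftedHamiltonian_one, add_comm]
  · rintro ⟨c, e⟩ hce hne
    have : e ≠ 0 := by
      rintro rfl
      simp at hce
      simp [hce] at hne
    refine Finset.sum_eq_zero fun b _ => ?_
    rw [shiftedHamiltonian_eq_zero D h q (e + 1) 0 (Or.inl (by omega)), nablaPow_zero_right]
    simp

theorem sum_moyalCoeff_bi (f g : smoothSymbols d) (s : Finset (ℕ × ℕ)) (r : ℕ × ℕ → BiPoly d)
    (x p : Phase d) :
    ∑ b ∈ s, moyalCoeff b.2 * (bi f g (r b) : Symbol d) x p =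
      (bi f g (∑ b ∈ s, MvPolynomial.C (moyalCoeff b.2) * r b) : Symbol d) x p := by
  simp only [map_sum, bi_C_mul, ← sum_coe]
  rfl

theorem sum_nablaPow_background (f g : smoothSymbols d) (y : PowerSeries (BiPoly d)) (c : ℂ)
    (k : ℕ) (x p : Phase d) :
    ∑ b ∈ Finset.HasAntidiagonal.antidiagonal k, moyalCoeff b.2 *
      nablaPow b.2 (bi f g (PowerSeries.coeff b.1 y) : Symbol d)
        (shiftedBackground d c : Symbol d) x p =
    (bi f g (PowerSeries.coeff k
      (shiftedSeries c (fun i => MvPolynomial.X (2, i) + MvPolynomial.X (3, i)) * y)) :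
        Symbol d) x p := by
  simp only [nablaPow_background]
  rw [sum_moyalCoeff_bi, mul_comm, PowerSeries.coeff_mul, shiftedSeries_background]
  refine congrFun (congrFun (congrArg Subtype.val (congrArg _ ?_)) x) p
  refine Finset.sum_congr rfl fun b _ => ?_
  rw [PowerSeries.coeff_mk]
  ring

theorem sum_nablaPow_bi (f g : smoothSymbols d) (y : PowerSeries (BiPoly d))
    (hy : PowerSeries.map (leftPart d : BiPoly d →+* BiPoly d) y = y) (k : ℕ) (x p : Phase d) :
    ∑ b ∈ Finset.HasAntidiagonal.antidiagonal k, moyalCoeff b.2 *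
      nablaPow b.2 (bi f 1 (PowerSeries.coeff b.1 y) : Symbol d) (g : Symbol d) x p =
    (bi f g (PowerSeries.coeff k (moyalExp y)) : Symbol d) x p := by
  have hy' : ∀ j, leftPart d (PowerSeries.coeff j y) = PowerSeries.coeff j y := fun j => by
    conv_rhs => rw [← hy, PowerSeries.coeff_map]
    rfl
  simp only [nablaPow_bi, hy']
  rw [sum_moyalCoeff_bi, moyalExp, PowerSeries.coeff_mk]

theorem starPow_zeroth (D : ℝ) (h : Symbol d) (q : Phase d) (n k : ℕ) :
    starPow (shiftedHamiltonian D h q) n 0 k = (bi (1 : smoothSymbols d) 1 (PowerSeries.coeff k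
      (shiftedSeries ((‖q‖ ^ 2 : ℝ) : ℂ) (fun _ => 0) ^ n)) : Symbol d) := by
  induction n generalizing k with
  | zero =>
    funext x p
    cases k with
    | zero =>
      have : bi (1 : smoothSymbols d) 1 (PowerSeries.coeff 0 (1 : PowerSeries (BiPoly d))) = 1 := by
        rw [PowerSeries.coeff_zero_one, bi_one, mul_one]
      rw [pow_zero, this]
      rfl
    | succ k =>
      rw [pow_zero, PowerSeries.coeff_one, if_neg k.succ_ne_zero, map_zero]
      rfl
  | succ n ih =>
    funext x p
    rw [starPow, star_shiftedHamiltonian_zero]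
    simp only [ih]
    -- Both arguments are the constant 1, so all derivatives may be deleted from the symbol and the
    -- Bopp shift becomes ordinary multiplication.
    rw [sum_nablaPow_background, ← bi_leftPart, bi_rightPart]
    refine congrFun (congrFun (congrArg Subtype.val (congrArg _ ?_)) x) p
    set φ := (rightPart d).comp (leftPart d) with hφ
    have h1 : ∀ y : PowerSeries (BiPoly d), rightPart d (leftPart d (PowerSeries.coeff k y)) =
        PowerSeries.coeff k (PowerSeries.map (φ : BiPoly d →+* BiPoly d) y) := fun y => by
      rw [PowerSeries.coeff_map]; rfl
    rw [h1, map_mul, map_pow, map_shiftedSeries _ (by simp [φ, rightPart_X, leftPart_X]),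
      map_shiftedSeries _ (by simp [φ, rightPart_X, leftPart_X]),
      pow_succ' (shiftedSeries _ _)]
    simp [φ, rightPart_X, leftPart_X]

/-- Either the fluctuation already sits among the first `n` factors and the background is multiplied
on from the right, or it is the last factor and all powers of the background stand to its left.
These are the two terms in the recursion of `linearSeries`. -/
theorem starPow_first (D : ℝ) (h : smoothSymbols d) (q : Phase d) (n k : ℕ) :
    starPow (shiftedHamiltonian D (h : Symbol d) q) n 1 k =
      (bi h 1 (PowerSeries.coeff k (linearSeries ((‖q‖ ^ 2 : ℝ) : ℂ) n)) : Symbol d) := by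
  induction n generalizing k with
  | zero =>
    funext x p
    rw [linearSeries, map_zero, map_zero]
    rfl
  | succ n ih =>
    funext x p
    rw [starPow, star_shiftedHamiltonian_succ]
    simp only [ih, starPow_zeroth]
    rw [sum_nablaPow_background, sum_nablaPow_bi, bi_rightPart, ← bi_leftPart, linearSeries,
      ← map_rightPart_shiftedSeries_pow, map_add, map_add]
    · simp only [PowerSeries.coeff_map, RingHom.coe_coe]
      refine congrArg₂ (· + ·) (congrFun (congrFun (congrArg Subtype.val (congrArg _ ?_)) x) p) rfl
      have h1 : ∀ y : PowerSeries (BiPoly d), leftPart d (PowerSeries.coeff k y) =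
          PowerSeries.coeff k (PowerSeries.map (leftPart d : BiPoly d →+* BiPoly d) y) := fun y => by
        rw [PowerSeries.coeff_map]; rfl
      rw [h1, map_mul, map_leftPart_linearSeries, map_shiftedSeries _ (by simp [leftPart_X])]
      simp [leftPart_X]
    · rw [map_pow, map_shiftedSeries _ (by simp [leftPart_X])]
      simp

/-- The last factor is the background, or it is the second fluctuation. In the latter case the full
`exp (iħ∇/2)` acts between the first-order part and `h`, which is why `middleSeries` carries the
shifted arguments. -/
theorem starPow_second (D : ℝ) (h : smoothSymbols d) (q : Phase d) (n k : ℕ) :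
    starPow (shiftedHamiltonian D (h : Symbol d) q) n 2 k =
      (bi h h (PowerSeries.coeff k (quadraticSeries ((‖q‖ ^ 2 : ℝ) : ℂ) n)) : Symbol d) := by
  induction n generalizing k with
  | zero =>
    funext x p
    rw [quadraticSeries, map_zero, map_zero]
    rfl
  | succ n ih =>
    funext x p
    rw [starPow, star_shiftedHamiltonian_succ]
    simp only [ih, starPow_first]
    rw [sum_nablaPow_background, sum_nablaPow_bi _ _ _ (map_leftPart_linearSeries _ _),
      quadraticSeries, moyalExp_linearSeries, map_add, map_add]
    rfl

/-! ### The second-order star Taylor coefficients -/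

/-- `p² - (p + iħv/2)²`. -/
def shiftIncrement (v : Fin d → BiPoly d) : PowerSeries (BiPoly d) :=
  PowerSeries.X * PowerSeries.C (-MvPolynomial.C Complex.I * ∑ i, MvPolynomial.X (4, i) * v i) +
    PowerSeries.X ^ 2 * PowerSeries.C (MvPolynomial.C (1 / 4) * ∑ i, v i ^ 2)

variable (d) in
/-- `middleSeries` for a vanishing background. -/
def middleIncrement : ℕ → PowerSeries (BiPoly d)
  | 0 => 0
  | n + 1 => shiftIncrement (fun i => MvPolynomial.X (3, i) - MvPolynomial.X (2, i)) *
      middleIncrement n +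
      shiftIncrement (fun i => -MvPolynomial.X (3, i) - MvPolynomial.X (2, i)) ^ n

variable (d) in
/-- `quadraticSeries` for a vanishing background. -/
def quadraticIncrement : ℕ → PowerSeries (BiPoly d)
  | 0 => 0
  | n + 1 => shiftIncrement (fun i => MvPolynomial.X (2, i) + MvPolynomial.X (3, i)) *
      quadraticIncrement n + middleIncrement d n * moyalExp 1

theorem shiftedSeries_sub_shiftIncrement (c : ℂ) (v : Fin d → BiPoly d) :
    shiftedSeries c v - shiftIncrement v =
      PowerSeries.C (MvPolynomial.C c - pairing d 4 4) := by
  rw [shiftedSeries_eq, shiftIncrement]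
  ring

/-- `shiftedSeries` and `shiftIncrement` are congruent modulo `c - p²`, and the recursion respects
congruences. -/
theorem dvd_middleSeries_sub (c : ℂ) (n : ℕ) :
    PowerSeries.C (MvPolynomial.C c - pairing d 4 4) ∣ middleSeries c n - middleIncrement d n := by
  induction n with
  | zero => simp [middleSeries, middleIncrement]
  | succ n ih =>
    rw [middleSeries, middleIncrement, add_sub_add_comm]
    refine dvd_add ?_ ((?_ : _ ∣ _).trans (sub_dvd_pow_sub_pow _ _ n))
    · rw [show ∀ a a' b b' : PowerSeries (BiPoly d), a * b - a' * b' =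
        (a - a') * b + a' * (b - b') from fun _ _ _ _ => by ring]
      refine dvd_add (Dvd.dvd.mul_right ?_ _) (Dvd.dvd.mul_left ih _)
      rw [shiftedSeries_sub_shiftIncrement]
    · rw [shiftedSeries_sub_shiftIncrement]

theorem dvd_quadraticSeries_sub (c : ℂ) (n : ℕ) :
    PowerSeries.C (MvPolynomial.C c - pairing d 4 4) ∣
      quadraticSeries c n - quadraticIncrement d n := by
  induction n with
  | zero => simp [quadraticSeries, quadraticIncrement]
  | succ n ih =>
    rw [quadraticSeries, quadraticIncrement, add_sub_add_comm, ← sub_mul]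
    refine dvd_add ?_ (Dvd.dvd.mul_right (dvd_middleSeries_sub c n) _)
    rw [show ∀ a a' b b' : PowerSeries (BiPoly d), a * b - a' * b' =
      (a - a') * b + a' * (b - b') from fun _ _ _ _ => by ring]
    refine dvd_add (Dvd.dvd.mul_right ?_ _) (Dvd.dvd.mul_left ih _)
    rw [shiftedSeries_sub_shiftIncrement]

/-- The momenta in a symbol stand outside all derivatives, so the factor is simply evaluated at `p`,
where it is zero. -/
theorem bi_background_mul (f g : smoothSymbols d) (r : BiPoly d) (x p : Phase d) :
    (bi f g ((MvPolynomial.C ((‖p‖ ^ 2 : ℝ) : ℂ) - pairing d 4 4) * r) : Symbol d) x p = 0 := by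
  have h := congrFun (congrFun (nablaPow_background ((‖p‖ ^ 2 : ℝ) : ℂ) 0 f g r) x) p
  have h2 := congrFun (congrFun (shiftedHamiltonian_zero 0 (0 : Symbol d) p) x) p
  rw [← backgroundSym, ← h]
  change _ * _ = _
  rw [← h2]
  simp [shiftedHamiltonian, hamiltonian, const]

/-- The second-order coefficient `l = 2` of the star power at order `ħ^k`. -/
def quadraticSymbol (h : smoothSymbols d) (k n : ℕ) : smoothSymbols d :=
  bi h h (PowerSeries.coeff k (quadraticIncrement d n))

/-- Subtracting the frozen background value removes `D`, and reduction modulo `c - p²` removes the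
frozen value itself. What remains is one smooth symbol evaluated at `(x, p)`, to which the momentum
integration can be applied. -/
theorem starTaylor_two (D : ℝ) (h : smoothSymbols d) (k n : ℕ) (x p : Phase d) :
    starTaylor D (h : Symbol d) 2 k n x p =
      (quadraticSymbol h k n : Symbol d) x p / (n.factorial : ℂ) := by
  have h1 := congrFun (congrFun (starPow_second D h p n k) x) p
  rw [shiftedHamiltonian] at h1
  rw [starTaylor, h1, quadraticSymbol]
  congr 1
  obtain ⟨G, hG⟩ := dvd_quadraticSeries_sub (d := d) ((‖p‖ ^ 2 : ℝ) : ℂ) n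
  rw [sub_eq_iff_eq_add.1 hG, map_add, map_add, PowerSeries.coeff_C_mul]
  have := bi_background_mul h h (PowerSeries.coeff k G) x p
  have hadd : ∀ A B : smoothSymbols d, ((A + B : smoothSymbols d) : Symbol d) x p =
      (A : Symbol d) x p + (B : Symbol d) x p := fun _ _ => rfl
  rw [hadd, this, zero_add]

variable (d) in
/-- Identification of the position derivatives of the two factors up to sign. -/
def byParts : BiPoly d →ₐ[ℂ] BiPoly d :=
  MvPolynomial.aeval fun v => if v.1 = 3 then -MvPolynomial.X (2, v.2) else MvPolynomial.X v

theorem byParts_X (a : Fin 5) (i : Fin d) : byParts d (MvPolynomial.X (a, i)) =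
    if a = 3 then -MvPolynomial.X (2, i) else MvPolynomial.X (a, i) := by
  rw [byParts, MvPolynomial.aeval_X]

theorem map_byParts_shiftIncrement (v : Fin d → BiPoly d) :
    PowerSeries.map (byParts d : BiPoly d →+* BiPoly d) (shiftIncrement v) =
      shiftIncrement fun i => byParts d (v i) := by
  have hC : ∀ a, byParts d (MvPolynomial.C a) = MvPolynomial.C a := fun a => (byParts d).commutes a
  simp only [shiftIncrement, map_sum, map_pow, map_add, map_mul, PowerSeries.map_C, map_neg,
    PowerSeries.map_X, RingHom.coe_coe, hC, byParts_X]
  simp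

theorem shiftIncrement_zero : shiftIncrement (fun _ : Fin d => 0) = 0 := by
  simp [shiftIncrement]

/-- After integration by parts the shift `-X (3, i) - X (2, i)` is zero. The inhomogeneous term
therefore contributes only through its zeroth power, which starts the recursion with 1. -/
theorem map_byParts_middleIncrement (n : ℕ) :
    PowerSeries.map (byParts d : BiPoly d →+* BiPoly d) (middleIncrement d (n + 1)) =
      shiftIncrement (fun i => -2 * MvPolynomial.X (2, i)) ^ n := by
  have h1 : (fun i : Fin d => byParts d (MvPolynomial.X (3, i) - MvPolynomial.X (2, i))) =
      fun i => -2 * MvPolynomial.X (2, i) := by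
    funext i
    rw [map_sub, byParts_X, byParts_X]
    simp
    ring
  have h2 : (fun i : Fin d => byParts d (-MvPolynomial.X (3, i) - MvPolynomial.X (2, i))) =
      fun i => 0 := by
    funext i
    rw [map_sub, map_neg, byParts_X, byParts_X]
    simp
  induction n with
  | zero => simp [middleIncrement]
  | succ n ih =>
    rw [middleIncrement, map_add, map_mul, ih, map_pow, map_byParts_shiftIncrement,
      map_byParts_shiftIncrement, h1, h2, shiftIncrement_zero, zero_pow n.succ_ne_zero, add_zero,
      pow_succ']

/-- The homogeneous term of the recursion carries the total derivative of the whole product and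
drops out, so only the term in which `h` is the last factor survives. -/
theorem map_byParts_quadraticIncrement (n : ℕ) :
    PowerSeries.map (byParts d : BiPoly d →+* BiPoly d) (quadraticIncrement d (n + 2)) =
      shiftIncrement (fun i => -2 * MvPolynomial.X (2, i)) ^ n *
        PowerSeries.map (byParts d : BiPoly d →+* BiPoly d) (moyalExp 1) := by
  have h2 : (fun i : Fin d => byParts d (MvPolynomial.X (2, i) + MvPolynomial.X (3, i))) =
      fun i => 0 := by
    funext i
    rw [map_add, byParts_X, byParts_X]
    simp
  rw [quadraticIncrement, map_add, map_mul, map_mul, map_byParts_shiftIncrement, h2,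
    shiftIncrement_zero, zero_mul, zero_add, map_byParts_middleIncrement]

theorem coeff_map_byParts_moyalExp (k : ℕ) :
    PowerSeries.coeff k (PowerSeries.map (byParts d : BiPoly d →+* BiPoly d) (moyalExp 1)) =
      MvPolynomial.C (moyalCoeff k) * (-(pairing d 2 0 + pairing d 2 1)) ^ k := by
  have hC : ∀ a, byParts d (MvPolynomial.C a) = MvPolynomial.C a := fun a => (byParts d).commutes a
  have : byParts d (moyalSym d) = -(pairing d 2 0 + pairing d 2 1) := by
    simp only [moyalSym, pairing, map_sub, map_sum, map_mul, byParts_X]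
    simp
    ring
  rw [moyalExp_one, PowerSeries.coeff_map, PowerSeries.coeff_mk, RingHom.coe_coe, map_mul, hC,
    map_pow, this]

theorem coeff_linear_pow {A : Type*} [CommRing A] (a c : A) (s j : ℕ) :
    PowerSeries.coeff j ((PowerSeries.X * PowerSeries.C a + PowerSeries.C c) ^ s) =
      if j ≤ s then (s.choose j : A) * a ^ j * c ^ (s - j) else 0 := by
  have h : ∀ i, PowerSeries.coeff j ((PowerSeries.X * PowerSeries.C a) ^ i *
      PowerSeries.C c ^ (s - i) * ((s.choose i : ℕ) : PowerSeries A)) =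
      if i = j then (s.choose j : A) * a ^ j * c ^ (s - j) else 0 := fun i => by
    rw [mul_pow, ← map_pow, ← map_pow, ← map_natCast (PowerSeries.C (R := A)), mul_assoc, mul_assoc,
      ← map_mul, ← map_mul, PowerSeries.coeff_X_pow_mul', PowerSeries.coeff_C]
    split_ifs with h1 h2 h3
    · subst h3; ring
    · omega
    · omega
    · rfl
    · omega
    · rfl
  rw [add_pow, map_sum]
  simp only [h]
  rw [Finset.sum_ite_eq']
  simp

/-- The increment is `ħ (2i pk + ħk²)`: its prefactor accounts for the `n` in the index, and the
second power of `ħ` counts the factors `k²`. -/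
theorem coeff_shiftIncrement_pow (n e : ℕ) :
    PowerSeries.coeff (n + e) (shiftIncrement (fun i : Fin d => -2 * MvPolynomial.X (2, i)) ^ n) =
      if e ≤ n then MvPolynomial.C (((n.choose e : ℕ) : ℂ) * (2 * Complex.I) ^ (n - e)) *
        pairing d 2 2 ^ e * pairing d 4 2 ^ (n - e) else 0 := by
  have hU : shiftIncrement (fun i : Fin d => -2 * MvPolynomial.X (2, i)) =
      PowerSeries.X * (PowerSeries.X * PowerSeries.C (pairing d 2 2) +
        PowerSeries.C (MvPolynomial.C (2 * Complex.I) * pairing d 4 2)) := by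
    have h1 : -MvPolynomial.C Complex.I *
        ∑ i, MvPolynomial.X (4, i) * (-2 * MvPolynomial.X (2, i)) =
        MvPolynomial.C (2 * Complex.I) * pairing d 4 2 := by
      rw [map_mul, map_ofNat, pairing, Finset.mul_sum, Finset.mul_sum]
      exact Finset.sum_congr rfl fun i _ => by ring
    have h2 : MvPolynomial.C (1 / 4) * ∑ i, (-2 * MvPolynomial.X (2, i)) ^ 2 = pairing d 2 2 := by
      rw [pairing, Finset.mul_sum]
      refine Finset.sum_congr rfl fun i _ => ?_
      have : (MvPolynomial.C (1 / 4) : BiPoly d) * 4 = 1 := by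
        rw [← map_ofNat MvPolynomial.C 4, ← map_mul]; norm_num
      linear_combination MvPolynomial.X (2, i) ^ 2 * this
    rw [shiftIncrement, h1, h2]
    ring
  rw [hU, mul_pow, add_comm n e, PowerSeries.coeff_X_pow_mul, coeff_linear_pow]
  refine if_congr Iff.rfl ?_ rfl
  simp only [mul_pow, map_mul, map_pow, map_natCast]
  ring

theorem coeff_shiftIncrement_pow_of_lt {n e : ℕ} (h : e < n) :
    PowerSeries.coeff e (shiftIncrement (fun i : Fin d => -2 * MvPolynomial.X (2, i)) ^ n) = 0 := by
  have : PowerSeries.X ^ n ∣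
      (shiftIncrement (fun i : Fin d => -2 * MvPolynomial.X (2, i)) ^ n) := by
    refine pow_dvd_pow_of_dvd ?_ n
    rw [shiftIncrement, pow_two, mul_assoc, ← mul_add]
    exact dvd_mul_right _ _
  exact PowerSeries.X_pow_dvd_iff.1 this e h

/-! ### Moments of the unit ball -/

/-- Polar coordinates separate the direction from the radius. The sphere integral is common to all
radial weights and need never be computed by itself. -/
theorem integral_inner_pow_mul_radial {E : Type*} [NormedAddCommGroup E] [InnerProductSpace ℝ E]
    [MeasurableSpace E] [BorelSpace E] [FiniteDimensional ℝ E] [Nontrivial E] (ξ : E) (r : ℕ)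
    (g : ℝ → ℝ) :
    ∫ y : E, inner ℝ y ξ ^ r * g ‖y‖ =
      (∫ u : Metric.sphere (0 : E) 1, inner ℝ (u : E) ξ ^ r ∂(volume : Measure E).toSphere) *
        ∫ ρ in Set.Ioi (0 : ℝ), ρ ^ (Module.finrank ℝ E - 1) * (ρ ^ r * g ρ) := by
  have hpolar := (volume : Measure E).measurePreserving_homeomorphUnitSphereProd.integral_comp
    (Homeomorph.measurableEmbedding _)
    (fun z : Metric.sphere (0 : E) 1 × Set.Ioi (0 : ℝ) =>
      inner ℝ (z.1 : E) ξ ^ r * ((z.2 : ℝ) ^ r * g z.2))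
  calc
    _ = ∫ y : ({(0)}ᶜ : Set E), inner ℝ (y : E) ξ ^ r * g ‖(y : E)‖
        ∂((volume : Measure E).comap (↑)) := by
      rw [integral_subtype_comap (measurableSet_singleton _).compl
        fun y : E => inner ℝ y ξ ^ r * g ‖y‖, restrict_compl_singleton]
    _ = ∫ z : Metric.sphere (0 : E) 1 × Set.Ioi (0 : ℝ),
        inner ℝ (z.1 : E) ξ ^ r * ((z.2 : ℝ) ^ r * g z.2)
        ∂((volume : Measure E).toSphere.prod (.volumeIoiPow (Module.finrank ℝ E - 1))) := by
      rw [← hpolar]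
      congr 1
      funext y
      have hy : (y : E) ≠ 0 := y.2
      have hn : ‖(y : E)‖ ≠ 0 := norm_ne_zero_iff.2 hy
      simp only [homeomorphUnitSphereProd_apply_fst_coe, homeomorphUnitSphereProd_apply_snd_coe,
        real_inner_smul_left]
      rw [mul_pow, inv_pow]
      field_simp
    _ = _ := by
      rw [integral_prod_mul (fun u : Metric.sphere (0 : E) 1 => inner ℝ (u : E) ξ ^ r)
        (fun ρ : Set.Ioi (0 : ℝ) => (ρ : ℝ) ^ r * g ρ)]
      congr 1
      simp only [Measure.volumeIoiPow, ENNReal.ofReal]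
      rw [integral_withDensity_eq_integral_smul,
        integral_subtype_comap measurableSet_Ioi fun a : ℝ =>
          Real.toNNReal (a ^ (Module.finrank ℝ E - 1)) • (a ^ r * g a),
        setIntegral_congr_fun measurableSet_Ioi fun x hx => ?_]
      · rw [NNReal.smul_def, Real.coe_toNNReal _ (pow_nonneg hx.out.le _), smul_eq_mul]
      · exact (measurable_subtype_coe.pow_const _).real_toNNReal

theorem integral_Ioi_pow_mul_exp_neg_sq (n : ℕ) :
    ∫ ρ in Set.Ioi (0 : ℝ), ρ ^ n * Real.exp (-ρ ^ 2) = 1 / 2 * Real.Gamma ((n + 1) / 2) := by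
  have h := integral_rpow_mul_exp_neg_rpow (p := 2) (q := n) (by norm_num)
    (by linarith [(Nat.cast_nonneg n : (0 : ℝ) ≤ n)])
  rw [← h]
  refine setIntegral_congr_fun measurableSet_Ioi fun x _ => ?_
  simp only [Real.rpow_natCast]
  congr 3
  norm_cast

theorem integral_pow_mul_exp_neg_sq (r : ℕ) :
    ∫ x : ℝ, x ^ (2 * r) * Real.exp (-x ^ 2) = Real.Gamma (r + 1 / 2) := by
  have h := integral_comp_abs (f := fun x : ℝ => x ^ (2 * r) * Real.exp (-x ^ 2))
  have h2 : ∀ x : ℝ, |x| ^ (2 * r) = x ^ (2 * r) := fun x => by rw [pow_mul, sq_abs, ← pow_mul]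
  simp only [h2, sq_abs] at h
  rw [h, integral_Ioi_pow_mul_exp_neg_sq]
  push_cast
  rw [← mul_assoc, show (2 : ℝ) * (1 / 2) = 1 by norm_num, one_mul]
  congr 1
  ring

theorem integral_coord_pow_mul_gaussian (i : Fin d) (r : ℕ) :
    ∫ y : Phase d, (y i) ^ (2 * r) * Real.exp (-‖y‖ ^ 2) =
      Real.Gamma (r + 1 / 2) * Real.sqrt Real.pi ^ (d - 1) := by
  have h1 := (PiLp.volume_preserving_ofLp (Fin d)).integral_comp
    (MeasurableEquiv.toLp 2 (Fin d → ℝ)).symm.measurableEmbedding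
    (fun y : Fin d → ℝ => ∏ j, ((if j = i then y j ^ (2 * r) else 1) * Real.exp (-y j ^ 2)))
  have h2 : ∀ y : Phase d, (y i) ^ (2 * r) * Real.exp (-‖y‖ ^ 2) =
      ∏ j, ((if j = i then y j ^ (2 * r) else 1) * Real.exp (-y j ^ 2)) := fun y => by
    rw [Finset.prod_mul_distrib, ← Real.exp_sum, EuclideanSpace.norm_sq_eq,
      Finset.prod_ite_eq' Finset.univ i (fun j => y j ^ (2 * r))]
    simp
  simp only [h2]
  refine h1.trans ?_
  rw [integral_fintype_prod_volume_eq_prod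
    (f := fun j (x : ℝ) => (if j = i then x ^ (2 * r) else 1) * Real.exp (-x ^ 2)),
    ← Finset.mul_prod_erase _ _ (Finset.mem_univ i)]
  congr 1
  · simp [integral_pow_mul_exp_neg_sq]
  · have h3 : ∀ j ∈ Finset.univ.erase i, (∫ x : ℝ, (if j = i then x ^ (2 * r) else 1) *
        Real.exp (-x ^ 2)) = Real.sqrt Real.pi := fun j hj => by
      have h0 := integral_pow_mul_exp_neg_sq 0
      simp only [mul_zero, pow_zero, one_mul, Nat.cast_zero, zero_add,
        Real.Gamma_one_half_eq] at h0
      simp only [if_neg (Finset.ne_of_mem_erase hj), one_mul, h0]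
    rw [Finset.prod_congr rfl h3, Finset.prod_const, Finset.card_erase_of_mem (Finset.mem_univ i)]
    simp

theorem integral_inner_pow_mul_gaussian (hd : 0 < d) (ξ : Phase d) (r : ℕ) :
    ∫ y : Phase d, inner ℝ y ξ ^ (2 * r) * Real.exp (-‖y‖ ^ 2) =
      ‖ξ‖ ^ (2 * r) * (Real.Gamma (r + 1 / 2) * Real.sqrt Real.pi ^ (d - 1)) := by
  set e : Phase d := ‖ξ‖ • EuclideanSpace.single ⟨0, hd⟩ 1 with he
  have hn : ‖ξ‖ = ‖e‖ := by simp [he, norm_smul]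
  -- `ξ` and `e` have equal length, so the reflection in the hyperplane orthogonal to `ξ - e`
  -- carries `ξ` to a multiple of a coordinate vector.
  set ρ := (ℝ ∙ (ξ - e))ᗮ.reflection with hρ
  have hρξ : ρ ξ = e := Submodule.reflection_sub hn
  rw [← integral_coord_pow_mul_gaussian ⟨0, hd⟩ r, ← integral_const_mul,
    ← ρ.measurePreserving.integral_comp ρ.toHomeomorph.measurableEmbedding
      (fun y : Phase d => ‖ξ‖ ^ (2 * r) * (y ⟨0, hd⟩ ^ (2 * r) * Real.exp (-‖y‖ ^ 2)))]
  congr 1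
  funext y
  have h1 : inner ℝ y ξ = ‖ξ‖ * (ρ y) ⟨0, hd⟩ := by
    rw [← ρ.inner_map_map, hρξ, he, real_inner_smul_right, EuclideanSpace.inner_single_right]
    simp
  rw [h1, mul_pow, ρ.norm_map, mul_assoc]

/-- The constant in `∫ (y·ξ)^(2r) d^dy = c ξ^(2r)` over the unit ball. -/
def ballMoment (d r : ℕ) : ℝ :=
  Real.Gamma (r + 1 / 2) * Real.sqrt Real.pi ^ (d - 1) / Real.Gamma ((d : ℝ) / 2 + r + 1)

/-- The Gaussian weight and the indicator of the ball share the same sphere integral. The Gaussian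
side factors into one-dimensional integrals, so the ratio of the two radial integrals gives the
ball. -/
theorem integral_ball_inner_pow (hd : 0 < d) (ξ : Phase d) (r : ℕ) :
    ∫ y in Metric.ball (0 : Phase d) 1, inner ℝ y ξ ^ (2 * r) =
      ballMoment d r * ‖ξ‖ ^ (2 * r) := by
  have : Nonempty (Fin d) := ⟨⟨0, hd⟩⟩
  have hfin : Module.finrank ℝ (Phase d) = d := by simp
  have h1 := integral_inner_pow_mul_radial ξ (2 * r) (fun ρ => Real.exp (-ρ ^ 2))
  have h2 := integral_inner_pow_mul_radial ξ (2 * r) (fun ρ => if ρ < 1 then 1 else 0)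
  rw [integral_inner_pow_mul_gaussian hd] at h1
  have e1 : ∫ ρ in Set.Ioi (0 : ℝ), ρ ^ (Module.finrank ℝ (Phase d) - 1) *
      (ρ ^ (2 * r) * Real.exp (-ρ ^ 2)) = 1 / 2 * Real.Gamma ((d : ℝ) / 2 + r) := by
    simp only [← mul_assoc, ← pow_add]
    rw [integral_Ioi_pow_mul_exp_neg_sq, hfin]
    congr 2
    have : ((d - 1 + 2 * r : ℕ) : ℝ) = d - 1 + 2 * r := by
      push_cast [Nat.cast_sub (show 1 ≤ d from hd)]; ring
    rw [this]; ring
  have e2 : ∫ ρ in Set.Ioi (0 : ℝ), ρ ^ (Module.finrank ℝ (Phase d) - 1) *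
      (ρ ^ (2 * r) * if ρ < 1 then 1 else 0) = 1 / (d + 2 * r) := by
    have : ∀ ρ : ℝ, ρ ^ (Module.finrank ℝ (Phase d) - 1) * (ρ ^ (2 * r) * if ρ < 1 then 1 else 0) =
        (Set.Iio (1 : ℝ)).indicator (fun ρ => ρ ^ (d - 1 + 2 * r)) ρ := fun ρ => by
      rw [hfin, Set.indicator_apply, pow_add]
      simp only [Set.mem_Iio]
      split_ifs <;> simp
    simp only [this]
    rw [setIntegral_indicator measurableSet_Iio, Set.Ioi_inter_Iio,
      ← integral_Ioc_eq_integral_Ioo, ← intervalIntegral.integral_of_le zero_le_one, integral_pow]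
    have : ((d - 1 + 2 * r : ℕ) : ℝ) = d - 1 + 2 * r := by
      push_cast [Nat.cast_sub (show 1 ≤ d from hd)]; ring
    rw [this]
    simp
    ring
  classical
  have e3 : ∫ y : Phase d, inner ℝ y ξ ^ (2 * r) * (if ‖y‖ < 1 then 1 else 0) =
      ∫ y in Metric.ball (0 : Phase d) 1, inner ℝ y ξ ^ (2 * r) := by
    rw [← integral_indicator measurableSet_ball]
    congr 1
    funext y
    rw [Set.indicator_apply]
    simp only [Metric.mem_ball, dist_zero_right]
    split_ifs <;> simp
  rw [e1] at h1
  rw [e2, e3] at h2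
  rw [h2, ballMoment]
  have hpos : (0 : ℝ) < (d : ℝ) / 2 + r := by
    have : (0 : ℝ) < d := Nat.cast_pos.2 hd
    positivity
  have hG := Real.Gamma_add_one hpos.ne'
  have hG' := (Real.Gamma_pos_of_pos hpos).ne'
  rw [hG]
  have h3 : (d : ℝ) + 2 * r = 2 * ((d : ℝ) / 2 + r) := by ring
  rw [h3]
  have hp' := hpos.ne'
  generalize Real.Gamma ((d : ℝ) / 2 + r) = G at *
  generalize Real.Gamma ((r : ℝ) + 1 / 2) = G₂ at *
  generalize (d : ℝ) / 2 + r = q at *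
  field_simp
  linarith

theorem integral_ball_odd (f : Phase d → ℂ) (hf : ∀ y, f (-y) = -f y) :
    ∫ y in Metric.ball (0 : Phase d) 1, f y = 0 := by
  have h := (LinearIsometryEquiv.neg ℝ (E := Phase d)).measurePreserving.setIntegral_preimage_emb
    (LinearIsometryEquiv.neg ℝ (E := Phase d)).toHomeomorph.measurableEmbedding f
    (Metric.ball (0 : Phase d) 1)
  have h1 : (LinearIsometryEquiv.neg ℝ (E := Phase d)) ⁻¹' (Metric.ball (0 : Phase d) 1) =
      Metric.ball (0 : Phase d) 1 := by
    ext y; simp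
  rw [h1] at h
  simp only [LinearIsometryEquiv.coe_neg, hf, integral_neg] at h
  exact self_eq_neg.1 h.symm

/-- The mean of a homogeneous constant-coefficient operator of even degree over all directions in the
unit ball is a power of the Laplacian. -/
theorem integral_ball_directional_pow (hd : 0 < d) {A : Type*} [CommRing A] [Algebra ℂ A]
    (X : Fin d → A) (L : A →ₗ[ℂ] ℂ) (r : ℕ) :
    ∫ y in Metric.ball (0 : Phase d) 1,
      L ((∑ i, algebraMap ℂ A ((y i : ℝ) : ℂ) * X i) ^ (2 * r)) =
      (ballMoment d r : ℂ) * L ((∑ i, X i ^ 2) ^ r) := by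
  set I : (Fin (2 * r) → Fin d) → ℝ := fun f =>
    ∫ y in Metric.ball (0 : Phase d) 1, ∏ a, y (f a) with hI
  have hint : ∀ f : Fin (2 * r) → Fin d, IntegrableOn (fun y : Phase d => ∏ a, y (f a))
      (Metric.ball (0 : Phase d) 1) := fun f => by
    refine (ContinuousOn.integrableOn_compact (isCompact_closedBall (0 : Phase d) 1) ?_).mono_set
      Metric.ball_subset_closedBall
    fun_prop
  -- The moment formula holds for every vector `ξ`, hence as an identity of polynomials; elements of
  -- any commutative algebra, such as derivatives, can then be substituted for the components of
  -- `ξ`.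
  have hpoly : ∑ f : Fin (2 * r) → Fin d, MvPolynomial.C (I f) * ∏ a, MvPolynomial.X (f a) =
      MvPolynomial.C (ballMoment d r) *
        (∑ i, MvPolynomial.X i ^ 2 : MvPolynomial (Fin d) ℝ) ^ r := by
    refine MvPolynomial.funext fun ξ => ?_
    have h := integral_ball_inner_pow hd (WithLp.toLp 2 ξ : Phase d) r
    have hin : ∀ y : Phase d, inner ℝ y (WithLp.toLp 2 ξ : Phase d) = ∑ i, y i * ξ i := fun y => by
      simp [PiLp.inner_apply, mul_comm]
    simp only [hin, Fintype.sum_pow, Finset.prod_mul_distrib] at h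
    rw [integral_finsetSum _ fun f _ => (hint f).mul_const _] at h
    simp only [integral_mul_const] at h
    rw [pow_mul, EuclideanSpace.norm_sq_eq] at h
    simpa [map_sum, map_prod, hI] using h
  have hA := congrArg (MvPolynomial.eval₂ ((algebraMap ℂ A).comp (algebraMap ℝ ℂ)) X) hpoly
  simp only [MvPolynomial.eval₂_sum, MvPolynomial.eval₂_mul, MvPolynomial.eval₂_C,
    MvPolynomial.eval₂_prod, MvPolynomial.eval₂_X, MvPolynomial.eval₂_pow,
    RingHom.comp_apply] at hA
  have hA' := congrArg L hA
  simp only [← Algebra.smul_def, map_sum, map_smul, smul_eq_mul] at hA'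
  have hexp : ∀ y : Phase d, L ((∑ i, algebraMap ℂ A ((y i : ℝ) : ℂ) * X i) ^ (2 * r)) =
      ∑ f : Fin (2 * r) → Fin d, (((∏ a, y (f a) : ℝ)) : ℂ) * L (∏ a, X (f a)) := fun y => by
    rw [Fintype.sum_pow, map_sum]
    refine Finset.sum_congr rfl fun f _ => ?_
    rw [Finset.prod_mul_distrib, ← map_prod, ← Algebra.smul_def, map_smul, smul_eq_mul]
    push_cast
    rfl
  have hintC : ∀ f : Fin (2 * r) → Fin d, IntegrableOn
      (fun y : Phase d => (((∏ a, y (f a) : ℝ)) : ℂ) * L (∏ a, X (f a)))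
      (Metric.ball (0 : Phase d) 1) := fun f => by
    refine (ContinuousOn.integrableOn_compact (isCompact_closedBall (0 : Phase d) 1) ?_).mono_set
      Metric.ball_subset_closedBall
    fun_prop
  simp only [hexp]
  rw [integral_finsetSum _ fun f _ => hintC f]
  simp only [integral_mul_const, Complex.real_smul] at hA' ⊢
  rw [← hA']
  refine Finset.sum_congr rfl fun f _ => ?_
  rw [hI, ← integral_complex_ofReal]

/-! ### Integrals depending on a parameter -/

theorem integrableOn_section {E : Type*} [NormedAddCommGroup E] [MeasurableSpace E] [BorelSpace E]
    {μ : Measure E} [IsFiniteMeasureOnCompacts μ] {S K : Set E} (hSK : S ⊆ K) (hK : IsCompact K)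
    {f : ℝ × E → ℂ} (hf : Continuous f) (s : ℝ) : IntegrableOn (fun z => f (s, z)) S μ :=
  (ContinuousOn.integrableOn_compact hK (by fun_prop)).mono_set hSK

section Parametric

variable {E : Type*} [NormedAddCommGroup E] [NormedSpace ℝ E]

/-- The derivative with respect to the first variable. -/
def parDeriv (f : ℝ × E → ℂ) : ℝ × E → ℂ := fun z => fderiv ℝ f z (1, 0)

theorem contDiff_parDeriv {f : ℝ × E → ℂ} (hf : ContDiff ℝ ∞ f) :
    ContDiff ℝ ∞ (parDeriv f) :=
  (hf.fderiv_right (m := ∞) (by simp)).clm_apply contDiff_const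

theorem contDiff_parDeriv_iterate {f : ℝ × E → ℂ} (hf : ContDiff ℝ ∞ f) (n : ℕ) :
    ContDiff ℝ ∞ (parDeriv^[n] f) := by
  induction n with
  | zero => exact hf
  | succ n ih => rw [Function.iterate_succ_apply']; exact contDiff_parDeriv ih

theorem hasDerivAt_parDeriv {f : ℝ × E → ℂ} (hf : ContDiff ℝ ∞ f) (s : ℝ) (z : E) :
    HasDerivAt (fun s => f (s, z)) (parDeriv f (s, z)) s := by
  have h1 : HasFDerivAt f (fderiv ℝ f (s, z)) (s, z) :=
    (hf.differentiable (by simp) (s, z)).hasFDerivAt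
  have h2 : HasDerivAt (fun s : ℝ => (s, z)) ((1 : ℝ), (0 : E)) s :=
    (hasDerivAt_id s).prodMk (hasDerivAt_const s z)
  exact h1.comp_hasDerivAt s h2

variable [MeasurableSpace E] [BorelSpace E] {μ : Measure E} [IsFiniteMeasureOnCompacts μ]
  {S K : Set E}

theorem hasDerivAt_setIntegral (hSK : S ⊆ K) (hK : IsCompact K)
    {f : ℝ × E → ℂ} (hf : ContDiff ℝ ∞ f) (s : ℝ) :
    HasDerivAt (fun s => ∫ z in S, f (s, z) ∂μ) (∫ z in S, parDeriv f (s, z) ∂μ) s := by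
  have hc : Continuous (parDeriv f) := (contDiff_parDeriv hf).continuous
  obtain ⟨C, hC⟩ := ((isCompact_closedBall s 1).prod hK).exists_bound_of_continuousOn hc.continuousOn
  refine (hasDerivAt_integral_of_dominated_loc_of_deriv_le (s := Metric.closedBall s 1)
    (F := fun s z => f (s, z)) (F' := fun s z => parDeriv f (s, z)) (bound := fun _ => C)
    (Metric.closedBall_mem_nhds s one_pos)
    (Eventually.of_forall fun x => (integrableOn_section hSK hK hf.continuous x).1)
    (integrableOn_section hSK hK hf.continuous s)
    (integrableOn_section hSK hK hc s).1 ?_ ?_ ?_).2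
  · refine ae_restrict_of_ae_restrict_of_subset hSK ?_
    refine (ae_restrict_mem hK.measurableSet).mono fun z hz x hx => hC (x, z) ⟨hx, hz⟩
  · exact (continuousOn_const.integrableOn_compact hK).mono_set hSK
  · exact Eventually.of_forall fun z x _ => hasDerivAt_parDeriv hf x z

theorem iteratedDeriv_setIntegral (hSK : S ⊆ K) (hK : IsCompact K)
    {f : ℝ × E → ℂ} (hf : ContDiff ℝ ∞ f) (n : ℕ) :
    iteratedDeriv n (fun s => ∫ z in S, f (s, z) ∂μ) =
      fun s => ∫ z in S, parDeriv^[n] f (s, z) ∂μ := by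
  induction n with
  | zero => simp
  | succ n ih =>
    rw [iteratedDeriv_succ, ih]
    funext s
    rw [(hasDerivAt_setIntegral hSK hK (contDiff_parDeriv_iterate hf n) s).deriv,
      Function.iterate_succ_apply']

theorem contDiff_setIntegral (hSK : S ⊆ K) (hK : IsCompact K)
    {f : ℝ × E → ℂ} (hf : ContDiff ℝ ∞ f) : ContDiff ℝ ∞ (fun s => ∫ z in S, f (s, z) ∂μ) := by
  refine contDiff_of_differentiable_iteratedDeriv fun n _ s => ?_
  rw [iteratedDeriv_setIntegral hSK hK hf]
  exact (hasDerivAt_setIntegral hSK hK (contDiff_parDeriv_iterate hf n) s).differentiableAt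

end Parametric

/-! ### Momentum integrals over shrinking balls -/

/-- Differentiation of a symbol in the momentum direction `y`. -/
def momDeriv (y : Phase d) : Derivation ℂ (smoothSymbols d) (smoothSymbols d) :=
  dirDerivation (0, y)

theorem momDeriv_eq_act (y : Phase d) (W : smoothSymbols d) :
    momDeriv y W = act (∑ i, algebraMap ℂ _ ((y i : ℝ) : ℂ) * MvPolynomial.X (0, i)) W := by
  have h : momDeriv y W = ∑ i, ((y i : ℝ) : ℂ) • dP i W := by
    ext x p
    rw [← sum_coe]
    have hy : y = ∑ i, y i • EuclideanSpace.single i (1 : ℝ) := by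
      conv_lhs => rw [← (EuclideanSpace.basisFun (Fin d) ℝ).sum_repr y]
      simp
    change fderiv ℝ (fun z : Phase d × Phase d => (W : Symbol d) z.1 z.2) (x, p) (0, y) =
      ∑ i, ((y i : ℝ) : ℂ) *
        fderiv ℝ (fun z : Phase d × Phase d => (W : Symbol d) z.1 z.2) (x, p)
          (0, EuclideanSpace.single i 1)
    conv_lhs => rw [hy]
    have : ((0 : Phase d), ∑ i, y i • EuclideanSpace.single i (1 : ℝ)) =
        ∑ i, y i • ((0 : Phase d), (EuclideanSpace.single i (1 : ℝ) : Phase d)) := by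
      simp [Prod.ext_iff, Prod.fst_sum, Prod.snd_sum]
    rw [this, map_sum]
    refine Finset.sum_congr rfl fun i _ => ?_
    rw [map_smul, Complex.real_smul]
  rw [h, map_sum, LinearMap.sum_apply]
  refine Finset.sum_congr rfl fun i _ => ?_
  rw [← Algebra.smul_def, map_smul, LinearMap.smul_apply, act_X_zero]

theorem momDeriv_iterate_eq_act (y : Phase d) (n : ℕ) (W : smoothSymbols d) :
    (momDeriv y)^[n] W =
      act ((∑ i, algebraMap ℂ _ ((y i : ℝ) : ℂ) * MvPolynomial.X (0, i)) ^ n) W := by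
  induction n with
  | zero => simp
  | succ n ih =>
    rw [Function.iterate_succ_apply', ih, momDeriv_eq_act, ← act_mul, ← pow_succ']

/-- The function `(s, (x, y)) ↦ W(x, s y)`. -/
def scaled (W : smoothSymbols d) : ℝ × (Phase d × Phase d) → ℂ :=
  fun z => (W : Symbol d) z.2.1 (z.1 • z.2.2)

theorem contDiff_scaled (W : smoothSymbols d) : ContDiff ℝ ∞ (scaled W) := by
  have hW : ContDiff ℝ ∞ (fun z : Phase d × Phase d => (W : Symbol d) z.1 z.2) := W.2
  exact hW.comp ((contDiff_fst.comp contDiff_snd).prodMk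
    (contDiff_fst.smul (contDiff_snd.comp contDiff_snd)))

theorem hasDerivAt_scaled (W : smoothSymbols d) (s : ℝ) (x y : Phase d) :
    HasDerivAt (fun s : ℝ => (W : Symbol d) x (s • y)) ((momDeriv y W : Symbol d) x (s • y)) s := by
  have h1 : HasFDerivAt (fun z : Phase d × Phase d => (W : Symbol d) z.1 z.2)
      (fderiv ℝ (fun z : Phase d × Phase d => (W : Symbol d) z.1 z.2) (x, s • y)) (x, s • y) :=
    (smoothSymbols.differentiable W.2 (x, s • y)).hasFDerivAt
  have h2 : HasDerivAt (fun s : ℝ => (x, s • y)) ((0 : Phase d), y) s := by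
    have := (hasDerivAt_const s x).prodMk ((hasDerivAt_id s).smul_const y)
    simpa using this
  exact h1.comp_hasDerivAt s h2

theorem parDeriv_iterate_scaled (W : smoothSymbols d) (n : ℕ) (s : ℝ) (z : Phase d × Phase d) :
    parDeriv^[n] (scaled W) (s, z) = (((momDeriv z.2)^[n] W : smoothSymbols d) : Symbol d) z.1
      (s • z.2) := by
  induction n generalizing s with
  | zero => rfl
  | succ n ih =>
    rw [Function.iterate_succ_apply', Function.iterate_succ_apply',
      ← (hasDerivAt_parDeriv (contDiff_parDeriv_iterate (contDiff_scaled W) n) s z).deriv]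
    simp only [ih]
    exact (hasDerivAt_scaled _ s z.1 z.2).deriv

/-- `∫ W(x, s y)` over `x` in `C` and `y` in the unit ball. -/
def ballAverage (C : Set (Phase d)) (W : smoothSymbols d) (s : ℝ) : ℂ :=
  ∫ z in C ×ˢ Metric.ball (0 : Phase d) 1, scaled W (s, z)

theorem prod_ball_subset (C : Set (Phase d)) : C ×ˢ Metric.ball (0 : Phase d) 1 ⊆
    C ×ˢ Metric.closedBall (0 : Phase d) 1 :=
  Set.prod_mono_right Metric.ball_subset_closedBall

theorem isCompact_prod_closedBall {C : Set (Phase d)} (hC : IsCompact C) :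
    IsCompact (C ×ˢ Metric.closedBall (0 : Phase d) 1) :=
  hC.prod (isCompact_closedBall _ _)

theorem contDiff_ballAverage {C : Set (Phase d)} (hC : IsCompact C) (W : smoothSymbols d) :
    ContDiff ℝ ∞ (ballAverage C W) :=
  contDiff_setIntegral (prod_ball_subset C) (isCompact_prod_closedBall hC) (contDiff_scaled W)

theorem iteratedDeriv_ballAverage {C : Set (Phase d)} (hC : IsCompact C) (W : smoothSymbols d)
    (n : ℕ) : iteratedDeriv n (ballAverage C W) 0 =
      ∫ x in C, ∫ y in Metric.ball (0 : Phase d) 1,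
        (((momDeriv y)^[n] W : smoothSymbols d) : Symbol d) x 0 := by
  have h := congrFun (iteratedDeriv_setIntegral (μ := volume) (prod_ball_subset C)
    (isCompact_prod_closedBall hC) (contDiff_scaled W) n) 0
  refine h.trans ?_
  have hint := integrableOn_section (μ := volume) (prod_ball_subset C)
    (isCompact_prod_closedBall hC)
    (contDiff_parDeriv_iterate (contDiff_scaled W) n).continuous 0
  rw [Measure.volume_eq_prod] at hint ⊢
  rw [setIntegral_prod _ hint]
  simp only [parDeriv_iterate_scaled, zero_smul]

theorem ballAverage_eq {C : Set (Phase d)} (hC : IsCompact C) (W : smoothSymbols d) (s : ℝ) :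
    ballAverage C W s = ∫ x in C, ∫ y in Metric.ball (0 : Phase d) 1, (W : Symbol d) x (s • y) := by
  have hint := integrableOn_section (μ := volume) (prod_ball_subset C)
    (isCompact_prod_closedBall hC) (contDiff_scaled W).continuous s
  rw [ballAverage, Measure.volume_eq_prod]
  rw [Measure.volume_eq_prod] at hint
  rw [setIntegral_prod _ hint]
  rfl

/-! ### Energy derivatives as dilatations of the momentum -/

/-- The generator `d/2 + p·∂/2` of dilatations of the momentum. -/
def dilatation (W : smoothSymbols d) : smoothSymbols d :=
  ((d : ℂ) / 2) • W + (1 / 2 : ℂ) • ∑ i, pCoord i * dP i W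

theorem sum_pCoord_dP (W : smoothSymbols d) (x p : Phase d) :
    ((∑ i, pCoord i * dP i W : smoothSymbols d) : Symbol d) x p =
      (momDeriv p W : Symbol d) x p := by
  rw [momDeriv_eq_act, map_sum, LinearMap.sum_apply, ← sum_coe, ← sum_coe]
  refine Finset.sum_congr rfl fun i _ => ?_
  rw [← Algebra.smul_def, map_smul, LinearMap.smul_apply, act_X_zero]
  rfl

theorem momDeriv_smul (s : ℝ) (y : Phase d) (W : smoothSymbols d) (x p : Phase d) :
    (momDeriv (s • y) W : Symbol d) x p = (s : ℂ) * (momDeriv y W : Symbol d) x p := by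
  have : ((0 : Phase d), s • y) = s • ((0 : Phase d), y) := by simp
  change fderiv ℝ _ (x, p) ((0 : Phase d), s • y) = _
  rw [this, map_smul, Complex.real_smul]
  rfl

theorem dilatation_apply (W : smoothSymbols d) (x y : Phase d) (s : ℝ) :
    (dilatation W : Symbol d) x (s • y) = (d : ℂ) / 2 * (W : Symbol d) x (s • y) +
      1 / 2 * (s * (momDeriv y W : Symbol d) x (s • y)) := by
  rw [← momDeriv_smul, ← sum_pCoord_dP]
  rfl

theorem ballAverage_dilatation {C : Set (Phase d)} (hC : IsCompact C) (W : smoothSymbols d)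
    (s : ℝ) : ballAverage C (dilatation W) s =
      (d : ℂ) / 2 * ballAverage C W s + 1 / 2 * (s * deriv (ballAverage C W) s) := by
  have h := hasDerivAt_setIntegral (μ := volume) (prod_ball_subset C)
    (isCompact_prod_closedBall hC) (contDiff_scaled W) s
  have hi1 := integrableOn_section (μ := volume) (prod_ball_subset C)
    (isCompact_prod_closedBall hC) (contDiff_scaled W).continuous s
  have hi2 := integrableOn_section (μ := volume) (prod_ball_subset C)
    (isCompact_prod_closedBall hC) (contDiff_parDeriv (contDiff_scaled W)).continuous s
  have e : deriv (ballAverage C W) s = ∫ z in C ×ˢ Metric.ball (0 : Phase d) 1,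
      parDeriv (scaled W) (s, z) := h.deriv
  rw [e, ballAverage, ballAverage, ← integral_const_mul, ← integral_const_mul,
    ← integral_const_mul, ← integral_add (hi1.const_mul _) ((hi2.const_mul _).const_mul _)]
  congr 1
  funext z
  have := parDeriv_iterate_scaled W 1 s z
  simp only [Function.iterate_one] at this
  rw [this]
  exact dilatation_apply W z.1 z.2 s

/-- The integral of a symbol over the ball `p² < t`. -/
def sublevelIntegral (W : smoothSymbols d) (x : Phase d) (t : ℝ) : ℂ :=
  ∫ p in {p : Phase d | ‖p‖ ^ 2 < t}, (W : Symbol d) x p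

open scoped Pointwise in
theorem sublevelIntegral_eq (W : smoothSymbols d) (x : Phase d) {t : ℝ} (ht : 0 < t) :
    sublevelIntegral W x t = (Real.sqrt t : ℂ) ^ d *
      ∫ y in Metric.ball (0 : Phase d) 1, (W : Symbol d) x (Real.sqrt t • y) := by
  have hs := Real.sqrt_pos.2 ht
  have h := Measure.setIntegral_comp_smul_of_pos (volume : Measure (Phase d))
    (fun p => (W : Symbol d) x p) (Metric.ball (0 : Phase d) 1) hs
  have hset : Real.sqrt t • Metric.ball (0 : Phase d) 1 = {p : Phase d | ‖p‖ ^ 2 < t} := by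
    rw [smul_unitBall_of_pos hs]
    ext p
    simp [Real.lt_sqrt (norm_nonneg p)]
  rw [hset] at h
  rw [h, sublevelIntegral, Complex.real_smul, ← mul_assoc]
  have : (Real.sqrt t : ℂ) ^ d ≠ 0 := pow_ne_zero _ (Complex.ofReal_ne_zero.2 hs.ne')
  simp [this]

/-- The substitution `p = √t y` moves `t` from the domain into the integrand. Differentiating
`t^(d/2) W(x, √t y)` then gives `1/t` times the dilated symbol, with no surface integral. -/
theorem hasDerivAt_sublevelIntegral (W : smoothSymbols d) (x : Phase d) {t : ℝ} (ht : 0 < t) :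
    HasDerivAt (sublevelIntegral W x) ((t : ℂ)⁻¹ * sublevelIntegral (dilatation W) x t) t := by
  have hs := Real.sqrt_pos.2 ht
  set f : ℝ × Phase d → ℂ := fun z => (W : Symbol d) x (z.1 • z.2) with hf
  have hfc : ContDiff ℝ ∞ f := by
    have hW : ContDiff ℝ ∞ (fun z : Phase d × Phase d => (W : Symbol d) z.1 z.2) := W.2
    exact hW.comp (contDiff_const.prodMk (contDiff_fst.smul contDiff_snd))
  have hK := isCompact_closedBall (0 : Phase d) 1
  have hg := hasDerivAt_setIntegral (μ := volume) Metric.ball_subset_closedBall hK hfc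
    (Real.sqrt t)
  have hpar : ∀ s y, parDeriv f (s, y) = (momDeriv y W : Symbol d) x (s • y) := fun s y =>
    (hasDerivAt_parDeriv hfc s y).unique (hasDerivAt_scaled W s x y)
  have hsq : HasDerivAt Real.sqrt (1 / (2 * Real.sqrt t)) t := Real.hasDerivAt_sqrt ht.ne'
  have hg' := hg.scomp t hsq
  have hpow : HasDerivAt (fun t : ℝ => (Real.sqrt t : ℂ) ^ d)
      (d * (Real.sqrt t : ℂ) ^ (d - 1) * ((1 / (2 * Real.sqrt t) : ℝ) : ℂ)) t :=
    hsq.ofReal_comp.pow d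
  have hmul := hpow.mul hg'
  have heq : sublevelIntegral W x =ᶠ[𝓝 t] fun t => (Real.sqrt t : ℂ) ^ d *
      ∫ y in Metric.ball (0 : Phase d) 1, f (Real.sqrt t, y) :=
    (lt_mem_nhds ht).mono fun u hu => sublevelIntegral_eq W x hu
  refine HasDerivAt.congr_of_eventuallyEq (hmul.congr_deriv ?_) heq
  rw [sublevelIntegral_eq _ _ ht]
  simp only [dilatation_apply]
  have hi1 := integrableOn_section (μ := volume) Metric.ball_subset_closedBall hK hfc.continuous
    (Real.sqrt t)
  have hi2 := integrableOn_section (μ := volume) Metric.ball_subset_closedBall hK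
    (contDiff_parDeriv hfc).continuous (Real.sqrt t)
  simp only [hpar] at hi2 ⊢
  rw [integral_add (hi1.const_mul _) ((hi2.const_mul _).const_mul _)]
  simp only [integral_const_mul, Function.comp_apply, Complex.real_smul]
  set A := ∫ y in Metric.ball (0 : Phase d) 1, (W : Symbol d) x (Real.sqrt t • y)
  set B := ∫ y in Metric.ball (0 : Phase d) 1, (momDeriv y W : Symbol d) x (Real.sqrt t • y)
  have hs0 : (Real.sqrt t : ℂ) ≠ 0 := Complex.ofReal_ne_zero.2 hs.ne'
  have ht' : (t : ℂ) = (Real.sqrt t : ℂ) ^ 2 := by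
    rw [← Complex.ofReal_pow, Real.sq_sqrt ht.le]
  have hd1 : (d : ℂ) * (Real.sqrt t : ℂ) ^ d = d * (Real.sqrt t : ℂ) ^ (d - 1) * Real.sqrt t := by
    cases d with
    | zero => simp
    | succ d => rw [Nat.add_sub_cancel, pow_succ]; ring
  rw [ht']
  push_cast
  change (d : ℂ) * (Real.sqrt t : ℂ) ^ (d - 1) * (1 / (2 * (Real.sqrt t : ℂ))) * A + _ = _
  field_simp
  linear_combination -A * hd1

/-- The symbols whose integrals are the derivatives of the integral of `W` over balls. -/
def dilatationChain (W : smoothSymbols d) : ℕ → smoothSymbols d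
  | 0 => W
  | n + 1 => dilatation (dilatationChain W n) - (n : ℂ) • dilatationChain W n

theorem integrableOn_sublevel (W : smoothSymbols d) (x : Phase d) (t : ℝ) :
    IntegrableOn (fun p => (W : Symbol d) x p) {p : Phase d | ‖p‖ ^ 2 < t} := by
  have hW : Continuous (fun z : Phase d × Phase d => (W : Symbol d) z.1 z.2) :=
    ContDiff.continuous (n := ∞) W.2
  have hWx : Continuous (fun p => (W : Symbol d) x p) := hW.comp (by fun_prop : Continuous
    fun p : Phase d => (x, p))
  refine (hWx.continuousOn.integrableOn_compact
    (isCompact_closedBall (0 : Phase d) (Real.sqrt t))).mono_set fun p hp => ?_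
  rw [Metric.mem_closedBall, dist_zero_right]
  exact Real.le_sqrt_of_sq_le (le_of_lt hp)

theorem sublevelIntegral_sub_smul (V W : smoothSymbols d) (c : ℂ) (x : Phase d) (t : ℝ) :
    sublevelIntegral (V - c • W) x t = sublevelIntegral V x t - c * sublevelIntegral W x t := by
  rw [sublevelIntegral, sublevelIntegral, sublevelIntegral, ← integral_const_mul,
    ← integral_sub (integrableOn_sublevel V x t) ((integrableOn_sublevel W x t).const_mul c)]
  rfl

/-- This is `t^n (d/dt)^n = ∏ (t d/dt - i)` over `i < n`, with `t d/dt` realized on symbols by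
`dilatation`. -/
theorem iteratedDeriv_sublevelIntegral (W : smoothSymbols d) (x : Phase d) (n : ℕ) {t : ℝ}
    (ht : 0 < t) : iteratedDeriv n (sublevelIntegral W x) t =
      ((t : ℂ) ^ n)⁻¹ * sublevelIntegral (dilatationChain W n) x t := by
  induction n generalizing t with
  | zero => simp [dilatationChain]
  | succ n ih =>
    have heq : iteratedDeriv n (sublevelIntegral W x) =ᶠ[𝓝 t]
        fun t => ((t : ℂ) ^ n)⁻¹ * sublevelIntegral (dilatationChain W n) x t :=
      (lt_mem_nhds ht).mono fun u hu => ih hu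
    have ht0 : (t : ℂ) ≠ 0 := Complex.ofReal_ne_zero.2 ht.ne'
    have hpow : HasDerivAt (fun t : ℝ => ((t : ℂ) ^ n)⁻¹) (-n * ((t : ℂ) ^ (n + 1))⁻¹) t := by
      have h1 : HasDerivAt (fun t : ℝ => (t : ℂ) ^ n) (n * (t : ℂ) ^ (n - 1)) t :=
        (hasDerivAt_pow n (t : ℂ)).comp_ofReal
      refine (h1.inv (pow_ne_zero _ ht0)).congr_deriv ?_
      cases n with
      | zero => simp
      | succ n =>
        rw [Nat.add_sub_cancel]
        field_simp
        ring
    have hder := hpow.mul (hasDerivAt_sublevelIntegral (dilatationChain W n) x ht)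
    rw [iteratedDeriv_succ, heq.deriv_eq]
    refine hder.deriv.trans ?_
    rw [dilatationChain, sublevelIntegral_sub_smul, pow_succ, mul_inv]
    ring

theorem stepIntegral_eq (W : smoothSymbols d) (x : Phase d) (n : ℕ) {D : ℝ} (hD : 0 < D) :
    stepIntegral D n ((W : Symbol d) x) =
      ((D : ℂ) ^ n)⁻¹ * sublevelIntegral (dilatationChain W n) x D := by
  have h : (fun σ : ℝ => ∫ p in {p : Phase d | 0 < background D p + σ}, (W : Symbol d) x p) =
      fun σ => sublevelIntegral W x (D + σ) := by
    funext σ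
    rw [sublevelIntegral]
    congr 2
    ext p
    simp only [background, Set.mem_ofPred_eq]
    constructor <;> intro h <;> linarith
  rw [stepIntegral, h, iteratedDeriv_comp_const_add]
  simp only [add_zero]
  exact iteratedDeriv_sublevelIntegral W x n hD

/-! ### Compact support in position space -/

/-- The symbol `W(x, p)` vanishes for `x` outside `C`. -/
def VanishesOff (C : Set (Phase d)) (W : smoothSymbols d) : Prop :=
  ∀ x ∉ C, ∀ p, (W : Symbol d) x p = 0

theorem VanishesOff.dirDerivation {C : Set (Phase d)} (hC : IsClosed C) {W : smoothSymbols d}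
    (hW : VanishesOff C W) (v : Phase d × Phase d) : VanishesOff C (dirDerivation v W) := by
  intro x hx p
  have heq : (fun z : Phase d × Phase d => (W : Symbol d) z.1 z.2) =ᶠ[𝓝 (x, p)] fun _ => 0 := by
    have : (Prod.fst ⁻¹' Cᶜ : Set (Phase d × Phase d)) ∈ 𝓝 (x, p) :=
      (hC.isOpen_compl.preimage continuous_fst).mem_nhds hx
    exact Filter.mem_of_superset this fun z hz => hW z.1 hz z.2
  change fderiv ℝ (fun z : Phase d × Phase d => (W : Symbol d) z.1 z.2) (x, p) v = 0
  rw [heq.fderiv_eq]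
  simp

theorem VanishesOff.add {C : Set (Phase d)} {V W : smoothSymbols d}
    (hV : VanishesOff C V) (hW : VanishesOff C W) : VanishesOff C (V + W) := fun x hx p => by
  change (V : Symbol d) x p + (W : Symbol d) x p = 0
  rw [hV x hx p, hW x hx p, add_zero]

theorem VanishesOff.smul {C : Set (Phase d)} {W : smoothSymbols d}
    (hW : VanishesOff C W) (c : ℂ) : VanishesOff C (c • W) := fun x hx p => by
  change c * (W : Symbol d) x p = 0
  rw [hW x hx p, mul_zero]

theorem VanishesOff.mul_left {C : Set (Phase d)} {W : smoothSymbols d}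
    (hW : VanishesOff C W) (V : smoothSymbols d) : VanishesOff C (V * W) := fun x hx p => by
  change (V : Symbol d) x p * (W : Symbol d) x p = 0
  rw [hW x hx p, mul_zero]

theorem VanishesOff.dilatation {C : Set (Phase d)} (hC : IsClosed C) {W : smoothSymbols d}
    (hW : VanishesOff C W) : VanishesOff C (dilatation W) := by
  refine (hW.smul _).add (VanishesOff.smul (fun x hx p => ?_) _)
  rw [← sum_coe]
  exact Finset.sum_eq_zero fun i _ => (hW.dirDerivation hC _).mul_left _ x hx p

theorem VanishesOff.dilatationChain {C : Set (Phase d)} (hC : IsClosed C) {W : smoothSymbols d}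
    (hW : VanishesOff C W) (n : ℕ) : VanishesOff C (dilatationChain W n) := by
  induction n with
  | zero => exact hW
  | succ n ih =>
    rw [QuantizedVolume.dilatationChain, sub_eq_add_neg, ← neg_smul]
    exact (ih.dilatation hC).add (ih.smul _)

theorem VanishesOff.bi {C : Set (Phase d)} (hC : IsClosed C) {f : smoothSymbols d}
    (hf : VanishesOff C f) (g : smoothSymbols d) (r : BiPoly d) : VanishesOff C (bi f g r) := by
  revert f g
  induction r using biPoly_induction with
  | hC c =>
    intro f hf g
    rw [bi_C, mul_comm]
    exact (hf.mul_left g).smul c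
  | hadd p q hp hq =>
    intro f hf g
    rw [map_add]
    exact (hp hf g).add (hq hf g)
  | hX a j p hp =>
    intro f hf g
    fin_cases a
    · simp only [Fin.zero_eta, bi_X_zero_mul]
      exact hp (hf.dirDerivation hC _) g
    · simp only [Fin.mk_one, bi_X_one_mul]
      exact hp hf _
    · simp only [Fin.reduceFinMk, bi_X_two_mul]
      exact hp hf _
    · simp only [Fin.reduceFinMk, bi_X_three_mul]
      exact hp (hf.dirDerivation hC _) g
    · simp only [Fin.reduceFinMk, bi_X_four_mul]
      exact (hp hf g).mul_left _

theorem continuous_section (W : smoothSymbols d) (p : Phase d) :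
    Continuous fun x => (W : Symbol d) x p := by
  have hW : Continuous (fun z : Phase d × Phase d => (W : Symbol d) z.1 z.2) :=
    ContDiff.continuous (n := ∞) W.2
  exact hW.comp (by fun_prop : Continuous fun x : Phase d => (x, p))

theorem VanishesOff.integrable {C : Set (Phase d)} (hC : IsCompact C) {W : smoothSymbols d}
    (hW : VanishesOff C W) (p : Phase d) : Integrable fun x => (W : Symbol d) x p :=
  (continuous_section W p).integrable_of_hasCompactSupport
    (HasCompactSupport.intro hC fun x hx => hW x hx p)

theorem stepIntegral_eq_ballIntegral (W : smoothSymbols d) (x : Phase d) (n : ℕ) {D : ℝ}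
    (hD : 0 < D) : stepIntegral D n ((W : Symbol d) x) =
      ((D : ℂ) ^ n)⁻¹ * (Real.sqrt D : ℂ) ^ d *
        ∫ y in Metric.ball (0 : Phase d) 1,
          (dilatationChain W n : Symbol d) x (Real.sqrt D • y) := by
  rw [stepIntegral_eq W x n hD, sublevelIntegral_eq _ _ hD, mul_assoc]

theorem integral_stepIntegral {C : Set (Phase d)} (hC : IsCompact C) {W : smoothSymbols d}
    (hW : VanishesOff C W) (n : ℕ) {D : ℝ} (hD : 0 < D) :
    ∫ x, stepIntegral D n ((W : Symbol d) x) = ((D : ℂ) ^ n)⁻¹ * (Real.sqrt D : ℂ) ^ d *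
      ballAverage C (dilatationChain W n) (Real.sqrt D) := by
  simp only [stepIntegral_eq_ballIntegral W _ n hD]
  rw [integral_const_mul, ballAverage_eq hC,
    setIntegral_eq_integral_of_forall_compl_eq_zero fun x hx => ?_]
  simp [hW.dilatationChain hC.isClosed n x hx]

theorem integrable_stepIntegral {C : Set (Phase d)} (hC : IsCompact C) {W : smoothSymbols d}
    (hW : VanishesOff C W) (n : ℕ) {D : ℝ} (hD : 0 < D) :
    Integrable fun x => stepIntegral D n ((W : Symbol d) x) := by
  simp only [stepIntegral_eq_ballIntegral W _ n hD]
  refine Integrable.const_mul ?_ _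
  have hint := integrableOn_section (μ := volume) (prod_ball_subset C)
    (isCompact_prod_closedBall hC) (contDiff_scaled (dilatationChain W n)).continuous (Real.sqrt D)
  rw [Measure.volume_eq_prod, IntegrableOn, ← Measure.prod_restrict] at hint
  have h := hint.integral_prod_left
  refine (integrableOn_iff_integrable_of_support_subset fun x hx => ?_).1 h
  by_contra hxC
  exact hx (by simp [hW.dilatationChain hC.isClosed n x hxC])

/-! ### Asymptotics of momentum integrals for small energy -/

theorem iteratedDeriv_id_mul {f : ℝ → ℂ} (hf : ContDiff ℝ ∞ f) (j : ℕ) :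
    iteratedDeriv j (fun s : ℝ => (s : ℂ) * f s) =
      fun s => s * iteratedDeriv j f s + j * iteratedDeriv (j - 1) f s := by
  have hd : ∀ j s, HasDerivAt (iteratedDeriv j f) (iteratedDeriv (j + 1) f s) s := fun j s => by
    rw [iteratedDeriv_succ]
    refine DifferentiableAt.hasDerivAt ?_
    exact (hf.differentiable_iteratedDeriv j (by exact_mod_cast ENat.natCast_lt_top j)) s
  induction j with
  | zero => simp
  | succ j ih =>
    rw [iteratedDeriv_succ, ih]
    funext s
    have h1 : HasDerivAt (fun s : ℝ => (s : ℂ)) 1 s := Complex.ofRealCLM.hasDerivAt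
    have h2 := (h1.mul (hd j s)).add ((hd (j - 1) s).const_mul (j : ℂ))
    refine h2.deriv.trans ?_
    cases j with
    | zero => simp; ring
    | succ j =>
      simp only [Nat.add_sub_cancel]
      push_cast
      ring

/-- On the Taylor coefficient of degree `j` in `s` the Euler operator is multiplication by `j`, so a
dilatation acts as a scalar. -/
theorem iteratedDeriv_ballAverage_dilatation {C : Set (Phase d)} (hC : IsCompact C)
    (W : smoothSymbols d) (j : ℕ) : iteratedDeriv j (ballAverage C (dilatation W)) 0 =
      ((d : ℂ) + j) / 2 * iteratedDeriv j (ballAverage C W) 0 := by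
  have hG := contDiff_ballAverage hC W
  have hG' : ContDiff ℝ ∞ (deriv (ballAverage C W)) :=
    (contDiff_infty_iff_deriv.1 hG).2
  have h : ballAverage C (dilatation W) = fun s => (d : ℂ) / 2 * ballAverage C W s +
      1 / 2 * (s * deriv (ballAverage C W) s) := funext (ballAverage_dilatation hC W)
  have hmul : ContDiff ℝ ∞ (fun s : ℝ => (s : ℂ) * deriv (ballAverage C W) s) :=
    Complex.ofRealCLM.contDiff.mul hG'
  have hj : ((j : ℕ∞) : WithTop ℕ∞) ≤ ∞ := by exact_mod_cast le_top
  rw [h, iteratedDeriv_fun_add ((contDiff_const.mul hG).contDiffAt.of_le hj)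
    ((contDiff_const.mul hmul).contDiffAt.of_le hj), iteratedDeriv_const_mul_field,
    iteratedDeriv_const_mul_field, iteratedDeriv_id_mul hG']
  cases j with
  | zero => simp
  | succ j =>
    rw [Nat.add_sub_cancel, iteratedDeriv_succ']
    push_cast
    ring

theorem ballAverage_sub_smul {C : Set (Phase d)} (hC : IsCompact C) (V W : smoothSymbols d)
    (c : ℂ) : ballAverage C (V - c • W) = ballAverage C V - fun s => c * ballAverage C W s := by
  funext s
  have hi := fun W : smoothSymbols d => integrableOn_section (μ := volume) (prod_ball_subset C)
    (isCompact_prod_closedBall hC) (contDiff_scaled W).continuous s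
  rw [Pi.sub_apply, ballAverage, ballAverage, ballAverage, ← integral_const_mul,
    ← integral_sub (hi V) ((hi W).const_mul c)]
  rfl

theorem iteratedDeriv_ballAverage_dilatationChain {C : Set (Phase d)} (hC : IsCompact C)
    (W : smoothSymbols d) (n j : ℕ) : iteratedDeriv j (ballAverage C (dilatationChain W n)) 0 =
      (∏ i ∈ Finset.range n, (((d : ℂ) + j) / 2 - i)) * iteratedDeriv j (ballAverage C W) 0 := by
  induction n with
  | zero => simp [dilatationChain]
  | succ n ih =>
    have hj : ((j : ℕ∞) : WithTop ℕ∞) ≤ ∞ := by exact_mod_cast le_top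
    rw [dilatationChain, ballAverage_sub_smul hC, iteratedDeriv_sub
      ((contDiff_ballAverage hC _).contDiffAt.of_le hj)
      ((contDiff_const.mul (contDiff_ballAverage hC _)).contDiffAt.of_le hj),
      iteratedDeriv_const_mul_field, iteratedDeriv_ballAverage_dilatation hC, ih,
      Finset.prod_range_succ]
    ring

/-- The integral of `Δₚ^r W` over position space at vanishing momentum. -/
def laplaceMoment (W : smoothSymbols d) (r : ℕ) : ℂ :=
  ∫ x, (act ((∑ i, MvPolynomial.X (0, i) ^ 2) ^ r) W : Symbol d) x 0

theorem VanishesOff.act {C : Set (Phase d)} (hC : IsClosed C) {W : smoothSymbols d}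
    (hW : VanishesOff C W) (P : MvPolynomial (Fin 2 × Fin d) ℂ) : VanishesOff C (act P W) := by
  induction P using MvPolynomial.induction_on with
  | C c =>
    rw [← MvPolynomial.algebraMap_eq, AlgHom.commutes, Module.algebraMap_end_apply]
    exact hW.smul c
  | add P Q hP hQ =>
    rw [map_add, LinearMap.add_apply]
    exact hP.add hQ
  | mul_X P v hP =>
    rw [mul_comm, act_mul, act_X, partialEnd]
    split_ifs
    · exact hP.dirDerivation hC _
    · exact hP.dirDerivation hC _

/-- The Taylor coefficients at `s = 0` are directional derivatives averaged over the ball, and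
averaging an even power gives a power of the Laplacian. -/
theorem iteratedDeriv_ballAverage_even {C : Set (Phase d)} (hC : IsCompact C) (hd : 0 < d)
    {W : smoothSymbols d} (hW : VanishesOff C W) (r : ℕ) :
    iteratedDeriv (2 * r) (ballAverage C W) 0 = ballMoment d r * laplaceMoment W r := by
  have hz : ∀ x ∉ C, (ballMoment d r : ℂ) *
      (QuantizedVolume.act ((∑ i, MvPolynomial.X (0, i) ^ 2) ^ r) W : Symbol d) x 0 = 0 :=
    fun x hx => by rw [hW.act hC.isClosed _ x hx, mul_zero]
  rw [iteratedDeriv_ballAverage hC, laplaceMoment, ← integral_const_mul,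
    ← setIntegral_eq_integral_of_forall_compl_eq_zero hz]
  refine integral_congr_ae (Eventually.of_forall fun x => ?_)
  have h := integral_ball_directional_pow hd
    (fun i => (MvPolynomial.X (0, i) : MvPolynomial (Fin 2 × Fin d) ℂ))
    { toFun := fun P => (QuantizedVolume.act P W : Symbol d) x 0
      map_add' := fun P Q => by rw [map_add]; rfl
      map_smul' := fun c P => by rw [map_smul]; rfl } r
  refine Eq.trans ?_ h
  simp only [momDeriv_iterate_eq_act]
  rfl

theorem iteratedDeriv_ballAverage_odd {C : Set (Phase d)} (hC : IsCompact C)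
    (W : smoothSymbols d) (r : ℕ) :
    iteratedDeriv (2 * r + 1) (ballAverage C W) 0 = 0 := by
  rw [iteratedDeriv_ballAverage hC]
  refine integral_eq_zero_of_ae (Eventually.of_forall fun x => ?_)
  refine integral_ball_odd _ fun y => ?_
  simp only [momDeriv_iterate_eq_act]
  have : (∑ i, algebraMap ℂ (MvPolynomial (Fin 2 × Fin d) ℂ) (((-y) i : ℝ) : ℂ) *
      MvPolynomial.X (0, i)) = -∑ i, algebraMap ℂ (MvPolynomial (Fin 2 × Fin d) ℂ) ((y i : ℝ) : ℂ) *
        MvPolynomial.X (0, i) := by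
    simp [Finset.sum_neg_distrib]
  rw [this, Odd.neg_pow ⟨r, rfl⟩, map_neg]
  rfl

/-- The coefficient of `D^(d/2+r-n)` in the integral of the `n`-th derivative of the step function. -/
def stepCoeff (d n r : ℕ) : ℝ :=
  (∏ i ∈ Finset.range n, ((d : ℝ) / 2 + r - i)) * ballMoment d r / (2 * r).factorial

theorem sum_range_even {M : Type*} [AddCommMonoid M] (f : ℕ → M) (hf : ∀ r, f (2 * r + 1) = 0)
    (n : ℕ) : ∑ j ∈ Finset.range (2 * n + 1), f j = ∑ r ∈ Finset.range (n + 1), f (2 * r) := by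
  induction n with
  | zero => simp
  | succ n ih =>
    rw [show 2 * (n + 1) + 1 = 2 * n + 1 + 1 + 1 by ring, Finset.sum_range_succ,
      Finset.sum_range_succ, ih, Finset.sum_range_succ _ (n + 1), hf, add_zero]
    rfl

theorem tendsto_integral_stepIntegral_sub {C : Set (Phase d)} (hC : IsCompact C) (hd : 0 < d)
    {W : smoothSymbols d} (hW : VanishesOff C W) (n : ℕ) :
    Tendsto (fun D : ℝ => (∫ x, stepIntegral D n ((W : Symbol d) x)) -
      ∑ r ∈ Finset.range (n + 1), ((stepCoeff d n r : ℝ) : ℂ) * laplaceMoment W r *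
        ((D ^ ((d : ℝ) / 2 + r - n) : ℝ) : ℂ)) (𝓝[>] 0) (𝓝 0) := by
  set F := ballAverage C (dilatationChain W n) with hF
  -- Taylor order `2n` is needed because the prefactor is `s^(d-2n)` with `s = √D`: the remainder
  -- `o(s^(2n))` then becomes `o(s^d)`.
  have hFc : ContDiff ℝ ((2 * n : ℕ) : ℕ∞) F :=
    (contDiff_ballAverage hC _).of_le (by exact_mod_cast le_top)
  have hT := taylor_tendsto convex_univ (Set.mem_univ (0 : ℝ)) hFc.contDiffOn
  rw [nhdsWithin_univ] at hT
  have hsq : Tendsto Real.sqrt (𝓝[>] 0) (𝓝 0) := by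
    have := Real.continuous_sqrt.tendsto 0
    rw [Real.sqrt_zero] at this
    exact this.mono_left nhdsWithin_le_nhds
  have hd' : Tendsto (fun D : ℝ => (Real.sqrt D : ℂ) ^ d) (𝓝[>] 0) (𝓝 0) := by
    have := ((Complex.continuous_ofReal.tendsto 0).comp hsq).pow d
    simpa [hd.ne'] using this
  have h := hd'.mul (hT.comp hsq)
  rw [mul_zero] at h
  refine h.congr' ?_
  filter_upwards [self_mem_nhdsWithin] with D hD
  have hD : 0 < D := hD
  have hs := Real.sqrt_pos.2 hD
  set s := Real.sqrt D with hsdef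
  have hDs : (D : ℂ) = (s : ℂ) ^ 2 := by
    rw [← Complex.ofReal_pow, Real.sq_sqrt hD.le]
  rw [integral_stepIntegral hC hW n hD, ← hF, ← hsdef, Function.comp_apply, taylor_within_apply,
    sum_range_even _ fun r => ?_]
  · rw [smul_sub, mul_sub]
    congr 1
    · rw [hDs, Complex.real_smul]
      push_cast
      rw [sub_zero, ← pow_mul]
      ring
    · rw [Finset.smul_sum, Finset.mul_sum]
      refine Finset.sum_congr rfl fun r _ => ?_
      rw [iteratedDerivWithin_univ, iteratedDeriv_ballAverage_dilatationChain hC,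
        iteratedDeriv_ballAverage_even hC hd hW, stepCoeff]
      have hp : D ^ ((d : ℝ) / 2 + r - n) = s ^ d * ((s ^ (2 * n))⁻¹ * s ^ (2 * r)) := by
        rw [hsdef, Real.sqrt_eq_rpow, ← Real.rpow_natCast, ← Real.rpow_natCast, ← Real.rpow_natCast,
          ← Real.rpow_mul hD.le, ← Real.rpow_mul hD.le, ← Real.rpow_mul hD.le, ← Real.rpow_neg hD.le,
          ← Real.rpow_add hD, ← Real.rpow_add hD]
        congr 1
        push_cast
        ring
      rw [hp, sub_zero]
      simp only [Complex.real_smul]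
      push_cast
      have : ∀ i : ℕ, ((d : ℂ) + 2 * r) / 2 - i = (d : ℂ) / 2 + r - i := fun i => by ring
      simp only [this]
      ring
  · rw [iteratedDerivWithin_univ, iteratedDeriv_ballAverage_dilatationChain hC,
      iteratedDeriv_ballAverage_odd hC, mul_zero, smul_zero]

theorem gamma_add_half_div_factorial (r : ℕ) :
    Real.Gamma (r + 1 / 2) / (2 * r).factorial = Real.sqrt Real.pi / (4 ^ r * r.factorial) := by
  induction r with
  | zero =>
    rw [Nat.cast_zero, zero_add, Real.Gamma_one_half_eq]
    simp
  | succ r ih =>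
    have h : Real.Gamma ((r + 1 : ℕ) + 1 / 2) = (r + 1 / 2) * Real.Gamma (r + 1 / 2) := by
      rw [← Real.Gamma_add_one (by positivity)]
      congr 1
      push_cast
      ring
    rw [h, show 2 * (r + 1) = 2 * r + 1 + 1 by ring, Nat.factorial_succ, Nat.factorial_succ,
      Nat.factorial_succ, pow_succ]
    rw [div_eq_div_iff (by positivity) (by positivity)] at ih ⊢
    push_cast
    linear_combination (2 * (r + 1) * (2 * r + 1 : ℝ)) * ih

/-- The falling factorial from the energy derivatives and the Gamma function in the ball moment are
both `(m + r)!` and cancel. -/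
theorem stepCoeff_even (m r : ℕ) (hm : 0 < m) :
    stepCoeff (2 * m) (m + r) r = Real.pi ^ m / (4 ^ r * r.factorial) := by
  have hprod : ∏ i ∈ Finset.range (m + r), (((2 * m : ℕ) : ℝ) / 2 + r - i) = (m + r).factorial := by
    rw [← Finset.prod_range_reflect, ← Finset.prod_range_add_one_eq_factorial, Nat.cast_prod]
    refine Finset.prod_congr rfl fun i hi => ?_
    have : i + 1 ≤ m + r := Finset.mem_range.1 hi
    rw [show m + r - 1 - i = m + r - (i + 1) by omega, Nat.cast_sub this]
    push_cast
    ring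
  have hG : Real.Gamma (((2 * m : ℕ) : ℝ) / 2 + r + 1) = (m + r).factorial := by
    rw [← Real.Gamma_nat_eq_factorial]
    congr 1
    push_cast
    ring
  have hpi : Real.sqrt Real.pi * Real.sqrt Real.pi ^ (2 * m - 1) = Real.pi ^ m := by
    rw [← pow_succ', show 2 * m - 1 + 1 = 2 * m by omega, pow_mul, Real.sq_sqrt Real.pi_pos.le]
  have h := gamma_add_half_div_factorial r
  rw [stepCoeff, ballMoment, hprod, hG, ← hpi]
  have : ((m + r).factorial : ℝ) ≠ 0 := by positivity
  rw [mul_div_cancel₀ _ this, mul_div_right_comm, h]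
  ring

/-- In even dimension the falling factorial passes through zero, since `t^(m+r)` is a polynomial
killed by more than `m + r` derivatives. Hence no negative power of `D` occurs. -/
theorem stepCoeff_even_of_lt {m n r : ℕ} (h : m + r < n) : stepCoeff (2 * m) n r = 0 := by
  rw [stepCoeff, Finset.prod_eq_zero (Finset.mem_range.2 h) (by push_cast; ring)]
  simp

theorem tendsto_rpow_zero {a : ℝ} (ha : 0 < a) :
    Tendsto (fun D : ℝ => ((D ^ a : ℝ) : ℂ)) (𝓝[>] 0) (𝓝 0) := by
  have h := (Real.continuousAt_rpow_const 0 a (Or.inr ha.le)).tendsto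
  rw [Real.zero_rpow ha.ne'] at h
  have := (Complex.continuous_ofReal.tendsto 0).comp h
  exact this.mono_left nhdsWithin_le_nhds

/-- The limit of the momentum integrals at vanishing energy, in even dimension `2 m`. -/
def evenLimit (m n : ℕ) (W : smoothSymbols d) : ℂ :=
  if m ≤ n then ((Real.pi ^ m / (4 ^ (n - m) * (n - m).factorial) : ℝ) : ℂ) * laplaceMoment W (n - m)
  else 0

theorem tendsto_integral_stepIntegral {C : Set (Phase d)} (hC : IsCompact C) {m : ℕ} (hm : 0 < m)
    (hdm : d = 2 * m) {W : smoothSymbols d} (hW : VanishesOff C W) (n : ℕ) :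
    Tendsto (fun D : ℝ => ∫ x, stepIntegral D n ((W : Symbol d) x)) (𝓝[>] 0)
      (𝓝 (evenLimit m n W)) := by
  have hsum : Tendsto (fun D : ℝ =>
      ∑ r ∈ Finset.range (n + 1), ((stepCoeff d n r : ℝ) : ℂ) * laplaceMoment W r *
        ((D ^ ((d : ℝ) / 2 + r - n) : ℝ) : ℂ)) (𝓝[>] 0)
      (𝓝 (∑ r ∈ Finset.range (n + 1), if m + r = n then
        ((Real.pi ^ m / (4 ^ r * r.factorial) : ℝ) : ℂ) * laplaceMoment W r else 0)) := by
    refine tendsto_finsetSum _ fun r _ => ?_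
    have hexp : (d : ℝ) / 2 + r - n = (m : ℝ) + r - n := by rw [hdm]; push_cast; ring
    rw [hexp]
    split_ifs with h
    · have h0 : (m : ℝ) + r - n = 0 := by rw [← h]; push_cast; ring
      have hc : stepCoeff d n r = Real.pi ^ m / (4 ^ r * r.factorial) := by
        rw [hdm, ← h, stepCoeff_even m r hm]
      rw [h0, hc]
      simp
    · rcases Nat.lt_or_gt_of_ne h with h | h
      · have hc : stepCoeff d n r = 0 := by rw [hdm, stepCoeff_even_of_lt h]
        rw [hc]
        simp
      · have := (tendsto_rpow_zero (a := (m : ℝ) + r - n) (by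
          rw [sub_pos]; exact_mod_cast h)).const_mul (((stepCoeff d n r : ℝ) : ℂ) * laplaceMoment W r)
        rwa [mul_zero] at this
  have h := (tendsto_integral_stepIntegral_sub hC (by omega) hW n).add hsum
  simp only [sub_add_cancel, zero_add] at h
  convert h using 2
  rw [evenLimit]
  split_ifs with hmn
  · rw [Finset.sum_eq_single (n - m)]
    · rw [if_pos (by omega)]
    · intro r _ hr
      rw [if_neg (by omega)]
    · intro hr
      exact absurd (Finset.mem_range.2 (by omega)) hr
  · exact (Finset.sum_eq_zero fun r _ => if_neg (by omega)).symm

/-- The functions of the energy which are, up to terms vanishing in the limit, combinations of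
the powers `D^(-j-1/2)`. -/
def HasHalfIntegerExpansion (f : ℝ → ℂ) : Prop :=
  ∃ g ∈ Submodule.span ℂ (Set.range fun (j : ℕ) (D : ℝ) => ((D ^ (-(j : ℝ) - 1 / 2) : ℝ) : ℂ)),
    Tendsto (f - g) (𝓝[>] 0) (𝓝 0)

theorem HasHalfIntegerExpansion.const_mul {f : ℝ → ℂ} (hf : HasHalfIntegerExpansion f) (c : ℂ) :
    HasHalfIntegerExpansion fun D => c * f D := by
  obtain ⟨g, hg, h⟩ := hf
  refine ⟨c • g, Submodule.smul_mem _ c hg, ?_⟩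
  have := h.const_mul c
  rw [mul_zero] at this
  refine this.congr fun D => ?_
  simp [mul_sub]

theorem HasHalfIntegerExpansion.sum {ι : Type*} {s : Finset ι} {f : ι → ℝ → ℂ}
    (hf : ∀ i ∈ s, HasHalfIntegerExpansion (f i)) :
    HasHalfIntegerExpansion fun D => ∑ i ∈ s, f i D := by
  choose! g hg h using hf
  refine ⟨∑ i ∈ s, g i, Submodule.sum_mem _ hg, ?_⟩
  have := tendsto_finsetSum s h
  simp only [Finset.sum_const_zero] at this
  refine this.congr fun D => ?_
  simp [Finset.sum_sub_distrib]

theorem HasHalfIntegerExpansion.exists_sum {f : ℝ → ℂ} (hf : HasHalfIntegerExpansion f) :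
    ∃ (N : ℕ) (b : ℕ → ℂ), Tendsto (fun D : ℝ => f D -
      ∑ j ∈ Finset.range N, b j * ((D ^ (-(j : ℝ) - 1 / 2) : ℝ) : ℂ)) (𝓝[>] 0) (𝓝 0) := by
  obtain ⟨g, hg, h⟩ := hf
  rw [Finsupp.mem_span_range_iff_exists_finsupp] at hg
  obtain ⟨c, hc⟩ := hg
  refine ⟨c.support.sup id + 1, c, h.congr fun D => ?_⟩
  rw [Pi.sub_apply, ← hc, Finsupp.sum, Finset.sum_apply]
  congr 1
  refine Finset.sum_subset (fun j hj => Finset.mem_range.2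
    (Nat.lt_succ_of_le (Finset.le_sup (f := id) hj))) fun j _ hj => ?_
  simp [Finsupp.notMem_support_iff.1 hj]

/-- For `d = 2l + 1` the exponents `d/2 + r - n` are half-integers: the negative ones are among the
listed powers, the positive ones vanish in the limit. -/
theorem hasHalfIntegerExpansion_stepIntegral {C : Set (Phase d)} (hC : IsCompact C) (hd : Odd d)
    {W : smoothSymbols d} (hW : VanishesOff C W) (n : ℕ) :
    HasHalfIntegerExpansion fun D : ℝ => ∫ x, stepIntegral D n ((W : Symbol d) x) := by
  obtain ⟨l, hl⟩ := hd
  have hmono : ∀ r : ℕ, HasHalfIntegerExpansion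
      fun D : ℝ => ((D ^ ((d : ℝ) / 2 + r - n) : ℝ) : ℂ) := fun r => by
    rcases lt_or_ge (l + r) n with h | h
    · refine ⟨_, Submodule.subset_span ⟨n - (l + r) - 1, rfl⟩, ?_⟩
      have : (d : ℝ) / 2 + r - n = -((n - (l + r) - 1 : ℕ) : ℝ) - 1 / 2 := by
        rw [hl, Nat.sub_sub, Nat.cast_sub (by omega)]
        push_cast
        ring
      rw [this, sub_self]
      exact tendsto_const_nhds
    · refine ⟨0, Submodule.zero_mem _, ?_⟩
      rw [sub_zero]
      refine tendsto_rpow_zero ?_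
      have : (n : ℝ) ≤ l + r := by exact_mod_cast h
      rw [hl]
      push_cast
      linarith
  have hsum := HasHalfIntegerExpansion.sum (s := Finset.range (n + 1)) fun r _ =>
    (hmono r).const_mul (((stepCoeff d n r : ℝ) : ℂ) * laplaceMoment W r)
  obtain ⟨g, hg, h⟩ := hsum
  refine ⟨g, hg, ?_⟩
  have := (tendsto_integral_stepIntegral_sub hC (by omega) hW n).add h
  rw [add_zero] at this
  refine this.congr fun D => ?_
  simp

/-! ### Integrals of bidifferential expressions over position space -/

theorem integral_dX_eq_zero {C : Set (Phase d)} (hC : IsCompact C) {W : smoothSymbols d}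
    (hW : VanishesOff C W) (i : Fin d) (p : Phase d) : ∫ x, (dX i W : Symbol d) x p = 0 := by
  have hdiff : Differentiable ℝ fun x => (W : Symbol d) x p :=
    (smoothSymbols.differentiable W.2).comp
      (differentiable_id.prodMk (differentiable_const p))
  have heq : ∀ x, (dX i W : Symbol d) x p =
      fderiv ℝ (fun x => (W : Symbol d) x p) x (EuclideanSpace.single i 1) := fun x => by
    rw [coe_dX, dx, (hdiff x).lineDeriv_eq_fderiv]
  have hint := (hW.dirDerivation hC.isClosed (EuclideanSpace.single i 1, 0)).integrable hC p
  have hint' : Integrable fun x =>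
      fderiv ℝ (fun x => (W : Symbol d) x p) x (EuclideanSpace.single i 1) :=
    hint.congr (Eventually.of_forall heq)
  have h := integral_mul_fderiv_eq_neg_fderiv_mul_of_integrable (μ := volume)
    (f := fun x => (W : Symbol d) x p) (g := fun _ => (1 : ℂ)) (v := EuclideanSpace.single i 1)
    (by simpa using hint') (by simp) (by simpa using hW.integrable hC p)
    (fun x _ => hdiff x) (fun x _ => differentiableAt_const _)
  simp only [heq]
  simpa using h

section Functional

variable {C : Set (Phase d)} {h : smoothSymbols d}

/-- The integral of a bidifferential expression in `h` over position space, at `p = 0`. -/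
def biIntegral (hC : IsCompact C) (hh : VanishesOff C h) : BiPoly d →ₗ[ℂ] ℂ where
  toFun r := ∫ x, (bi h h r : Symbol d) x 0
  map_add' r s := by
    rw [map_add, ← integral_add ((hh.bi hC.isClosed h r).integrable hC 0)
      ((hh.bi hC.isClosed h s).integrable hC 0)]
    rfl
  map_smul' c r := by
    rw [map_smul, RingHom.id_apply, smul_eq_mul, ← integral_const_mul]
    rfl

variable (hC : IsCompact C) (hh : VanishesOff C h)

theorem biIntegral_momentum_mul (i : Fin d) (r : BiPoly d) :
    biIntegral hC hh (MvPolynomial.X (4, i) * r) = 0 := by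
  refine integral_eq_zero_of_ae (Eventually.of_forall fun x => ?_)
  rw [bi_X_four_mul]
  change (((0 : Phase d) i : ℝ) : ℂ) * _ = 0
  simp

theorem biIntegral_pairing_mul (a : Fin 5) (r : BiPoly d) :
    biIntegral hC hh (pairing d 4 a * r) = 0 := by
  rw [pairing, Finset.sum_mul, map_sum]
  refine Finset.sum_eq_zero fun i _ => ?_
  rw [mul_assoc, biIntegral_momentum_mul]

theorem biIntegral_position_mul (i : Fin d) (r : BiPoly d) :
    biIntegral hC hh ((MvPolynomial.X (2, i) + MvPolynomial.X (3, i)) * r) = 0 := by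
  change ∫ x, (bi h h _ : Symbol d) x 0 = 0
  rw [← dX_bi]
  exact integral_dX_eq_zero hC (hh.bi hC.isClosed h r) i 0

/-- The functional vanishes on the ideal generated by the sums of the variables 2 and 3; the
cofactor `s` lets the induction replace the variables one at a time. -/
theorem biIntegral_mul_byParts (s r : BiPoly d) :
    biIntegral hC hh (s * byParts d r) = biIntegral hC hh (s * r) := by
  induction r using MvPolynomial.induction_on generalizing s with
  | C c => rw [byParts, MvPolynomial.aeval_C]; rfl
  | add p q hp hq => rw [map_add, mul_add, mul_add, map_add, map_add, hp, hq]
  | mul_X p v hp =>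
    have hv : biIntegral hC hh (s * p * byParts d (MvPolynomial.X v)) =
        biIntegral hC hh (s * p * MvPolynomial.X v) := by
      obtain ⟨a, i⟩ := v
      rw [byParts_X]
      split_ifs with ha
      · subst ha
        rw [eq_comm, ← sub_eq_zero, ← map_sub, show s * p * MvPolynomial.X (3, i) -
          s * p * -MvPolynomial.X (2, i) =
          (MvPolynomial.X (2, i) + MvPolynomial.X (3, i)) * (s * p) by ring]
        exact biIntegral_position_mul hC hh i _
      · rfl
    rw [map_mul (byParts d), ← mul_assoc, mul_right_comm, hp, mul_right_comm, hv, mul_assoc]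

theorem biIntegral_byParts (r : BiPoly d) :
    biIntegral hC hh (byParts d r) = biIntegral hC hh r := by
  simpa using biIntegral_mul_byParts hC hh 1 r

theorem biIntegral_swap (r : BiPoly d) :
    biIntegral hC hh (MvPolynomial.rename
      (fun v => ((![1, 0, 3, 2, 4] : Fin 5 → Fin 5) v.1, v.2)) r) = biIntegral hC hh r := by
  change ∫ x, (bi h h _ : Symbol d) x 0 = ∫ x, (bi h h _ : Symbol d) x 0
  rw [← bi_swap]

end Functional

/-! ### Momentum derivatives of bidifferential expressions -/

/-- The momentum derivative, on symbols of bidifferential operators. -/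
def momOp (i : Fin d) : Module.End ℂ (BiPoly d) :=
  (MvPolynomial.pderiv (4, i)).toLinearMap +
    LinearMap.mulLeft ℂ (MvPolynomial.X (0, i) + MvPolynomial.X (1, i))

theorem momOp_apply (i : Fin d) (r : BiPoly d) : momOp i r =
    MvPolynomial.pderiv (4, i) r + (MvPolynomial.X (0, i) + MvPolynomial.X (1, i)) * r := rfl

variable (d) in
/-- The Laplace operator in momentum space, on symbols of bidifferential operators. -/
def lapOp : Module.End ℂ (BiPoly d) := ∑ i, momOp i * momOp i

theorem lapOp_apply (r : BiPoly d) : lapOp d r = ∑ i, momOp i (momOp i r) := by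
  simp [lapOp]

theorem act_laplace_bi (f g : smoothSymbols d) (n : ℕ) (r : BiPoly d) :
    act ((∑ i, MvPolynomial.X (0, i) ^ 2) ^ n) (bi f g r) = bi f g ((lapOp d ^ n) r) := by
  have h1 : ∀ r, act (∑ i, MvPolynomial.X (0, i) ^ 2) (bi f g r) = bi f g (lapOp d r) := fun r => by
    rw [map_sum, LinearMap.sum_apply, lapOp_apply, map_sum]
    refine Finset.sum_congr rfl fun i _ => ?_
    rw [pow_two, act_mul, act_X_zero, act_X_zero, dP_bi, dP_bi]
    rfl
  induction n generalizing r with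
  | zero => simp
  | succ n ih => rw [pow_succ', act_mul, ih, h1, pow_succ', Module.End.mul_apply]

theorem laplaceMoment_bi {C : Set (Phase d)} (hC : IsCompact C) {h : smoothSymbols d}
    (hh : VanishesOff C h) (r : BiPoly d) (n : ℕ) :
    laplaceMoment (bi h h r) n = biIntegral hC hh ((lapOp d ^ n) r) := by
  rw [laplaceMoment, act_laplace_bi]
  rfl

theorem byParts_pderiv (i : Fin d) (r : BiPoly d) :
    byParts d (MvPolynomial.pderiv (4, i) r) = MvPolynomial.pderiv (4, i) (byParts d r) := by
  induction r using MvPolynomial.induction_on with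
  | C c =>
    have : byParts d (MvPolynomial.C c) = MvPolynomial.C c := (byParts d).commutes c
    rw [this, MvPolynomial.pderiv_C, map_zero]
  | add p q hp hq => simp only [map_add, hp, hq]
  | mul_X p v hp =>
    obtain ⟨a, j⟩ := v
    have hX : byParts d (MvPolynomial.pderiv (4, i) (MvPolynomial.X (a, j))) =
        MvPolynomial.pderiv (4, i) (byParts d (MvPolynomial.X (a, j))) := by
      rw [byParts_X]
      by_cases ha : a = 3
      · subst ha
        simp
      · rw [if_neg ha, MvPolynomial.pderiv_X, Pi.single_apply]
        split_ifs <;> simp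
    simp only [map_mul, Derivation.leibniz, map_add, smul_eq_mul, hp, hX]

theorem byParts_lapOp (r : BiPoly d) : byParts d (lapOp d r) = lapOp d (byParts d r) := by
  have h1 : ∀ i r, byParts d (momOp i r) = momOp i (byParts d r) := fun i r => by
    rw [momOp_apply, momOp_apply, map_add, map_mul, map_add, byParts_pderiv, byParts_X, byParts_X]
    simp
  simp only [lapOp_apply, map_sum, h1]

theorem byParts_lapOp_pow (n : ℕ) (r : BiPoly d) :
    byParts d ((lapOp d ^ n) r) = (lapOp d ^ n) (byParts d r) := by
  induction n generalizing r with
  | zero => rfl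
  | succ n ih => rw [pow_succ, Module.End.mul_apply, ih, byParts_lapOp]; rfl

/-- The symbols of bidifferential operators with constant coefficients. -/
def constantSymbols (d : ℕ) : Subalgebra ℂ (BiPoly d) where
  carrier := {s | ∀ i, MvPolynomial.pderiv (4, i) s = 0}
  mul_mem' {a b} ha hb i := by
    rw [Derivation.leibniz, ha i, hb i, smul_zero, smul_zero, add_zero]
  add_mem' {a b} ha hb i := by rw [map_add, ha i, hb i, add_zero]
  algebraMap_mem' c i := MvPolynomial.pderiv_C

theorem X_mem_constantSymbols {a : Fin 5} (ha : a ≠ 4) (i : Fin d) :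
    MvPolynomial.X (a, i) ∈ constantSymbols d := fun j =>
  MvPolynomial.pderiv_X_of_ne (by simp [ha])

theorem pairing_mem_constantSymbols {a b : Fin 5} (ha : a ≠ 4) (hb : b ≠ 4) :
    pairing d a b ∈ constantSymbols d :=
  Subalgebra.sum_mem _ fun i _ =>
    Subalgebra.mul_mem _ (X_mem_constantSymbols ha i) (X_mem_constantSymbols hb i)

/-! ### Powers of the momentum Laplacian on plane waves -/

variable (d) in
/-- `q²`, where `q` stands for the total momentum derivative. -/
def momSq : BiPoly d := ∑ i, (MvPolynomial.X (0, i) + MvPolynomial.X (1, i)) ^ 2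

variable (d) in
/-- `qk`, where `q` stands for the total momentum derivative. -/
def momPos : BiPoly d := pairing d 2 0 + pairing d 2 1

variable (d) in
/-- `(q + v k)²`, as a power series in `v`. -/
def shiftedSq : PowerSeries (BiPoly d) :=
  PowerSeries.C (momSq d) + PowerSeries.X * PowerSeries.C (2 * momPos d) +
    PowerSeries.X ^ 2 * PowerSeries.C (pairing d 2 2)

variable (d) in
/-- `exp(v p k)`, as a power series in `v`. -/
def planeWave : PowerSeries (BiPoly d) :=
  PowerSeries.mk fun j => MvPolynomial.C (j.factorial : ℂ)⁻¹ * pairing d 4 2 ^ j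

theorem pderiv_pairing (i : Fin d) :
    MvPolynomial.pderiv (4, i) (pairing d 4 2) = MvPolynomial.X (2, i) := by
  rw [pairing, map_sum, Finset.sum_eq_single i]
  · rw [Derivation.leibniz, MvPolynomial.pderiv_X_self, MvPolynomial.pderiv_X_of_ne (by simp)]
    simp
  · intro j _ hj
    rw [Derivation.leibniz, MvPolynomial.pderiv_X_of_ne (by simp),
      MvPolynomial.pderiv_X_of_ne (by simp [hj])]
    simp
  · simp

/-- Coefficientwise in `v`, this is the rule that `∂ₚ` brings down `vk` from `exp(v pk)`, besides
acting on the two factors. -/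
theorem momOp_planeWave (i : Fin d) (j : ℕ) :
    momOp i (PowerSeries.coeff j (planeWave d)) = PowerSeries.coeff j
      ((PowerSeries.C (MvPolynomial.X (0, i) + MvPolynomial.X (1, i)) +
        PowerSeries.X * PowerSeries.C (MvPolynomial.X (2, i))) * planeWave d) := by
  rw [momOp_apply, add_mul (PowerSeries.C _), map_add (PowerSeries.coeff j),
    PowerSeries.coeff_C_mul, mul_assoc, add_comm (MvPolynomial.pderiv _ _)]
  congr 1
  cases j with
  | zero => simp [planeWave]
  | succ j =>
    rw [PowerSeries.coeff_succ_X_mul, PowerSeries.coeff_C_mul]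
    simp only [planeWave, PowerSeries.coeff_mk, Derivation.leibniz, Derivation.leibniz_pow,
      pderiv_pairing, MvPolynomial.pderiv_C, smul_eq_mul, nsmul_eq_mul,
      Nat.add_sub_cancel]
    have : MvPolynomial.C ((j + 1).factorial : ℂ)⁻¹ * ((j + 1 : ℕ) : BiPoly d) =
        MvPolynomial.C (j.factorial : ℂ)⁻¹ := by
      rw [← map_natCast (MvPolynomial.C (R := ℂ) (σ := Fin 5 × Fin d)), ← map_mul]
      congr 1
      rw [Nat.factorial_succ]
      push_cast
      have : ((j : ℂ) + 1) ≠ 0 := by exact_mod_cast Nat.succ_ne_zero j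
      have : (j.factorial : ℂ) ≠ 0 := by exact_mod_cast j.factorial_ne_zero
      field_simp
    linear_combination (pairing d 4 2 ^ j * MvPolynomial.X (2, i)) * this

/-- The power series whose coefficients are independent of the momentum. -/
def constantSeries (d : ℕ) : Subsemiring (PowerSeries (BiPoly d)) where
  carrier := {c | ∀ j, PowerSeries.coeff j c ∈ constantSymbols d}
  mul_mem' {a b} ha hb j := by
    rw [PowerSeries.coeff_mul]
    exact Subalgebra.sum_mem _ fun x _ => Subalgebra.mul_mem _ (ha _) (hb _)
  one_mem' j := by
    rw [PowerSeries.coeff_one]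
    split_ifs
    · exact Subalgebra.one_mem _
    · exact Subalgebra.zero_mem _
  add_mem' {a b} ha hb j := by
    rw [map_add]
    exact Subalgebra.add_mem _ (ha j) (hb j)
  zero_mem' j := by
    rw [map_zero]
    exact Subalgebra.zero_mem _

theorem C_mem_constantSeries {s : BiPoly d} (hs : s ∈ constantSymbols d) :
    PowerSeries.C s ∈ constantSeries d := fun j => by
  rw [PowerSeries.coeff_C]
  split_ifs
  · exact hs
  · exact Subalgebra.zero_mem _

theorem X_mem_constantSeries : PowerSeries.X ∈ constantSeries d := fun j => by
  rw [PowerSeries.coeff_X]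
  split_ifs
  · exact Subalgebra.one_mem _
  · exact Subalgebra.zero_mem _

theorem map_coeff_mul {L : Module.End ℂ (BiPoly d)}
    (hL : ∀ s ∈ constantSymbols d, ∀ r, L (s * r) = s * L r) {c f g : PowerSeries (BiPoly d)}
    (hc : ∀ j, PowerSeries.coeff j c ∈ constantSymbols d)
    (h : ∀ j, L (PowerSeries.coeff j f) = PowerSeries.coeff j g) (j : ℕ) :
    L (PowerSeries.coeff j (c * f)) = PowerSeries.coeff j (c * g) := by
  rw [PowerSeries.coeff_mul, PowerSeries.coeff_mul, map_sum]
  exact Finset.sum_congr rfl fun x _ => by rw [hL _ (hc x.1), h]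

theorem momOp_mul (i : Fin d) {s : BiPoly d} (hs : s ∈ constantSymbols d) (r : BiPoly d) :
    momOp i (s * r) = s * momOp i r := by
  rw [momOp_apply, momOp_apply, Derivation.leibniz, hs i, smul_zero, add_zero, smul_eq_mul]
  ring

theorem lapOp_mul {s : BiPoly d} (hs : s ∈ constantSymbols d) (r : BiPoly d) :
    lapOp d (s * r) = s * lapOp d r := by
  simp only [lapOp_apply, momOp_mul _ hs, Finset.mul_sum]

theorem lapOp_pow_mul {s : BiPoly d} (hs : s ∈ constantSymbols d) (n : ℕ) (r : BiPoly d) :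
    (lapOp d ^ n) (s * r) = s * (lapOp d ^ n) r := by
  induction n generalizing r with
  | zero => rfl
  | succ n ih => rw [pow_succ, Module.End.mul_apply, lapOp_mul hs, ih]; rfl

theorem sum_sq_wave : ∑ i : Fin d, (PowerSeries.C (MvPolynomial.X (0, i) + MvPolynomial.X (1, i)) +
    PowerSeries.X * PowerSeries.C (MvPolynomial.X (2, i))) ^ 2 = shiftedSq d := by
  simp only [shiftedSq, momSq, momPos, pairing, add_sq, map_sum, map_add,
    map_mul, map_pow, Finset.mul_sum, mul_pow, ← Finset.sum_add_distrib]
  refine Finset.sum_congr rfl fun i _ => ?_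
  rw [show PowerSeries.C (2 : BiPoly d) = 2 from map_ofNat _ 2]
  ring

/-- `exp(v pk)` is an eigenvector of each momentum derivative over the series with constant
coefficients, so the Laplacian multiplies it by `(q + vk)²`. -/
theorem lapOp_planeWave (j : ℕ) : lapOp d (PowerSeries.coeff j (planeWave d)) =
    PowerSeries.coeff j (shiftedSq d * planeWave d) := by
  rw [lapOp_apply, ← sum_sq_wave, Finset.sum_mul, map_sum]
  refine Finset.sum_congr rfl fun i _ => ?_
  rw [momOp_planeWave, pow_two, mul_assoc]
  refine map_coeff_mul (fun s hs r => momOp_mul i hs r) (Subsemiring.add_mem (constantSeries d)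
    (C_mem_constantSeries (Subalgebra.add_mem _ ?_ ?_))
    (Subsemiring.mul_mem _ X_mem_constantSeries (C_mem_constantSeries ?_))) (momOp_planeWave i) j
  all_goals exact X_mem_constantSymbols (by decide) i

theorem momSq_mem_constantSymbols : momSq d ∈ constantSymbols d :=
  Subalgebra.sum_mem _ fun i _ => Subalgebra.pow_mem _ (Subalgebra.add_mem _
    (X_mem_constantSymbols (by decide) i) (X_mem_constantSymbols (by decide) i)) 2

theorem momPos_mem_constantSymbols : momPos d ∈ constantSymbols d :=
  Subalgebra.add_mem _ (pairing_mem_constantSymbols (by decide) (by decide))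
    (pairing_mem_constantSymbols (by decide) (by decide))

theorem shiftedSq_mem_constantSeries : shiftedSq d ∈ constantSeries d :=
  Subsemiring.add_mem _ (Subsemiring.add_mem _ (C_mem_constantSeries momSq_mem_constantSymbols)
    (Subsemiring.mul_mem _ X_mem_constantSeries (C_mem_constantSeries
      (Subalgebra.mul_mem _ (ofNat_mem _ 2) momPos_mem_constantSymbols))))
    (Subsemiring.mul_mem _ (Subsemiring.pow_mem _ X_mem_constantSeries 2) (C_mem_constantSeries
      (pairing_mem_constantSymbols (by decide) (by decide))))

theorem lapOp_pow_planeWave (n j : ℕ) : (lapOp d ^ n) (PowerSeries.coeff j (planeWave d)) =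
    PowerSeries.coeff j (shiftedSq d ^ n * planeWave d) := by
  induction n generalizing j with
  | zero => simp
  | succ n ih =>
    rw [pow_succ', Module.End.mul_apply, ih]
    have hc := Subsemiring.pow_mem _ (shiftedSq_mem_constantSeries (d := d)) n
    rw [map_coeff_mul (fun s hs r => lapOp_mul hs r) hc lapOp_planeWave, ← mul_assoc, pow_succ]

/-- `(pk)^j` is `j!` times a coefficient of the plane wave, on which the Laplacian is
multiplication. At `p = 0` the plane wave is 1, so only the coefficient of `v^j` in the multiplier
remains. -/
theorem biIntegral_lapOp_pow {C : Set (Phase d)} {h : smoothSymbols d} (hC : IsCompact C)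
    (hh : VanishesOff C h) {s : BiPoly d} (hs : s ∈ constantSymbols d) (n j : ℕ) :
    biIntegral hC hh ((lapOp d ^ n) (s * pairing d 4 2 ^ j)) =
      j.factorial * biIntegral hC hh (s * PowerSeries.coeff j (shiftedSq d ^ n)) := by
  have hj : (j.factorial : ℂ) ≠ 0 := by exact_mod_cast j.factorial_ne_zero
  have hpow : pairing d 4 2 ^ j = (j.factorial : ℂ) • PowerSeries.coeff j (planeWave d) := by
    rw [planeWave, PowerSeries.coeff_mk, ← MvPolynomial.smul_eq_C_mul, smul_smul,
      mul_inv_cancel₀ hj, one_smul]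
  rw [lapOp_pow_mul hs, hpow, map_smul, mul_smul_comm, map_smul, smul_eq_mul, lapOp_pow_planeWave,
    PowerSeries.coeff_mul, Finset.mul_sum, map_sum, Finset.sum_eq_single (j, 0)]
  · simp [planeWave]
  · rintro ⟨a, b⟩ hab hne
    have hb : b ≠ 0 := by
      rintro rfl
      exact hne (by simpa using hab)
    obtain ⟨b, rfl⟩ := Nat.exists_eq_succ_of_ne_zero hb
    rw [planeWave, PowerSeries.coeff_mk, pow_succ, show ∀ x y z w u : BiPoly d,
      x * (y * (z * (w * u))) = u * (x * y * z * w) by intros; ring]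
    exact biIntegral_pairing_mul hC hh 2 _
  · simp

/-! ### Moments of the interval -/

/-- The integral of `(1 - s) (s (1 - s))^M (s - 1/2)^B` over the unit interval. -/
def weightedMoment (M B : ℕ) : ℝ :=
  ∫ s in (0 : ℝ)..1, (1 - s) * ((s * (1 - s)) ^ M * (s - 1 / 2) ^ B)

theorem integral_one_sub_mul_pow (n : ℕ) :
    ∫ s in (0 : ℝ)..1, (1 - s) * s ^ n = 1 / ((n + 1) * (n + 2)) := by
  have h : ∀ s : ℝ, (1 - s) * s ^ n = s ^ n - s ^ (n + 1) := fun s => by ring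
  simp only [h]
  rw [intervalIntegral.integral_sub (Continuous.intervalIntegrable (by fun_prop) _ _)
    (Continuous.intervalIntegrable (by fun_prop) _ _), integral_pow, integral_pow]
  push_cast
  field_simp
  ring

/-- The expansion is arranged so that its terms match the sums over `b` and `c` in
`expansionTerm_eq`: `b` is the order of the star exponential, and the last factor is `N!/(N+2)!` for
the star power `N + 2`. -/
theorem weightedMoment_eq_sum (M B : ℕ) : weightedMoment M B =
    ∑ b ∈ Finset.range (B + 1), ∑ c ∈ Finset.range (M + 1),
      (-1 / 2) ^ b * (B.choose b) * ((-1) ^ c * (M.choose c)) *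
        (1 / (((M + (B - b) + c : ℕ) + 1) * ((M + (B - b) + c : ℕ) + 2)) : ℝ) := by
  have h : ∀ s : ℝ, (1 - s) * ((s * (1 - s)) ^ M * (s - 1 / 2) ^ B) =
      ∑ b ∈ Finset.range (B + 1), ∑ c ∈ Finset.range (M + 1),
        (-1 / 2) ^ b * (B.choose b) * ((-1) ^ c * (M.choose c)) *
          ((1 - s) * s ^ (M + (B - b) + c)) := fun s => by
    have h1 : (s - 1 / 2) ^ B = ∑ b ∈ Finset.range (B + 1), (-1 / 2) ^ b * s ^ (B - b) *
        B.choose b := by rw [← add_pow]; ring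
    have h2 : (1 - s) ^ M = ∑ c ∈ Finset.range (M + 1), (-s) ^ c * 1 ^ (M - c) *
        M.choose c := by rw [← add_pow]; ring
    rw [mul_pow, h1, h2, Finset.mul_sum, Finset.mul_sum]
    refine Finset.sum_congr rfl fun b _ => ?_
    rw [Finset.mul_sum, Finset.sum_mul, Finset.mul_sum]
    refine Finset.sum_congr rfl fun c _ => ?_
    rw [pow_add, pow_add, neg_pow s, one_pow]
    ring
  simp only [weightedMoment, h]
  rw [intervalIntegral.integral_finsetSum fun b _ => Continuous.intervalIntegrable (by fun_prop) _ _]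
  refine Finset.sum_congr rfl fun b _ => ?_
  rw [intervalIntegral.integral_finsetSum fun b _ => Continuous.intervalIntegrable (by fun_prop) _ _]
  refine Finset.sum_congr rfl fun c _ => ?_
  rw [intervalIntegral.integral_const_mul, integral_one_sub_mul_pow]

theorem integral_symmetric_moment (M j : ℕ) :
    ∫ s in (0 : ℝ)..1, (s * (1 - s)) ^ M * (s - 1 / 2) ^ (2 * j) =
      M.factorial * Real.Gamma (j + 1 / 2) /
        (2 * 4 ^ (M + j) * Real.Gamma (((M + j : ℕ) : ℝ) + 3 / 2)) := by
  have hG : ∀ x : ℝ, 0 < x → Real.Gamma (x + 1) = x * Real.Gamma x := fun x hx =>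
    Real.Gamma_add_one hx.ne'
  induction M generalizing j with
  | zero =>
    have h := hG (j + 1 / 2) (by positivity)
    have h0 : Real.Gamma (j + 1 / 2 : ℝ) ≠ 0 := (Real.Gamma_pos_of_pos (by positivity)).ne'
    have hshift : ∫ s in (0 : ℝ)..1, (s - 1 / 2) ^ (2 * j) =
        ∫ s in (0 - 1 / 2 : ℝ)..(1 - 1 / 2), s ^ (2 * j) :=
      intervalIntegral.integral_comp_sub_right (fun s => s ^ (2 * j)) (1 / 2)
    simp only [pow_zero, one_mul]
    rw [hshift, integral_pow, show (((0 + j : ℕ) : ℝ) + 3 / 2) = (j + 1 / 2) + 1 by push_cast; ring, h,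
      pow_succ, pow_succ, pow_mul, pow_mul, Nat.factorial_zero, zero_add]
    norm_num
    rw [one_div_pow] 
    field_simp
    ring
  | succ M ih =>
    -- From `s(1-s) = 1/4 - (s - 1/2)²`, which lowers `M` at the price of raising `j`.
    have h : ∀ s : ℝ, (s * (1 - s)) ^ (M + 1) * (s - 1 / 2) ^ (2 * j) =
        1 / 4 * ((s * (1 - s)) ^ M * (s - 1 / 2) ^ (2 * j)) -
          (s * (1 - s)) ^ M * (s - 1 / 2) ^ (2 * (j + 1)) := fun s => by ring
    simp only [h]
    rw [intervalIntegral.integral_sub (Continuous.intervalIntegrable (by fun_prop) _ _)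
      (Continuous.intervalIntegrable (by fun_prop) _ _), intervalIntegral.integral_const_mul, ih, ih]
    have h1 := hG (j + 1 / 2) (by positivity)
    have h2 := hG (((M + j : ℕ) : ℝ) + 3 / 2) (by positivity)
    have e1 : (((j + 1 : ℕ) : ℝ) + 1 / 2) = j + 1 / 2 + 1 := by push_cast; ring
    have e2 : (((M + (j + 1) : ℕ) : ℝ) + 3 / 2) = ((M + j : ℕ) : ℝ) + 3 / 2 + 1 := by push_cast; ring
    have e3 : (((M + 1 + j : ℕ) : ℝ) + 3 / 2) = ((M + j : ℕ) : ℝ) + 3 / 2 + 1 := by push_cast; ring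
    have h0 : Real.Gamma (((M + j : ℕ) : ℝ) + 3 / 2) ≠ 0 :=
      (Real.Gamma_pos_of_pos (by positivity)).ne'
    have h3 : (((M + j : ℕ) : ℝ) + 3 / 2) ≠ 0 := by positivity
    rw [e1, e2, e3, h1, h2, Nat.factorial_succ, show M + 1 + j = M + j + 1 by ring,
      show M + (j + 1) = M + j + 1 by ring, pow_succ]
    field_simp
    push_cast
    ring

/-- For an even power the rest of the integrand is invariant under `s ↦ 1 - s`, which exchanges the
weights `1 - s` and `s`. The weight may thus be replaced by its mean `1/2`. -/
theorem weightedMoment_even (M j : ℕ) : weightedMoment M (2 * j) =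
    M.factorial * Real.Gamma (j + 1 / 2) /
      (4 ^ (M + j + 1) * Real.Gamma (((M + j : ℕ) : ℝ) + 3 / 2)) := by
  have hrefl := intervalIntegral.integral_comp_sub_left
    (fun s : ℝ => (1 - s) * ((s * (1 - s)) ^ M * (s - 1 / 2) ^ (2 * j))) (a := 0) (b := 1) 1
  rw [sub_self, sub_zero, ← weightedMoment] at hrefl
  have hadd : weightedMoment M (2 * j) + weightedMoment M (2 * j) =
      ∫ s in (0 : ℝ)..1, (s * (1 - s)) ^ M * (s - 1 / 2) ^ (2 * j) := by
    nth_rewrite 1 [← hrefl]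
    rw [weightedMoment, ← intervalIntegral.integral_add
      (Continuous.intervalIntegrable (by fun_prop) _ _)
      (Continuous.intervalIntegrable (by fun_prop) _ _)]
    congr 1
    funext s
    rw [show (1 - s - 1 / 2 : ℝ) ^ (2 * j) = (s - 1 / 2) ^ (2 * j) by
      rw [pow_mul, pow_mul]; ring]
    ring
  rw [integral_symmetric_moment] at hadd
  rw [show weightedMoment M (2 * j) = (weightedMoment M (2 * j) + weightedMoment M (2 * j)) / 2 by
    ring, hadd, pow_succ]
  field_simp
  norm_num

/-! ### The limit of the quadratic action -/

theorem coeff_shiftedSq_pow (r j : ℕ) : PowerSeries.coeff j (shiftedSq d ^ r) =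
    ∑ u ∈ Finset.range (r + 1), if r - u ≤ j ∧ j ≤ 2 * (r - u) then
      ((r.choose u * (r - u).choose (j - (r - u)) * 2 ^ (2 * (r - u) - j) : ℕ) : ℂ) •
        (momSq d ^ u * pairing d 2 2 ^ (j - (r - u)) * momPos d ^ (2 * (r - u) - j)) else 0 := by
  have h : shiftedSq d = PowerSeries.C (momSq d) + PowerSeries.X *
      (PowerSeries.X * PowerSeries.C (pairing d 2 2) + PowerSeries.C (2 * momPos d)) := by
    rw [shiftedSq]
    ring
  rw [h, add_pow, map_sum]
  refine Finset.sum_congr rfl fun u _ => ?_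
  rw [mul_pow, ← map_pow, ← map_natCast (PowerSeries.C (R := BiPoly d)), mul_comm, ← mul_assoc,
    ← map_mul, PowerSeries.coeff_C_mul, PowerSeries.coeff_X_pow_mul', coeff_linear_pow]
  by_cases h1 : r - u ≤ j
  · by_cases h2 : j ≤ 2 * (r - u)
    · rw [if_pos h1, if_pos (by omega), if_pos ⟨h1, h2⟩,
        show r - u - (j - (r - u)) = 2 * (r - u) - j by omega, MvPolynomial.smul_eq_C_mul,
        map_natCast]
      push_cast
      ring
    · rw [if_pos h1, if_neg (by omega), if_neg (by omega), mul_zero]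
  · rw [if_neg h1, if_neg (by omega), mul_zero]

section Functional

variable {C : Set (Phase d)} {h : smoothSymbols d} (hC : IsCompact C) (hh : VanishesOff C h)

/-- The integral of the bidifferential operator with symbol `(q²)^u (k²)^M (qk)^B`. -/
def scalarIntegral (u M B : ℕ) : ℂ :=
  biIntegral hC hh (momSq d ^ u * pairing d 2 2 ^ M * momPos d ^ B)

/-- Both arguments are the same `h`. Exchanging them and integrating by parts leaves `q` fixed and
reverses `k`. -/
theorem scalarIntegral_odd (u M B : ℕ) (hB : Odd B) : scalarIntegral hC hh u M B = 0 := by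
  have h1 := biIntegral_swap hC hh (momSq d ^ u * pairing d 2 2 ^ M * momPos d ^ B)
  rw [← biIntegral_byParts] at h1
  have e1 : byParts d (MvPolynomial.rename
      (fun v => ((![1, 0, 3, 2, 4] : Fin 5 → Fin 5) v.1, v.2)) (momSq d)) = momSq d := by
    simp only [momSq, map_sum, map_pow, map_add, MvPolynomial.rename_X, byParts_X]
    simp [add_comm]
  have e2 : byParts d (MvPolynomial.rename
      (fun v => ((![1, 0, 3, 2, 4] : Fin 5 → Fin 5) v.1, v.2)) (pairing d 2 2)) =
      pairing d 2 2 := by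
    simp only [pairing, map_sum, map_mul, MvPolynomial.rename_X, byParts_X]
    simp
  have e3 : byParts d (MvPolynomial.rename
      (fun v => ((![1, 0, 3, 2, 4] : Fin 5 → Fin 5) v.1, v.2)) (momPos d)) = -momPos d := by
    simp only [momPos, pairing, map_add, map_sum, map_mul, MvPolynomial.rename_X, byParts_X]
    simp [add_comm]
  simp only [map_mul (MvPolynomial.rename _), map_mul (byParts d), map_pow (MvPolynomial.rename _),
    map_pow (byParts d), e1, e2, e3, hB.neg_pow, mul_neg, map_neg] at h1
  exact self_eq_neg.1 h1.symm

end Functional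

section Functional

variable {C : Set (Phase d)} {h : smoothSymbols d} (hC : IsCompact C) (hh : VanishesOff C h)

/-- `b` is the order of the star exponential and `u` the exponent of `q²` in the expansion of `(q +
vk)^(2r)`. The inequalities express that all remaining exponents are nonnegative. -/
theorem biIntegral_lapOp_quadraticIncrement (N r k : ℕ) :
    biIntegral hC hh ((lapOp d ^ r) (PowerSeries.coeff k (quadraticIncrement d (N + 2)))) =
      ∑ b ∈ Finset.range (k + 1), ∑ u ∈ Finset.range (r + 1),
        if N + b ≤ k ∧ k ≤ 2 * N + b ∧ r - u ≤ 2 * N + b - k ∧ 2 * N + b - k ≤ 2 * (r - u) then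
          (N.choose (k - N - b) : ℂ) * (2 * Complex.I) ^ (2 * N + b - k) *
            (moyalCoeff b * (-1) ^ b) * (2 * N + b - k).factorial *
            ((r.choose u * (r - u).choose (2 * N + b - k - (r - u)) *
              2 ^ (2 * (r - u) - (2 * N + b - k)) : ℕ) : ℂ) *
            scalarIntegral hC hh u (k - N - b + (2 * N + b - k - (r - u)))
              (b + (2 * (r - u) - (2 * N + b - k)))
        else 0 := by
  have hmap : ∀ x, byParts d (PowerSeries.coeff k x) = PowerSeries.coeff k
      (PowerSeries.map (byParts d : BiPoly d →+* BiPoly d) x) := fun x => by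
    rw [PowerSeries.coeff_map]
    rfl
  rw [← biIntegral_byParts, byParts_lapOp_pow, hmap, map_byParts_quadraticIncrement, mul_comm,
    PowerSeries.coeff_mul, Finset.Nat.sum_antidiagonal_eq_sum_range_succ_mk, map_sum, map_sum]
  refine Finset.sum_congr rfl fun b hb => ?_
  have hbk : b ≤ k := Nat.lt_succ_iff.1 (Finset.mem_range.1 hb)
  rw [coeff_map_byParts_moyalExp]
  by_cases h1 : N + b ≤ k ∧ k ≤ 2 * N + b
  · obtain ⟨e, he⟩ : ∃ e, k - b = N + e := ⟨k - b - N, by omega⟩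
    have heN : e ≤ N := by omega
    have hj : 2 * N + b - k = N - e := by omega
    have he' : k - N - b = e := by omega
    have hmem : MvPolynomial.C (moyalCoeff b * (-1) ^ b * (N.choose e * (2 * Complex.I) ^ (N - e))) *
        (pairing d 2 2 ^ e * momPos d ^ b) ∈ constantSymbols d := by
      rw [← MvPolynomial.smul_eq_C_mul]
      exact Subalgebra.smul_mem _ (Subalgebra.mul_mem _ (Subalgebra.pow_mem _
        (pairing_mem_constantSymbols (by decide) (by decide)) _)
        (Subalgebra.pow_mem _ momPos_mem_constantSymbols _)) _
    have hprod : MvPolynomial.C (moyalCoeff b) * (-(pairing d 2 0 + pairing d 2 1)) ^ b *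
        (MvPolynomial.C (((N.choose e : ℕ) : ℂ) * (2 * Complex.I) ^ (N - e)) *
          pairing d 2 2 ^ e * pairing d 4 2 ^ (N - e)) =
        MvPolynomial.C (moyalCoeff b * (-1) ^ b * (N.choose e * (2 * Complex.I) ^ (N - e))) *
          (pairing d 2 2 ^ e * momPos d ^ b) * pairing d 4 2 ^ (N - e) := by
      rw [neg_pow, momPos]
      simp only [map_mul, map_pow, map_neg, map_one]
      ring
    rw [he, coeff_shiftIncrement_pow, if_pos heN, hprod, biIntegral_lapOp_pow hC hh hmem,
      coeff_shiftedSq_pow, Finset.mul_sum, map_sum, Finset.mul_sum]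
    refine Finset.sum_congr rfl fun u _ => ?_
    rw [hj, he']
    by_cases h2 : r - u ≤ N - e ∧ N - e ≤ 2 * (r - u)
    · rw [if_pos h2, if_pos ⟨h1.1, h1.2, h2⟩, mul_smul_comm, map_smul, smul_eq_mul,
        ← MvPolynomial.smul_eq_C_mul, smul_mul_assoc, map_smul, smul_eq_mul, scalarIntegral]
      rw [show pairing d 2 2 ^ e * momPos d ^ b * (momSq d ^ u * pairing d 2 2 ^ (N - e - (r - u)) *
        momPos d ^ (2 * (r - u) - (N - e))) = momSq d ^ u * pairing d 2 2 ^ (e + (N - e - (r - u))) *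
        momPos d ^ (b + (2 * (r - u) - (N - e))) by ring]
      ring
    · rw [if_neg h2, if_neg (fun h => h2 h.2.2)]
      simp
  · rw [Finset.sum_eq_zero fun u _ => if_neg fun h => h1 ⟨h.1, h.2.1⟩]
    rcases lt_or_ge (k - b) N with h2 | h2
    · rw [coeff_shiftIncrement_pow_of_lt h2]
      simp
    · obtain ⟨e, he⟩ : ∃ e, k - b = N + e := ⟨k - b - N, by omega⟩
      rw [he, coeff_shiftIncrement_pow, if_neg (by omega)]
      simp

/-- Here `N = c + e + β + c` is the number of increments, `c + e` the exponent of `k²` and `b + β`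
that of `qk`. After cancellation of factorials, `b` and `c` occur only in the two binomial
expansions of `weightedMoment_eq_sum` and in `N!/(N+2)!`. -/
theorem expansion_coefficient (b β c e u : ℕ) :
    1 / ((c + e + β + c + 2).factorial : ℂ) * (1 / (4 ^ (β + c + u) * (β + c + u).factorial)) *
      (((c + e + β + c).choose e : ℂ) * (2 * Complex.I) ^ (β + 2 * c) *
        (moyalCoeff b * (-1) ^ b) * (β + 2 * c).factorial *
        (((β + c + u).choose u * (β + c).choose c * 2 ^ β : ℕ) : ℂ)) =
    Complex.I ^ (b + β) / (4 ^ u * u.factorial * (c + e).factorial * (b + β).factorial) *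
      ((-1 / 2) ^ b * ((b + β).choose b) * ((-1) ^ c * ((c + e).choose c)) *
        (1 / (((c + e + β + c : ℕ) + 1) * ((c + e + β + c : ℕ) + 2)))) := by
  have e1 : ((c + e + β + c).choose e : ℂ) =
      (c + e + β + c).factorial / (e.factorial * (β + 2 * c).factorial) := by
    rw [show c + e + β + c = e + (β + 2 * c) by ring, Nat.cast_add_choose]
  have e2 : ((β + c + u).choose u : ℂ) = (β + c + u).factorial / (u.factorial * (β + c).factorial) := by
    rw [add_comm (β + c), Nat.cast_add_choose]
  have e3 : ((β + c).choose c : ℂ) = (β + c).factorial / (c.factorial * β.factorial) := by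
    rw [add_comm β, Nat.cast_add_choose]
  have e4 : ((b + β).choose b : ℂ) = (b + β).factorial / (b.factorial * β.factorial) :=
    Nat.cast_add_choose ℂ
  have e5 : ((c + e).choose c : ℂ) = (c + e).factorial / (c.factorial * e.factorial) :=
    Nat.cast_add_choose ℂ
  have e6 : (2 * Complex.I) ^ (β + 2 * c) = 2 ^ β * Complex.I ^ β * (4 ^ c * (-1) ^ c) := by
    rw [pow_add, pow_mul, mul_pow, mul_pow, Complex.I_sq,
      show (2 ^ 2 * -1 : ℂ) = 4 * -1 by norm_num, mul_pow (4 : ℂ)]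
  have e7 : moyalCoeff b * (-1) ^ b = Complex.I ^ b * (-1 / 2) ^ b / b.factorial := by
    rw [moyalCoeff, div_mul_eq_mul_div, ← mul_pow, ← mul_pow]
    ring_nf
  have e8 : ((c + e + β + c + 2).factorial : ℂ) = (((c + e + β + c : ℕ) : ℂ) + 2) *
      ((((c + e + β + c : ℕ) : ℂ) + 1) * (c + e + β + c).factorial) := by
    rw [Nat.factorial_succ, Nat.factorial_succ]
    push_cast
    ring
  have hf : ∀ n : ℕ, (n.factorial : ℂ) ≠ 0 := fun n => by exact_mod_cast n.factorial_ne_zero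
  have hn1 : (((c + e + β + c : ℕ) : ℂ) + 1) ≠ 0 := by exact_mod_cast Nat.succ_ne_zero (c + e + β + c)
  have hn2 : (((c + e + β + c : ℕ) : ℂ) + 2) ≠ 0 := by
    exact_mod_cast Nat.succ_ne_zero (c + e + β + c + 1)
  have h4 : (4 : ℂ) ^ (β + c + u) = 2 ^ β * 2 ^ β * 4 ^ c * 4 ^ u := by
    rw [pow_add, pow_add, ← mul_pow]
    norm_num
  rw [Nat.cast_mul, Nat.cast_mul, e1, e2, e3, e4, e5, e6, e7, e8, h4, pow_add Complex.I]
  push_cast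
  push_cast at hn1 hn2
  generalize (c : ℂ) + e + β + c + 1 = x at *
  generalize (c : ℂ) + e + β + c + 2 = y at *
  generalize Complex.I ^ b = i1
  generalize Complex.I ^ β = i2
  generalize (-1 / 2 : ℂ) ^ b = i3
  generalize (-1 : ℂ) ^ c = i4
  have := hf (c + e + β + c)
  have := hf (β + c + u)
  have := hf (β + c)
  have := hf (β + 2 * c)
  have := hf (b + β)
  have := hf (c + e)
  have := hf b
  have := hf β
  have := hf c
  have := hf e
  have := hf u
  field_simp

end Functional

/-! ### Summation over the star powers -/

theorem sum_range_eq_sum_ite {M : Type*} [AddCommMonoid M] (f : ℕ → M) {n n' : ℕ} (h : n ≤ n') :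
    ∑ i ∈ Finset.range n, f i = ∑ i ∈ Finset.range n', if i < n then f i else 0 := by
  rw [← Finset.sum_filter]
  refine Finset.sum_congr (Finset.ext fun i => ?_) fun _ _ => rfl
  simp only [Finset.mem_range, Finset.mem_filter]
  omega

section Functional

variable {C : Set (Phase d)} {h : smoothSymbols d} (hC : IsCompact C) (hh : VanishesOff C h)

/-- A term in the expansion of the limit of the quadratic action. -/
def expansionTerm (m k N b u : ℕ) : ℂ :=
  1 / ((N + 2).factorial : ℂ) * (1 / (4 ^ (N - m) * (N - m).factorial)) *
    ((N.choose (k - N - b) : ℂ) * (2 * Complex.I) ^ (2 * N + b - k) *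
      (moyalCoeff b * (-1) ^ b) * (2 * N + b - k).factorial *
      (((N - m).choose u * (N - m - u).choose (2 * N + b - k - (N - m - u)) *
        2 ^ (2 * (N - m - u) - (2 * N + b - k)) : ℕ) : ℂ)) *
    scalarIntegral hC hh u (k - N - b + (2 * N + b - k - (N - m - u)))
      (b + (2 * (N - m - u) - (2 * N + b - k)))

/-- For given `k` and `u` the exponents of `k²` and `qk` are determined by counting, independently
of `b` and `c`. The double sum over `b` and `c` is therefore a scalar in front of a single integral.
-/
theorem expansionTerm_eq (m k u b c : ℕ) (h1 : 2 * (m + u) + b ≤ k) (h2 : c ≤ m + u) :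
    expansionTerm hC hh m k (k - (m + u) - b + c) b u =
      Complex.I ^ (k - 2 * (m + u)) /
          (4 ^ u * u.factorial * (m + u).factorial * (k - 2 * (m + u)).factorial) *
        ((((-1 / 2) ^ b * ((k - 2 * (m + u)).choose b) * ((-1) ^ c * ((m + u).choose c)) *
          (1 / (((m + u + (k - 2 * (m + u) - b) + c : ℕ) + 1) *
            ((m + u + (k - 2 * (m + u) - b) + c : ℕ) + 2))) : ℝ)) : ℂ) *
        scalarIntegral hC hh u (m + u) (k - 2 * (m + u)) := by
  obtain ⟨e, he⟩ := Nat.exists_eq_add_of_le h2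
  obtain ⟨β, hβ⟩ := Nat.exists_eq_add_of_le h1
  have hk : k - 2 * (m + u) = b + β := by omega
  have hN : k - (m + u) - b + c = c + e + β + c := by omega
  have hNm : c + e + β + c - m = β + c + u := by omega
  rw [hN, expansionTerm, hNm, hk, he]
  have i1 : k - (c + e + β + c) - b = e := by omega
  have i2 : 2 * (c + e + β + c) + b - k = β + 2 * c := by omega
  have i3 : β + c + u - u = β + c := by omega
  have i4 : β + 2 * c - (β + c) = c := by omega
  have i5 : 2 * (β + c) - (β + 2 * c) = β := by omega
  have i6 : b + β - b = β := by omega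
  rw [i1, i2, i3, i4, i5, i6, expansion_coefficient, add_comm e c]
  push_cast
  ring

theorem evenLimit_eq (m k N : ℕ) :
    1 / ((N + 2).factorial : ℂ) * evenLimit (m + 2) (N + 2) (quadraticSymbol h k (N + 2)) =
      (Real.pi : ℂ) ^ (m + 2) * if m ≤ N then ∑ b ∈ Finset.range (k + 1),
        ∑ u ∈ Finset.range (N - m + 1),
          if N + b ≤ k ∧ k ≤ 2 * N + b ∧ N - m - u ≤ 2 * N + b - k ∧
            2 * N + b - k ≤ 2 * (N - m - u) then expansionTerm hC hh m k N b u else 0 else 0 := by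
  by_cases hm : m ≤ N
  · rw [evenLimit, if_pos (by omega), if_pos hm, quadraticSymbol, laplaceMoment_bi hC hh,
      Nat.add_sub_add_right, biIntegral_lapOp_quadraticIncrement]
    simp only [Finset.mul_sum]
    refine Finset.sum_congr rfl fun b _ => Finset.sum_congr rfl fun u _ => ?_
    split_ifs
    · rw [expansionTerm]
      push_cast
      ring
    · ring
  · rw [evenLimit, if_neg (by omega), if_neg hm, mul_zero, mul_zero]

/-- For fixed `u` and `b` the inequalities confine `N` to `m + u + 1` consecutive values starting at
`k - (m + u) - b`, and they require `2(m + u) + b ≤ k`. The new index `c` is the offset of `N`. -/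
theorem sum_expansionTerm (m k : ℕ) :
    (∑ N ∈ Finset.range (2 * k + 1), if m ≤ N then ∑ b ∈ Finset.range (k + 1),
        ∑ u ∈ Finset.range (N - m + 1),
          if N + b ≤ k ∧ k ≤ 2 * N + b ∧ N - m - u ≤ 2 * N + b - k ∧
            2 * N + b - k ≤ 2 * (N - m - u) then expansionTerm hC hh m k N b u else 0 else 0) =
      ∑ u ∈ Finset.range (k + 1), if 2 * (m + u) ≤ k then
        ∑ b ∈ Finset.range (k - 2 * (m + u) + 1), ∑ c ∈ Finset.range (m + u + 1),
          expansionTerm hC hh m k (k - (m + u) - b + c) b u else 0 := by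
  have hL : ∀ N ∈ Finset.range (2 * k + 1), (if m ≤ N then ∑ b ∈ Finset.range (k + 1),
      ∑ u ∈ Finset.range (N - m + 1),
        if N + b ≤ k ∧ k ≤ 2 * N + b ∧ N - m - u ≤ 2 * N + b - k ∧
          2 * N + b - k ≤ 2 * (N - m - u) then expansionTerm hC hh m k N b u else 0 else 0) =
      ∑ u ∈ Finset.range (k + 1), ∑ b ∈ Finset.range (k + 1),
        if m + u ≤ N ∧ N + b ≤ k ∧ k ≤ 2 * N + b ∧ N - m - u ≤ 2 * N + b - k ∧
          2 * N + b - k ≤ 2 * (N - m - u) then expansionTerm hC hh m k N b u else 0 := by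
    intro N _
    conv_rhs => rw [Finset.sum_comm]
    by_cases hm : m ≤ N
    · rw [if_pos hm]
      refine Finset.sum_congr rfl fun b _ => ?_
      rw [← Finset.sum_filter, ← Finset.sum_filter]
      refine Finset.sum_congr (Finset.ext fun u => ?_) fun _ _ => rfl
      simp only [Finset.mem_filter, Finset.mem_range]
      omega
    · rw [if_neg hm]
      exact (Finset.sum_eq_zero fun b _ => Finset.sum_eq_zero fun u _ => if_neg (by omega)).symm
  rw [Finset.sum_congr rfl hL, Finset.sum_comm]
  refine Finset.sum_congr rfl fun u _ => ?_
  rw [Finset.sum_comm]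
  by_cases hu : 2 * (m + u) ≤ k
  · rw [if_pos hu, sum_range_eq_sum_ite _ (show k - 2 * (m + u) + 1 ≤ k + 1 by omega)]
    refine Finset.sum_congr rfl fun b _ => ?_
    by_cases hb : b < k - 2 * (m + u) + 1
    · rw [if_pos hb, ← Finset.sum_filter]
      refine Finset.sum_nbij' (fun N => N - (k - (m + u) - b)) (fun c => k - (m + u) - b + c)
        ?_ ?_ ?_ ?_ ?_
      · intro N hN
        simp only [Finset.mem_filter, Finset.mem_range] at hN ⊢
        omega
      · intro c hc
        simp only [Finset.mem_filter, Finset.mem_range] at hc ⊢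
        omega
      · intro N hN
        simp only [Finset.mem_filter, Finset.mem_range] at hN
        omega
      · intro c hc
        omega
      · intro N hN
        simp only [Finset.mem_filter, Finset.mem_range] at hN
        congr 1
        omega
    · rw [if_neg hb]
      exact Finset.sum_eq_zero fun N _ => if_neg (by omega)
  · rw [if_neg hu]
    exact Finset.sum_eq_zero fun b _ => Finset.sum_eq_zero fun N _ => if_neg (by omega)

theorem sum_evenLimit (m k : ℕ) :
    ∑ n ∈ Finset.range (2 * k + 3),
      1 / (n.factorial : ℂ) * evenLimit (m + 2) n (quadraticSymbol h k n) =
    (Real.pi : ℂ) ^ (m + 2) * ∑ u ∈ Finset.range (k + 1), if 2 * (m + u) ≤ k then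
      Complex.I ^ (k - 2 * (m + u)) /
          (4 ^ u * u.factorial * (m + u).factorial * (k - 2 * (m + u)).factorial) *
        (weightedMoment (m + u) (k - 2 * (m + u)) : ℂ) *
        scalarIntegral hC hh u (m + u) (k - 2 * (m + u)) else 0 := by
  -- A limit at `D = 0` needs at least `d/2 = m + 2` derivatives of the step function, so the orders
  -- 0 and 1 may be split off.
  have h01 : ∀ n < 2, 1 / (n.factorial : ℂ) * evenLimit (m + 2) n (quadraticSymbol h k n) = 0 :=
    fun n hn => by rw [evenLimit, if_neg (by omega), mul_zero]
  rw [Finset.sum_range_succ', Finset.sum_range_succ', h01 0 (by omega), h01 (0 + 1) (by omega),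
    add_zero, add_zero]
  simp only [add_assoc, Nat.reduceAdd]
  rw [Finset.sum_congr rfl fun N _ => evenLimit_eq hC hh m k N, ← Finset.mul_sum,
    sum_expansionTerm]
  congr 1
  refine Finset.sum_congr rfl fun u _ => ?_
  split_ifs with hu
  · rw [weightedMoment_eq_sum, Complex.ofReal_sum, Finset.mul_sum, Finset.sum_mul]
    refine Finset.sum_congr rfl fun b hb => ?_
    rw [Complex.ofReal_sum, Finset.mul_sum, Finset.sum_mul]
    refine Finset.sum_congr rfl fun c hc => ?_
    rw [Finset.mem_range] at hb hc
    exact expansionTerm_eq hC hh m k u b c (by omega) (by omega)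
  · rfl

theorem sum_evenLimit_odd (hC : IsCompact C) (hh : VanishesOff C h) (m k : ℕ) (hk : Odd k) :
    ∑ n ∈ Finset.range (2 * k + 3),
      1 / (n.factorial : ℂ) * evenLimit (m + 2) n (quadraticSymbol h k n) = 0 := by
  rw [sum_evenLimit hC hh, Finset.sum_eq_zero, mul_zero]
  intro u _
  split_ifs with hu
  · rw [scalarIntegral_odd hC hh _ _ _ (Nat.Odd.sub_even hu hk (even_two_mul _)), mul_zero]
  · rfl

theorem sum_evenLimit_of_lt (hC : IsCompact C) (hh : VanishesOff C h) (m k : ℕ) (hk : k < 2 * m) :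
    ∑ n ∈ Finset.range (2 * k + 3),
      1 / (n.factorial : ℂ) * evenLimit (m + 2) n (quadraticSymbol h k n) = 0 := by
  rw [sum_evenLimit hC hh, Finset.sum_eq_zero, mul_zero]
  intro u _
  rw [if_neg (by omega)]

variable (d) in
/-- `(q²)(k²) - (qk)²`, where `q` stands for the total momentum derivative. -/
def transverseSq : BiPoly d := pairing d 2 2 * momSq d - momPos d ^ 2

/-- With `u + j = N` the exponent of `qk` is `2j` and `i^(2j) = (-1)^j`. The quotient
`Γ(j+1/2)/(2j)!` reduces to `√π/(4^j j!)`, so the weights become those of the binomial expansion of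
`(k²q² - (qk)²)^N`. -/
theorem sum_evenLimit_even (m N : ℕ) :
    ∑ n ∈ Finset.range (2 * (2 * (m + N)) + 3),
      1 / (n.factorial : ℂ) * evenLimit (m + 2) n (quadraticSymbol h (2 * (m + N)) n) =
    (Real.pi : ℂ) ^ (m + 2) *
      ((Real.sqrt Real.pi / (4 ^ (m + 1) * 16 ^ N * Real.Gamma (((m + N : ℕ) : ℝ) + 3 / 2) *
        N.factorial) : ℝ) : ℂ) *
      biIntegral hC hh (pairing d 2 2 ^ m * transverseSq d ^ N) := by
  rw [sum_evenLimit hC hh, mul_assoc]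
  congr 1
  rw [← Finset.sum_subset (Finset.range_subset_range.2 (show N + 1 ≤ 2 * (m + N) + 1 by omega))
    fun u _ hu => if_neg (by rw [Finset.mem_range] at hu; omega), transverseSq, sub_eq_add_neg,
    add_pow, Finset.mul_sum, map_sum, Finset.mul_sum]
  refine Finset.sum_congr rfl fun u hu => ?_
  obtain ⟨j, rfl⟩ := Nat.exists_eq_add_of_le (Nat.lt_succ_iff.1 (Finset.mem_range.1 hu))
  have hB : 2 * (m + (u + j)) - 2 * (m + u) = 2 * j := by omega
  rw [if_pos (by omega), hB, Nat.add_sub_cancel_left, weightedMoment_even, pow_mul, Complex.I_sq]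
  have hmono : pairing d 2 2 ^ m * ((pairing d 2 2 * momSq d) ^ u * (-momPos d ^ 2) ^ j *
      (((u + j).choose u : ℕ) : BiPoly d)) = (((u + j).choose u : ℂ) * (-1) ^ j) •
        (momSq d ^ u * pairing d 2 2 ^ (m + u) * momPos d ^ (2 * j)) := by
    rw [MvPolynomial.smul_eq_C_mul, neg_pow (momPos d ^ 2)]
    simp only [map_mul, map_pow, map_neg, map_one, map_natCast]
    ring
  rw [hmono, map_smul, smul_eq_mul, ← scalarIntegral, ← mul_assoc]
  congr 1
  have h1 := gamma_add_half_div_factorial j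
  have h2 : Real.Gamma (j + 1 / 2) = Real.sqrt Real.pi / (4 ^ j * j.factorial) *
      (2 * j).factorial := by
    rw [← h1, div_mul_cancel₀]
    exact_mod_cast (2 * j).factorial_ne_zero
  have h3 : ((u + j).choose u : ℂ) = (u + j).factorial / (u.factorial * j.factorial) :=
    Nat.cast_add_choose ℂ
  have hf : ∀ n : ℕ, (n.factorial : ℂ) ≠ 0 := fun n => by exact_mod_cast n.factorial_ne_zero
  have hG : ((Real.Gamma (((m + (u + j) : ℕ) : ℝ) + 3 / 2) : ℝ) : ℂ) ≠ 0 :=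
    Complex.ofReal_ne_zero.2 (Real.Gamma_pos_of_pos (by positivity)).ne'
  rw [h2, h3, show m + u + j = m + (u + j) by ring]
  have h16 : (16 : ℂ) ^ (u + j) = 4 ^ u * 4 ^ j * 4 ^ (u + j) := by
    rw [← pow_add, ← mul_pow]
    norm_num
  push_cast
  push_cast at hG
  rw [h16]
  have := hf (m + u)
  have := hf (2 * j)
  have := hf (u + j)
  have := hf u
  have := hf j
  field_simp
  ring

end Functional

/-! ### The addition theorem -/

/-- `1 / (n - k)!`, understood to vanish for `k > n`. -/
def invFactorialSub (n k : ℕ) : ℝ := if k ≤ n then ((n - k).factorial : ℝ)⁻¹ else 0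

theorem invFactorialSub_succ_succ (n k : ℕ) :
    invFactorialSub (n + 1) (k + 1) = invFactorialSub n k := by
  simp [invFactorialSub]

theorem invFactorialSub_succ_right (n k : ℕ) :
    invFactorialSub n (k + 1) = ((n : ℝ) - k) * invFactorialSub n k := by
  unfold invFactorialSub
  rcases lt_trichotomy k n with h | h | h
  · rw [if_pos (by omega), if_pos (by omega)]
    obtain ⟨a, rfl⟩ := Nat.exists_eq_add_of_lt h
    rw [show k + a + 1 - (k + 1) = a by omega, show k + a + 1 - k = a + 1 by omega,
      Nat.factorial_succ]
    push_cast
    have : (a : ℝ) + 1 ≠ 0 := by positivity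
    field_simp
    ring
  · subst h
    simp
  · rw [if_neg (by omega), if_neg (by omega), mul_zero]

theorem invFactorialSub_zero (n : ℕ) : invFactorialSub n 0 = (n.factorial : ℝ)⁻¹ := by
  simp [invFactorialSub]

/-- The terms of the sum over spins in the addition theorem for Bessel functions. -/
def additionTerm (l : ℝ) (b c k : ℕ) : ℝ :=
  (-1) ^ k * (l + 2 * k) * Real.Gamma (l + k) / (k.factorial * Real.Gamma (l + b + k + 1) *
    Real.Gamma (l + c + k + 1)) * invFactorialSub b k * invFactorialSub c k

/-- Termwise form of the recursion for the induction on `b`: the shift `k ↦ k + 1` is absorbed by `l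
↦ l + 2`. -/
theorem additionTerm_succ {l : ℝ} (hl : 0 < l) (b c j : ℕ) :
    (b + 1) * (l + b + 1) * additionTerm l (b + 1) (c + 1) (j + 1) + additionTerm (l + 2) b c j =
      additionTerm l b (c + 1) (j + 1) := by
  have hG : ∀ x : ℝ, 0 < x → Real.Gamma (x + 1) = x * Real.Gamma x := fun x hx =>
    Real.Gamma_add_one hx.ne'
  simp only [additionTerm, invFactorialSub_succ_succ, invFactorialSub_succ_right, Nat.factorial_succ]
  push_cast
  rw [show l + (b + 1) + (j + 1) + 1 = l + b + j + 2 + 1 by ring,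
    show l + 2 + b + j + 1 = l + b + j + 2 + 1 by ring,
    show l + b + (j + 1) + 1 = l + b + j + 2 by ring,
    show l + (c + 1) + (j + 1) + 1 = l + c + j + 3 by ring,
    show l + 2 + c + j + 1 = l + c + j + 3 by ring,
    show l + 2 + j = l + (j + 1) + 1 by ring, hG (l + b + j + 2) (by positivity),
    hG (l + (j + 1)) (by positivity)]
  have h1 : Real.Gamma (l + b + j + 2) ≠ 0 := (Real.Gamma_pos_of_pos (by positivity)).ne'
  have h2 : Real.Gamma (l + c + j + 3) ≠ 0 := (Real.Gamma_pos_of_pos (by positivity)).ne'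
  have h3 : l + b + j + 2 ≠ 0 := by positivity
  have h4 : (j.factorial : ℝ) ≠ 0 := by positivity
  have h5 : (j : ℝ) + 1 ≠ 0 := by positivity
  rw [pow_succ]
  field_simp
  ring

theorem additionTerm_zero {l : ℝ} (hl : 0 < l) (b c : ℕ) :
    (b + 1) * (l + b + 1) * additionTerm l (b + 1) c 0 = additionTerm l b c 0 := by
  have hG := Real.Gamma_add_one (show l + b + 1 ≠ 0 by positivity)
  simp only [additionTerm, invFactorialSub_zero, Nat.factorial_succ]
  push_cast
  rw [show l + (b + 1) + 0 + 1 = l + b + 1 + 1 by ring, hG,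
    show l + b + 0 + 1 = l + b + 1 by ring]
  have h1 : Real.Gamma (l + b + 1) ≠ 0 := (Real.Gamma_pos_of_pos (by positivity)).ne'
  have h2 : Real.Gamma (l + c + 0 + 1) ≠ 0 := (Real.Gamma_pos_of_pos (by positivity)).ne'
  have h3 : l + b + 1 ≠ 0 := by positivity
  have h5 : (b : ℝ) + 1 ≠ 0 := by positivity
  field_simp

theorem additionTerm_eq_zero {l : ℝ} {b c k : ℕ} (h : b < k ∨ c < k) :
    additionTerm l b c k = 0 := by
  rw [additionTerm, invFactorialSub, invFactorialSub]
  rcases h with h | h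
  · rw [if_neg (by omega)]; ring
  · rw [if_neg (show ¬k ≤ c by omega)]; ring

/-- Coefficient form of the addition theorem. The induction on `b` keeps `l` and `c` free, because
the recursion expresses `(l, b+1, c+1)` through `(l, b, c+1)` and `(l+2, b, c)`, which both have
smaller first index. -/
theorem sum_additionTerm {l : ℝ} (hl : 0 < l) (b c : ℕ) :
    ∑ k ∈ Finset.range (b + 1), additionTerm l b c k =
      1 / (b.factorial * c.factorial * Real.Gamma (l + b + c + 1)) := by
  have hG : ∀ x : ℝ, 0 < x → Real.Gamma (x + 1) = x * Real.Gamma x := fun x hx =>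
    Real.Gamma_add_one hx.ne'
  induction b generalizing l c with
  | zero =>
    rw [zero_add, Finset.sum_range_one, additionTerm, invFactorialSub_zero, invFactorialSub_zero]
    push_cast
    rw [show l + 0 + 0 + 1 = l + 1 by ring, hG l hl, show l + c + 0 + 1 = l + 0 + c + 1 by ring,
      add_zero l]
    have h1 : Real.Gamma l ≠ 0 := (Real.Gamma_pos_of_pos hl).ne'
    have h2 : Real.Gamma (l + c + 1) ≠ 0 := (Real.Gamma_pos_of_pos (by positivity)).ne'
    have h3 : (c.factorial : ℝ) ≠ 0 := by positivity
    field_simp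
    simp
  | succ b ih =>
    have hlb : ((b : ℝ) + 1) * (l + b + 1) ≠ 0 := by positivity
    refine mul_left_cancel₀ hlb ?_
    have hlast : ∑ k ∈ Finset.range (b + 1 + 1), additionTerm l b c k =
        1 / (b.factorial * c.factorial * Real.Gamma (l + b + c + 1)) := by
      rw [Finset.sum_range_succ, ih hl, additionTerm_eq_zero (Or.inl (Nat.lt_succ_self b)), add_zero]
    have hbc : Real.Gamma (l + b + c + 1) ≠ 0 := (Real.Gamma_pos_of_pos (by positivity)).ne'
    have hbf : (b.factorial : ℝ) ≠ 0 := by positivity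
    have hcf : (c.factorial : ℝ) ≠ 0 := by positivity
    cases c with
    | zero =>
      have hz : ∀ b, ∑ k ∈ Finset.range (b + 1 + 1), additionTerm l b 0 k =
          additionTerm l b 0 0 := fun b => by
        rw [Finset.sum_range_succ', Finset.sum_eq_zero fun k _ =>
          additionTerm_eq_zero (Or.inr (Nat.succ_pos k)), zero_add]
      have hz' : ∑ k ∈ Finset.range (b + 1 + 1), additionTerm l (b + 1) 0 k =
          additionTerm l (b + 1) 0 0 := by
        rw [Finset.sum_range_succ', Finset.sum_eq_zero fun k _ =>
          additionTerm_eq_zero (Or.inr (Nat.succ_pos k)), zero_add]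
      rw [hz', additionTerm_zero hl, ← hz, hlast, Nat.factorial_succ]
      push_cast
      rw [show l + (b + 1) + 0 + 1 = l + b + 0 + 1 + 1 by ring, hG (l + b + 0 + 1) (by positivity)]
      have : l + b + 0 + 1 ≠ 0 := by positivity
      push_cast at hbc
      field_simp
      ring
    | succ c =>
      have hsum : (b + 1) * (l + b + 1) * ∑ k ∈ Finset.range (b + 1 + 1),
          additionTerm l (b + 1) (c + 1) k + ∑ k ∈ Finset.range (b + 1), additionTerm (l + 2) b c k =
          ∑ k ∈ Finset.range (b + 1 + 1), additionTerm l b (c + 1) k := by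
        rw [Finset.sum_range_succ', Finset.sum_range_succ' (additionTerm l b (c + 1)), mul_add,
          additionTerm_zero hl, Finset.mul_sum, add_right_comm, ← Finset.sum_add_distrib]
        congr 1
        exact Finset.sum_congr rfl fun j _ => additionTerm_succ hl b c j
      rw [eq_sub_of_add_eq hsum, hlast, ih (by positivity), Nat.factorial_succ, Nat.factorial_succ]
      push_cast
      rw [show l + 2 + b + c + 1 = l + b + (c + 1) + 1 + 1 by ring,
        show l + (b + 1) + (c + 1) + 1 = l + b + (c + 1) + 1 + 1 by ring,
        hG (l + b + (c + 1) + 1) (by positivity)]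
      have : l + b + (c + 1) + 1 ≠ 0 := by positivity
      have : (c : ℝ) + 1 ≠ 0 := by positivity
      have : (b : ℝ) + 1 ≠ 0 := by positivity
      have : (c.factorial : ℝ) ≠ 0 := by positivity
      push_cast at hbc
      field_simp
      ring

/-- Converts the product in the Gegenbauer denominators into a quotient of Gamma functions; `k < x`
keeps all arguments away from the poles. -/
theorem gamma_eq_prod_mul (x : ℝ) (k : ℕ) (hx : (k : ℝ) < x) :
    Real.Gamma x = (∏ i ∈ Finset.range k, (x - (i + 1))) * Real.Gamma (x - k) := by
  induction k with
  | zero => simp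
  | succ k ih =>
    push_cast at hx
    rw [ih (by linarith), Finset.prod_range_succ, mul_assoc]
    congr 1
    have h := Real.Gamma_add_one (s := x - (k + 1)) (by linarith)
    rw [show x - (k + 1) + 1 = x - k by ring] at h
    push_cast
    exact h

/-- The normalization of the spin-`s` term in the addition theorem. -/
def spinWeight (ν : ℝ) (s : ℕ) : ℝ := 2 ^ ν * 2 ^ ν * Real.Gamma (s + ν + 1) / 4 ^ s

theorem spinWeight_ne_zero {ν : ℝ} (hν : 0 < ν) (s : ℕ) : spinWeight ν s ≠ 0 :=
  div_ne_zero (mul_ne_zero (by positivity) (Real.Gamma_pos_of_pos (by positivity)).ne')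
    (by positivity)

/-- Spin `a + 2k` with dressing orders `b` and `c` contributes to `τ^a ρ^(2(b+k)) ρ'^(2(c+k))`. Up
to a factor independent of `k` once the exponents are fixed, its coefficient is a term of the finite
identity. -/
theorem spin_coefficient {ν : ℝ} (hν : 0 < ν) (a b c k : ℕ) :
    spinWeight ν (a + 2 * k) * (-1 / 4) ^ (b + c) *
      (besselCoeff ((a + 2 * k : ℕ) + ν) b * besselCoeff ((a + 2 * k : ℕ) + ν) c) *
      ((-1) ^ k * 2 ^ a / ((k.factorial : ℝ) * (a.factorial : ℝ) *
        ∏ i ∈ Finset.range k, (ν + (a + 2 * k : ℕ) - (i + 1)))) =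
    2 ^ a / (a.factorial * 16 ^ (a + (b + k) + (c + k))) *
      additionTerm (ν + a) (b + k) (c + k) k := by
  have ha : (0 : ℝ) ≤ a := by positivity
  have hk0 : (0 : ℝ) ≤ k := by positivity
  have hk : (k : ℝ) < ν + (a + 2 * k : ℕ) := by
    push_cast
    linarith
  have hpos : 0 < ν + (a + 2 * k : ℕ) := by positivity
  have hG := gamma_eq_prod_mul _ k hk
  have hG1 := Real.Gamma_add_one hpos.ne'
  set Q := ∏ i ∈ Finset.range k, (ν + (a + 2 * k : ℕ) - (i + 1 : ℝ)) with hQ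
  have hG0 : 0 < Real.Gamma (ν + (a + 2 * k : ℕ)) := Real.Gamma_pos_of_pos hpos
  have hQ0 : Q ≠ 0 := by
    intro h0
    rw [hG, h0, zero_mul] at hG0
    exact lt_irrefl _ hG0
  have hs : ((a + 2 * k : ℕ) : ℝ) + ν + 1 = ν + (a + 2 * k : ℕ) + 1 := by ring
  have hk' : ν + ((a + 2 * k : ℕ) : ℝ) - k = ν + a + k := by push_cast; ring
  have h2 : (2 : ℝ) ^ (((a + 2 * k : ℕ) : ℝ) + ν) = 2 ^ ν * (2 ^ a * 4 ^ k) := by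
    rw [add_comm, Real.rpow_add (by norm_num), Real.rpow_natCast, pow_add, pow_mul]
    norm_num
  have hν2 : (2 : ℝ) ^ ν ≠ 0 := by positivity
  have e1 : ((a + 2 * k : ℕ) : ℝ) + ν + b + 1 = ν + a + (b + k : ℕ) + k + 1 := by push_cast; ring
  have e2 : ((a + 2 * k : ℕ) : ℝ) + ν + c + 1 = ν + a + (c + k : ℕ) + k + 1 := by push_cast; ring
  have g1 : Real.Gamma (ν + a + (b + k : ℕ) + k + 1) ≠ 0 :=
    (Real.Gamma_pos_of_pos (by positivity)).ne'
  have g2 : Real.Gamma (ν + a + (c + k : ℕ) + k + 1) ≠ 0 :=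
    (Real.Gamma_pos_of_pos (by positivity)).ne'
  have i1 : invFactorialSub (b + k) k = (b.factorial : ℝ)⁻¹ := by simp [invFactorialSub]
  have i2 : invFactorialSub (c + k) k = (c.factorial : ℝ)⁻¹ := by simp [invFactorialSub]
  have h4 : (-1 / 4 : ℝ) ^ (b + c) = (-1) ^ b * (-1) ^ c / (4 ^ b * 4 ^ c) := by
    rw [div_pow, pow_add, pow_add]
  have h42 : (4 : ℝ) ^ (a + 2 * k) = 2 ^ a * 2 ^ a * (4 ^ k * 4 ^ k) := by
    rw [pow_add, two_mul, pow_add, show (4 : ℝ) = 2 * 2 by norm_num, mul_pow 2 2 a]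
  have h16 : (16 : ℝ) ^ (a + (b + k) + (c + k)) = (2 ^ a * 2 ^ a * (2 ^ a * 2 ^ a)) *
      (4 ^ b * 4 ^ b) * (4 ^ c * 4 ^ c) * (4 ^ k * 4 ^ k * (4 ^ k * 4 ^ k)) := by
    have h : (16 : ℝ) = 2 * 2 * (2 * 2) := by norm_num
    have h' : (4 : ℝ) = 2 * 2 := by norm_num
    rw [h, h']
    simp only [pow_add, mul_pow]
    ring
  have hsign : ∀ n : ℕ, ((-1 : ℝ) ^ n) * (-1) ^ n = 1 := fun n => by
    rw [← mul_pow]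
    norm_num
  rw [spinWeight, besselCoeff, besselCoeff, additionTerm, hs, hG1, hG, hk', h2, e1, e2, i1, i2, h4,
    h42, h16]
  have s1 := hsign b
  have s2 := hsign c
  have f1 : (a.factorial : ℝ) ≠ 0 := by positivity
  have f2 : (b.factorial : ℝ) ≠ 0 := by positivity
  have f3 : (c.factorial : ℝ) ≠ 0 := by positivity
  have f4 : (k.factorial : ℝ) ≠ 0 := by positivity
  generalize Real.Gamma (ν + a + (b + k : ℕ) + k + 1) = G1 at *
  generalize Real.Gamma (ν + a + (c + k : ℕ) + k + 1) = G2 at *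
  generalize Real.Gamma (ν + a + k) = G3 at *
  generalize (2 : ℝ) ^ ν = w at *
  generalize hx : (-1 : ℝ) ^ b = x at *
  generalize hy : (-1 : ℝ) ^ c = y at *
  push_cast
  field_simp
  rw [show x ^ 2 = 1 by rw [sq, s1], show y ^ 2 = 1 by rw [sq, s2]]
  ring

theorem coeff_deformedGen (s m : ℕ) : PowerSeries.coeff m (deformedGen d s) =
    ∑ b ∈ Finset.range (m + 1), MvPolynomial.C
      (besselCoeff (s + ((d : ℝ) - 3) / 2) b * besselCoeff (s + ((d : ℝ) - 3) / 2) (m - b)) *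
        (rhoSq d 0 ^ b * rhoSq d 1 ^ (m - b)) * undressedGen d s := by
  rw [deformedGen, PowerSeries.coeff_mul_C, PowerSeries.coeff_mul,
    Finset.Nat.sum_antidiagonal_eq_sum_range_succ_mk, Finset.sum_mul]
  refine Finset.sum_congr rfl fun b _ => ?_
  simp only [dressing, PowerSeries.coeff_mk, map_mul]
  ring

/-- Degree `N` of Gegenbauer's addition theorem for the Bessel function of `√(ρ² + ρ'² + 2τ)`: spin
`s` has degree `s` undressed, so it enters through order `N - s` of the dressing, where `κ = -1/4`
with `ħ` stripped off. -/
theorem sum_spins (hν : 0 < ((d : ℝ) - 3) / 2) (N : ℕ) :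
    ∑ s ∈ Finset.range (N + 1), MvPolynomial.C (spinWeight (((d : ℝ) - 3) / 2) s *
      (-1 / 4) ^ (N - s)) * PowerSeries.coeff (N - s) (deformedGen d s) =
    MvPolynomial.C (1 / (16 ^ N * N.factorial * Real.Gamma (((d : ℝ) - 3) / 2 + N + 1))) *
      (rhoSq d 0 + rhoSq d 1 + 2 * tau d) ^ N := by
  set ν := ((d : ℝ) - 3) / 2 with hνdef
  have hL : ∑ s ∈ Finset.range (N + 1), MvPolynomial.C (spinWeight ν s *
      (-1 / 4) ^ (N - s)) * PowerSeries.coeff (N - s) (deformedGen d s) =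
      ∑ s ∈ Finset.range (N + 1), ∑ b ∈ Finset.range (N - s + 1), ∑ k ∈ Finset.range (s / 2 + 1),
        MvPolynomial.C (spinWeight ν s * (-1 / 4) ^ (N - s) *
          (besselCoeff (s + ν) b * besselCoeff (s + ν) (N - s - b)) *
          ((-1) ^ k * 2 ^ (s - 2 * k) / ((k.factorial : ℝ) * ((s - 2 * k).factorial : ℝ) *
            ∏ i ∈ Finset.range k, (ν + s - (i + 1))))) *
        (tau d ^ (s - 2 * k) * rhoSq d 0 ^ (b + k) * rhoSq d 1 ^ (N - s - b + k)) := by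
    refine Finset.sum_congr rfl fun s _ => ?_
    rw [coeff_deformedGen, Finset.mul_sum]
    refine Finset.sum_congr rfl fun b _ => ?_
    rw [undressedGen, Finset.mul_sum, Finset.mul_sum]
    refine Finset.sum_congr rfl fun k _ => ?_
    simp only [← hνdef, map_mul, mul_pow]
    ring
  have hR : MvPolynomial.C (1 / (16 ^ N * N.factorial * Real.Gamma (ν + N + 1))) *
      (rhoSq d 0 + rhoSq d 1 + 2 * tau d) ^ N =
      ∑ a ∈ Finset.range (N + 1), ∑ b ∈ Finset.range (N - a + 1),
        ∑ k ∈ Finset.range (min b (N - a - b) + 1),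
          MvPolynomial.C (2 ^ a / (a.factorial * 16 ^ N) * additionTerm (ν + a) b (N - a - b) k) *
            (tau d ^ a * rhoSq d 0 ^ b * rhoSq d 1 ^ (N - a - b)) := by
    rw [add_comm (rhoSq d 0 + rhoSq d 1), add_pow, Finset.mul_sum]
    refine Finset.sum_congr rfl fun a ha => ?_
    rw [add_pow, Finset.mul_sum, Finset.sum_mul, Finset.mul_sum]
    refine Finset.sum_congr rfl fun b hb => ?_
    rw [Finset.mem_range] at ha hb
    obtain ⟨c, rfl⟩ : ∃ c, N = a + b + c := ⟨N - a - b, by omega⟩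
    -- An exponent `k` in `(ρ²ρ'²)^k` can exceed neither `b` nor `c`; the terms between `min b c`
    -- and `b` vanish.
    have hmin : ∑ k ∈ Finset.range (min b c + 1), additionTerm (ν + a) b c k =
        1 / (b.factorial * c.factorial * Real.Gamma (ν + a + b + c + 1)) := by
      rw [← sum_additionTerm (by positivity)]
      refine Finset.sum_subset (fun k hk => ?_) fun k _ hk => additionTerm_eq_zero ?_
      · rw [Finset.mem_range] at hk ⊢
        omega
      · rw [Finset.mem_range] at hk
        omega
    rw [show a + b + c - a - b = c by omega, show a + b + c - a = b + c by omega,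
      ← Finset.sum_mul, ← map_sum, ← Finset.mul_sum, hmin, ← map_natCast (MvPolynomial.C (R := ℝ)),
      ← map_natCast (MvPolynomial.C (R := ℝ)), mul_pow, Nat.cast_add_choose, add_assoc a b c,
      Nat.cast_add_choose, show (2 : GenPoly d) = MvPolynomial.C 2 from
        (map_ofNat MvPolynomial.C 2).symm, ← map_pow]
    have hc : (1 / (16 ^ (a + (b + c)) * (a + (b + c)).factorial *
        Real.Gamma (ν + (a + (b + c) : ℕ) + 1)) * (2 ^ a * ((b + c).factorial /
          (b.factorial * c.factorial)) * ((a + (b + c)).factorial /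
          (a.factorial * (b + c).factorial))) : ℝ) =
        2 ^ a / (a.factorial * 16 ^ (a + (b + c))) *
        (1 / (b.factorial * c.factorial * Real.Gamma (ν + a + b + c + 1))) := by
      push_cast
      rw [show ν + (a + (b + c)) + 1 = ν + a + b + c + 1 by ring]
      have : Real.Gamma (ν + a + b + c + 1) ≠ 0 := (Real.Gamma_pos_of_pos (by positivity)).ne'
      field_simp
    rw [← hc]
    simp only [map_mul]
    ring
  rw [hL, hR]
  simp only [Finset.sum_sigma']
  -- The sum over spin, dressing order and Gegenbauer index is regrouped by monomials: `s - 2k` is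
  -- the exponent of `τ`, and `b + k` that of `ρ²`.
  refine Finset.sum_nbij' (fun y => ⟨y.1 - 2 * y.2.2, y.2.1 + y.2.2, y.2.2⟩)
    (fun y => ⟨y.1 + 2 * y.2.2, y.2.1 - y.2.2, y.2.2⟩) ?_ ?_ ?_ ?_ ?_
  · rintro ⟨s, b, k⟩ hy
    simp only [Finset.mem_sigma, Finset.mem_range] at hy ⊢
    omega
  · rintro ⟨s, b, k⟩ hy
    simp only [Finset.mem_sigma, Finset.mem_range] at hy ⊢
    omega
  · rintro ⟨s, b, k⟩ hy
    simp only [Finset.mem_sigma, Finset.mem_range] at hy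
    simp only [Sigma.mk.injEq, heq_eq_eq, and_true]
    omega
  · rintro ⟨s, b, k⟩ hy
    simp only [Finset.mem_sigma, Finset.mem_range] at hy
    simp only [Sigma.mk.injEq, heq_eq_eq, and_true]
    omega
  · rintro ⟨s, b, k⟩ hy
    simp only [Finset.mem_sigma, Finset.mem_range] at hy ⊢
    obtain ⟨a, rfl⟩ : ∃ a, s = a + 2 * k := ⟨s - 2 * k, by omega⟩
    obtain ⟨c, rfl⟩ : ∃ c, N = a + 2 * k + b + c := ⟨N - (a + 2 * k) - b, by omega⟩
    rw [show a + 2 * k + b + c - (a + 2 * k) = b + c by omega, Nat.add_sub_cancel,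
      Nat.add_sub_cancel_left b c, show a + 2 * k + b + c - a - (b + k) = c + k by omega,
      spin_coefficient hν, show a + 2 * k + b + c = a + (b + k) + (c + k) by ring]

/-! ### Generating functions as bidifferential operators -/

variable (d) in
/-- The symbol of the bidifferential operator with a given generating function. -/
def toBi : GenPoly d →+* BiPoly d :=
  MvPolynomial.eval₂Hom (MvPolynomial.C.comp (algebraMap ℝ ℂ))
    fun v => MvPolynomial.X (Fin.castLE (by decide) v.1, v.2)

theorem toBi_C (c : ℝ) : toBi d (MvPolynomial.C c) = MvPolynomial.C (c : ℂ) := by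
  simp [toBi]

theorem toBi_X (a : Fin 3) (i : Fin d) :
    toBi d (MvPolynomial.X (a, i)) = MvPolynomial.X (Fin.castLE (by decide) a, i) := by
  simp [toBi]

theorem toBi_dot (a b : Fin 3) : toBi d (dot d a b) =
    pairing d (Fin.castLE (by decide) a) (Fin.castLE (by decide) b) := by
  simp only [dot, pairing, map_sum, map_mul, toBi_X]

theorem toBi_box : toBi d (box d) = pairing d 2 2 := toBi_dot 2 2

theorem pairing_comm (a b : Fin 5) : pairing d a b = pairing d b a :=
  Finset.sum_congr rfl fun _ _ => mul_comm _ _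

/-- `ρ²` is the quadratic form `□q² - (q∂)²` and `τ` is its polarization, so the combination is this
form at the sum of the two momentum derivatives. -/
theorem toBi_transverse : toBi d (rhoSq d 0 + rhoSq d 1 + 2 * tau d) = transverseSq d := by
  have h00 : toBi d (dot d 0 0) = pairing d 0 0 := toBi_dot 0 0
  have h11 : toBi d (dot d 1 1) = pairing d 1 1 := toBi_dot 1 1
  have h01 : toBi d (dot d 0 1) = pairing d 0 1 := toBi_dot 0 1
  have h02 : toBi d (dot d 0 2) = pairing d 2 0 := (toBi_dot 0 2).trans (pairing_comm _ _)
  have h12 : toBi d (dot d 1 2) = pairing d 2 1 := (toBi_dot 1 2).trans (pairing_comm _ _)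
  have hsq : momSq d = pairing d 0 0 + 2 * pairing d 0 1 + pairing d 1 1 := by
    simp only [momSq, pairing, Finset.mul_sum, ← Finset.sum_add_distrib]
    exact Finset.sum_congr rfl fun i _ => by ring
  simp only [rhoSq, tau, map_add, map_sub, map_mul, map_pow, map_ofNat, toBi_box, h00, h11, h01,
    h02, h12, transverseSq, momPos, hsq]
  ring

theorem act_X_pow_zero (i : Fin d) (n : ℕ) (f : smoothSymbols d) :
    (act (MvPolynomial.X (0, i) ^ n) f : Symbol d) = (dp i)^[n] f := by
  induction n with
  | zero => simp
  | succ n ih => rw [pow_succ', act_mul, act_X_zero, coe_dP, ih, Function.iterate_succ_apply']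

theorem act_X_pow_one (i : Fin d) (n : ℕ) (f : smoothSymbols d) :
    (act (MvPolynomial.X (1, i) ^ n) f : Symbol d) = (dx i)^[n] f := by
  induction n with
  | zero => simp
  | succ n ih => rw [pow_succ', act_mul, act_X_one, coe_dX, ih, Function.iterate_succ_apply']

theorem act_prod_zero (m : Fin d → ℕ) (f : smoothSymbols d) :
    (act (∏ i, MvPolynomial.X (0, i) ^ m i) f : Symbol d) = dpIter m f := by
  rw [Fin.prod_univ_def, dpIter]
  induction List.finRange d with
  | nil => simp
  | cons i l ih =>
    rw [List.map_cons, List.prod_cons, act_mul, act_X_pow_zero, ih, List.foldr_cons]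

theorem act_prod_one (m : Fin d → ℕ) (f : smoothSymbols d) :
    (act (∏ i, MvPolynomial.X (1, i) ^ m i) f : Symbol d) = dxIter m f := by
  rw [Fin.prod_univ_def, dxIter]
  induction List.finRange d with
  | nil => simp
  | cons i l ih =>
    rw [List.map_cons, List.prod_cons, act_mul, act_X_pow_one, ih, List.foldr_cons]

theorem bi_prod_zero_mul (m : Fin d → ℕ) (f g : smoothSymbols d) (r : BiPoly d) :
    bi f g ((∏ i, MvPolynomial.X (0, i) ^ m i) * r) =
      bi (act (∏ i, MvPolynomial.X (0, i) ^ m i) f) g r := by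
  have hpow : ∀ i n (f : smoothSymbols d) r, bi f g (MvPolynomial.X (0, i) ^ n * r) =
      bi (act (MvPolynomial.X (0, i) ^ n) f) g r := fun i n => by
    induction n with
    | zero => simp
    | succ n ih =>
      intro f r
      rw [pow_succ', mul_assoc, bi_X_zero_mul, ih, pow_succ, act_mul, act_X_zero]
  induction (Finset.univ : Finset (Fin d)) using Finset.induction_on generalizing f with
  | empty => simp
  | insert i s hi ih =>
    rw [Finset.prod_insert hi, Finset.prod_insert hi, mul_assoc, hpow, ih, mul_comm, act_mul]

theorem bi_prod_one_mul (m : Fin d → ℕ) (f g : smoothSymbols d) (r : BiPoly d) :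
    bi f g ((∏ i, MvPolynomial.X (1, i) ^ m i) * r) =
      bi f (act (∏ i, MvPolynomial.X (0, i) ^ m i) g) r := by
  have hpow : ∀ i n (g : smoothSymbols d) r, bi f g (MvPolynomial.X (1, i) ^ n * r) =
      bi f (act (MvPolynomial.X (0, i) ^ n) g) r := fun i n => by
    induction n with
    | zero => simp
    | succ n ih =>
      intro g r
      rw [pow_succ', mul_assoc, bi_X_one_mul, ih, pow_succ, act_mul, act_X_zero]
  induction (Finset.univ : Finset (Fin d)) using Finset.induction_on generalizing g with
  | empty => simp
  | insert i s hi ih =>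
    rw [Finset.prod_insert hi, Finset.prod_insert hi, mul_assoc, hpow, ih, mul_comm, act_mul]

theorem bi_prod_two_mul (m : Fin d → ℕ) (f g : smoothSymbols d) (r : BiPoly d) :
    bi f g ((∏ i, MvPolynomial.X (2, i) ^ m i) * r) =
      bi f (act (∏ i, MvPolynomial.X (1, i) ^ m i) g) r := by
  have hpow : ∀ i n (g : smoothSymbols d) r, bi f g (MvPolynomial.X (2, i) ^ n * r) =
      bi f (act (MvPolynomial.X (1, i) ^ n) g) r := fun i n => by
    induction n with
    | zero => simp
    | succ n ih =>
      intro g r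
      rw [pow_succ', mul_assoc, bi_X_two_mul, ih, pow_succ, act_mul, act_X_one]
  induction (Finset.univ : Finset (Fin d)) using Finset.induction_on generalizing g with
  | empty => simp
  | insert i s hi ih =>
    rw [Finset.prod_insert hi, Finset.prod_insert hi, mul_assoc, hpow, ih, mul_comm, act_mul]

theorem bi_toBi (f g : smoothSymbols d) (P : GenPoly d) (x p : Phase d) :
    (bi f g (toBi d P) : Symbol d) x p = ∑ m ∈ P.support, ((P.coeff m : ℝ) : ℂ) *
      (dpIter (fun i => m (0, i)) f x p *
        dxIter (fun i => m (2, i)) (dpIter (fun i => m (1, i)) g) x p) := by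
  conv_lhs => rw [← P.support_sum_monomial_coeff, map_sum, map_sum]
  rw [← sum_coe]
  refine Finset.sum_congr rfl fun m _ => ?_
  have hm : toBi d (MvPolynomial.monomial m (P.coeff m)) = ((P.coeff m : ℝ) : ℂ) •
      ((∏ i, MvPolynomial.X (0, i) ^ m (0, i)) * ((∏ i, MvPolynomial.X (1, i) ^ m (1, i)) *
        ((∏ i, MvPolynomial.X (2, i) ^ m (2, i)) * 1))) := by
    rw [toBi, MvPolynomial.coe_eval₂Hom, MvPolynomial.eval₂_monomial,
      Finsupp.prod_fintype _ _ fun _ => pow_zero _, Fintype.prod_prod_type, Fin.prod_univ_three,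
      MvPolynomial.smul_eq_C_mul, mul_one, mul_assoc]
    rfl
  rw [hm, map_smul, bi_prod_zero_mul, bi_prod_one_mul, bi_prod_two_mul, bi_one, ← act_prod_zero,
    ← act_prod_zero, ← act_prod_one]
  rfl

section Functional

variable {C : Set (Phase d)} {h : smoothSymbols d} (hC : IsCompact C) (hh : VanishesOff C h)

theorem generatedAction_eq (P : GenPoly d) :
    generatedAction P (h : Symbol d) = biIntegral hC hh (toBi d P) := by
  rw [generatedAction]
  simp only [← bi_toBi]
  rfl

theorem stepIntegral_div (D : ℝ) (n : ℕ) (w : Phase d → ℂ) (c : ℂ) :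
    stepIntegral D n (fun p => w p / c) = 1 / c * stepIntegral D n w := by
  rw [stepIntegral, stepIntegral, ← iteratedDeriv_const_mul_field]
  congr 1
  funext σ
  rw [← integral_const_mul]
  congr 1
  funext p
  ring

theorem quadraticAction_eq (hC : IsCompact C) (hh : VanishesOff C h) (k : ℕ) {D : ℝ} (hD : 0 < D) :
    quadraticAction D (h : Symbol d) k = (((2 * Real.pi) ^ d : ℝ) : ℂ)⁻¹ *
      ∑ n ∈ Finset.range (2 * k + 3), 1 / (n.factorial : ℂ) *
        ∫ x, stepIntegral D n ((quadraticSymbol h k n : Symbol d) x) := by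
  have hst : ∀ n x, starTaylor D (h : Symbol d) 2 k n x = fun p =>
      (quadraticSymbol h k n : Symbol d) x p / (n.factorial : ℂ) := fun n x =>
    funext fun p => starTaylor_two D h k n x p
  simp only [quadraticAction, lagrangian, hst, stepIntegral_div]
  rw [integral_const_mul, integral_finsetSum]
  · simp only [integral_const_mul]
  · exact fun n _ => (integrable_stepIntegral hC (hh.bi hC.isClosed h _) n hD).const_mul _

theorem tendsto_quadraticAction (hC : IsCompact C) (hh : VanishesOff C h) {m : ℕ}
    (hd : d = 2 * (m + 2)) (k : ℕ) :
    Tendsto (fun D : ℝ => quadraticAction D (h : Symbol d) k) (𝓝[>] 0)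
      (𝓝 ((((2 * Real.pi) ^ d : ℝ) : ℂ)⁻¹ * ∑ n ∈ Finset.range (2 * k + 3),
        1 / (n.factorial : ℂ) * evenLimit (m + 2) n (quadraticSymbol h k n))) := by
  have h1 : Tendsto (fun D : ℝ => (((2 * Real.pi) ^ d : ℝ) : ℂ)⁻¹ *
      ∑ n ∈ Finset.range (2 * k + 3), 1 / (n.factorial : ℂ) *
        ∫ x, stepIntegral D n ((quadraticSymbol h k n : Symbol d) x)) (𝓝[>] 0)
      (𝓝 ((((2 * Real.pi) ^ d : ℝ) : ℂ)⁻¹ * ∑ n ∈ Finset.range (2 * k + 3),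
        1 / (n.factorial : ℂ) * evenLimit (m + 2) n (quadraticSymbol h k n))) :=
    (tendsto_finsetSum _ fun n _ => (tendsto_integral_stepIntegral hC (by omega) hd
      (hh.bi hC.isClosed h _) n).const_mul _).const_mul _
  refine h1.congr' ?_
  filter_upwards [self_mem_nhdsWithin] with D hD
  exact (quadraticAction_eq hC hh k hD).symm

/-- The constants in the decomposition of the quadratic action into spins. -/
def spinConstant (d m s : ℕ) : ℝ :=
  ((2 * Real.pi) ^ d)⁻¹ * (Real.pi ^ (m + 2) * (Real.sqrt Real.pi / 4 ^ (m + 1))) *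
    spinWeight (((d : ℝ) - 3) / 2) s

theorem deformedSum_eq_zero {m : ℕ} (hd : d = 2 * (m + 2)) (α : ℕ → ℝ) (f : Symbol d) {k : ℕ}
    (hk : Odd k ∨ k < 2 * m) : deformedSum α f k = 0 := by
  refine Finset.sum_eq_zero fun s _ => Finset.sum_eq_zero fun j _ => if_neg ?_
  rcases hk with ⟨l, rfl⟩ | hk <;> omega

theorem deformedSum_even {m : ℕ} (hd : d = 2 * (m + 2)) (α : ℕ → ℝ) (f : Symbol d) (N : ℕ) :
    deformedSum α f (2 * (m + N)) = ∑ s ∈ Finset.range (N + 1), (α s : ℂ) * (-1 / 4) ^ (N - s) *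
      generatedAction (box d ^ m * PowerSeries.coeff (N - s) (deformedGen d s)) f := by
  have hm : d / 2 - 2 = m := by omega
  rw [deformedSum, hm, ← Finset.sum_subset (Finset.range_subset_range.2
    (show N + 1 ≤ 2 * (m + N) + 1 by omega))]
  · refine Finset.sum_congr rfl fun s hs => ?_
    rw [Finset.mem_range] at hs
    rw [Finset.sum_eq_single (N - s)]
    · rw [if_pos (by omega)]
    · intro j _ hj
      rw [if_neg (by omega)]
    · intro hN
      exact absurd (Finset.mem_range.2 (by omega)) hN
  · intro s _ hs
    rw [Finset.mem_range] at hs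
    exact Finset.sum_eq_zero fun j _ => if_neg (by omega)

/-- Odd orders and orders below `2m` vanish on both sides. In the remaining orders `k = 2(m + N)`
both sides are multiples of `□^m (ρ² + ρ'² + 2τ)^N`, and only the constants have to be compared. -/
theorem limit_eq_deformedSum (hC : IsCompact C) (hh : VanishesOff C h) {m : ℕ}
    (hd : d = 2 * (m + 2)) (k : ℕ) :
    (((2 * Real.pi) ^ d : ℝ) : ℂ)⁻¹ * ∑ n ∈ Finset.range (2 * k + 3),
      1 / (n.factorial : ℂ) * evenLimit (m + 2) n (quadraticSymbol h k n) =
    deformedSum (spinConstant d m) (h : Symbol d) k := by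
  by_cases hodd : Odd k
  · rw [sum_evenLimit_odd hC hh m k hodd, mul_zero, deformedSum_eq_zero hd _ _ (Or.inl hodd)]
  by_cases hlt : k < 2 * m
  · rw [sum_evenLimit_of_lt hC hh m k hlt, mul_zero, deformedSum_eq_zero hd _ _ (Or.inr hlt)]
  obtain ⟨l, hl⟩ := Nat.not_odd_iff_even.1 hodd
  obtain ⟨N, rfl⟩ : ∃ N, k = 2 * (m + N) := ⟨l - m, by omega⟩
  have hν : ((d : ℝ) - 3) / 2 = m + 1 / 2 := by
    rw [hd]
    push_cast
    ring
  have hν0 : 0 < ((d : ℝ) - 3) / 2 := by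
    rw [hν]
    positivity
  set c : ℝ := ((2 * Real.pi) ^ d)⁻¹ * (Real.pi ^ (m + 2) * (Real.sqrt Real.pi / 4 ^ (m + 1))) with hc
  have hsum := congrArg (fun P => biIntegral hC hh (toBi d (box d ^ m * P))) (sum_spins hν0 N)
  have hR : ∀ (a : ℝ) (P : GenPoly d), biIntegral hC hh (toBi d (box d ^ m *
      (MvPolynomial.C a * P))) = (a : ℂ) * biIntegral hC hh (toBi d (box d ^ m * P)) := fun a P => by
    rw [mul_left_comm, map_mul (toBi d), toBi_C, ← MvPolynomial.smul_eq_C_mul, map_smul, smul_eq_mul]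
  simp only [Finset.mul_sum, map_sum, hR] at hsum
  rw [map_mul (toBi d) (_ ^ _) (_ ^ _), map_pow, map_pow, toBi_box, toBi_transverse] at hsum
  have hα : ∀ s, spinConstant d m s = c * spinWeight (((d : ℝ) - 3) / 2) s := fun s => rfl
  rw [sum_evenLimit_even hC hh, deformedSum_even hd]
  simp only [generatedAction_eq hC hh, hα]
  have hL : ∑ s ∈ Finset.range (N + 1), ((c * spinWeight (((d : ℝ) - 3) / 2) s : ℝ) : ℂ) *
      (-1 / 4) ^ (N - s) * biIntegral hC hh (toBi d (box d ^ m *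
        PowerSeries.coeff (N - s) (deformedGen d s))) =
      c * ∑ s ∈ Finset.range (N + 1), ((spinWeight (((d : ℝ) - 3) / 2) s * (-1 / 4) ^ (N - s) : ℝ) : ℂ) *
        biIntegral hC hh (toBi d (box d ^ m * PowerSeries.coeff (N - s) (deformedGen d s))) := by
    rw [Finset.mul_sum]
    refine Finset.sum_congr rfl fun s _ => ?_
    push_cast
    ring
  rw [hL, hsum, ← mul_assoc, ← mul_assoc, ← mul_assoc]
  congr 1
  -- The Gamma function produced by the interval moments is exactly the one in the Bessel series of
  -- index `(d-3)/2`, so the ratio of the constants is independent of `N`.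
  have hG : ((m + N : ℕ) : ℝ) + 3 / 2 = ((d : ℝ) - 3) / 2 + N + 1 := by
    rw [hν]
    push_cast
    ring
  rw [hG, hc]
  push_cast
  field_simp

theorem quadraticAction_hasHalfIntegerExpansion (hC : IsCompact C) (hh : VanishesOff C h)
    (hd : Odd d) (k : ℕ) :
    HasHalfIntegerExpansion fun D : ℝ => quadraticAction D (h : Symbol d) k := by
  obtain ⟨g, hg, hlim⟩ := (HasHalfIntegerExpansion.sum (s := Finset.range (2 * k + 3)) fun n _ =>
    (hasHalfIntegerExpansion_stepIntegral hC hd (hh.bi hC.isClosed h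
      (PowerSeries.coeff k (quadraticIncrement d n))) n).const_mul
        (1 / (n.factorial : ℂ))).const_mul (((2 * Real.pi) ^ d : ℝ) : ℂ)⁻¹
  refine ⟨g, hg, hlim.congr' ?_⟩
  filter_upwards [self_mem_nhdsWithin] with D hD
  rw [Pi.sub_apply, Pi.sub_apply, quadraticAction_eq hC hh k hD]
  rfl

end Functional

/-! ### Gauge invariance -/

theorem pderiv_dot (i : Fin d) (a b : Fin 3) : MvPolynomial.pderiv (0, i) (dot d a b) =
    (if b = 0 then MvPolynomial.X (a, i) else 0) + if a = 0 then MvPolynomial.X (b, i) else 0 := by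
  rw [dot, map_sum, Finset.sum_eq_single i]
  · rw [Derivation.leibniz, smul_eq_mul, smul_eq_mul, MvPolynomial.pderiv_X, MvPolynomial.pderiv_X,
      Pi.single_apply, Pi.single_apply]
    by_cases ha : a = 0 <;> by_cases hb : b = 0 <;> simp [ha, hb]
  · intro j _ hj
    rw [Derivation.leibniz, MvPolynomial.pderiv_X_of_ne (by simp [hj]),
      MvPolynomial.pderiv_X_of_ne (by simp [hj]), smul_zero, smul_zero, add_zero]
  · simp

theorem pderiv_box (i : Fin d) : MvPolynomial.pderiv (0, i) (box d) = 0 := by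
  simp [box, pderiv_dot]

theorem pderiv_rhoSq_zero (i : Fin d) : MvPolynomial.pderiv (0, i) (rhoSq d 0) =
    2 * (box d * MvPolynomial.X (0, i) - dot d 0 2 * MvPolynomial.X (2, i)) := by
  simp only [rhoSq, map_sub, Derivation.leibniz, Derivation.leibniz_pow, pderiv_box, pderiv_dot,
    smul_eq_mul, nsmul_eq_mul]
  simp
  ring

theorem pderiv_rhoSq_one (i : Fin d) : MvPolynomial.pderiv (0, i) (rhoSq d 1) = 0 := by
  simp only [rhoSq, map_sub, Derivation.leibniz, Derivation.leibniz_pow, pderiv_box, pderiv_dot]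
  simp

theorem pderiv_tau (i : Fin d) : MvPolynomial.pderiv (0, i) (tau d) =
    box d * MvPolynomial.X (1, i) - dot d 1 2 * MvPolynomial.X (2, i) := by
  simp only [tau, map_sub, Derivation.leibniz, pderiv_box, pderiv_dot, smul_eq_mul]
  simp

variable (d) in
/-- The divergence operator `∂_q ∂`. -/
def divergence : Derivation ℝ (GenPoly d) (GenPoly d) :=
  ∑ i, (MvPolynomial.X (2, i) : GenPoly d) • MvPolynomial.pderiv (0, i)

theorem divergence_apply (P : GenPoly d) : divergence d P =
    ∑ i, MvPolynomial.X (2, i) * MvPolynomial.pderiv (0, i) P := by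
  change Derivation.coeFnAddMonoidHom (divergence d) P = _
  rw [divergence, map_sum, Finset.sum_apply]
  rfl

theorem divergence_rhoSq_zero : divergence d (rhoSq d 0) = 0 := by
  simp only [divergence_apply, pderiv_rhoSq_zero]
  have : ∀ i : Fin d, (MvPolynomial.X (2, i) : GenPoly d) *
      (2 * (box d * MvPolynomial.X (0, i) - dot d 0 2 * MvPolynomial.X (2, i))) =
      2 * (box d * (MvPolynomial.X (0, i) * MvPolynomial.X (2, i)) -
        dot d 0 2 * (MvPolynomial.X (2, i) * MvPolynomial.X (2, i))) := fun i => by ring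
  simp only [this]
  rw [← Finset.mul_sum, Finset.sum_sub_distrib, ← Finset.mul_sum, ← Finset.mul_sum, ← dot, ← dot,
    ← box]
  ring

theorem divergence_rhoSq_one : divergence d (rhoSq d 1) = 0 := by
  simp [divergence_apply, pderiv_rhoSq_one]

theorem divergence_tau : divergence d (tau d) = 0 := by
  simp only [divergence_apply, pderiv_tau]
  have : ∀ i : Fin d, (MvPolynomial.X (2, i) : GenPoly d) *
      (box d * MvPolynomial.X (1, i) - dot d 1 2 * MvPolynomial.X (2, i)) =
      box d * (MvPolynomial.X (1, i) * MvPolynomial.X (2, i)) -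
        dot d 1 2 * (MvPolynomial.X (2, i) * MvPolynomial.X (2, i)) := fun i => by ring
  simp only [this]
  rw [Finset.sum_sub_distrib, ← Finset.mul_sum, ← Finset.mul_sum, ← dot, ← dot, ← box]
  ring

/-- The divergence is a derivation which annihilates `ρ²`, `ρ'²` and `τ`, and hence every polynomial
in them. -/
theorem deformedGen_transverse (s m : ℕ) :
    divergence d (PowerSeries.coeff m (deformedGen d s)) = 0 := by
  simp only [coeff_deformedGen, undressedGen, map_sum, Derivation.leibniz, Derivation.leibniz_pow,
    divergence_rhoSq_zero, divergence_rhoSq_one, divergence_tau, ← MvPolynomial.algebraMap_eq,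
    Derivation.map_algebraMap, smul_zero, add_zero, Finset.sum_const_zero]

theorem deformedGen_symm (s m : ℕ) : MvPolynomial.aeval (fun v : Fin 3 × Fin d =>
    if v.1 = 2 then -(MvPolynomial.X v : GenPoly d)
    else MvPolynomial.X (Equiv.swap 0 1 v.1, v.2)) (PowerSeries.coeff m (deformedGen d s)) =
      PowerSeries.coeff m (deformedGen d s) := by
  set φ : GenPoly d →ₐ[ℝ] GenPoly d := MvPolynomial.aeval (fun v : Fin 3 × Fin d =>
    if v.1 = 2 then -(MvPolynomial.X v : GenPoly d)
    else MvPolynomial.X (Equiv.swap 0 1 v.1, v.2)) with hφ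
  have h0 : ∀ i, φ (MvPolynomial.X (0, i)) = MvPolynomial.X (1, i) := fun i => by simp [hφ]
  have h1 : ∀ i, φ (MvPolynomial.X (1, i)) = MvPolynomial.X (0, i) := fun i => by simp [hφ]
  have h2 : ∀ i, φ (MvPolynomial.X (2, i)) = -MvPolynomial.X (2, i) := fun i => by simp [hφ]
  have hr0 : φ (rhoSq d 0) = rhoSq d 1 := by
    simp [rhoSq, box, dot, h0, h2]
  have hr1 : φ (rhoSq d 1) = rhoSq d 0 := by
    simp [rhoSq, box, dot, h1, h2]
  have ht : φ (tau d) = tau d := by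
    simp only [tau, box, dot, map_sub, map_mul, map_sum, h0, h1, h2, neg_mul, mul_neg, neg_neg,
      Finset.sum_neg_distrib]
    rw [Finset.sum_congr rfl fun i _ => mul_comm (MvPolynomial.X (1, i)) (MvPolynomial.X (0, i))]
    ring
  have hu : φ (undressedGen d s) = undressedGen d s := by
    simp only [undressedGen, map_sum, map_mul, map_pow, ht, hr0, hr1, mul_comm (rhoSq d 1)]
    simp only [← MvPolynomial.algebraMap_eq, AlgHom.commutes]
  -- The exchange of `ρ²` and `ρ'²` is undone by reversing the order of summation, `b ↦ m - b`.
  rw [coeff_deformedGen, map_sum, ← Finset.sum_range_reflect]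
  refine Finset.sum_congr rfl fun b hb => ?_
  rw [Finset.mem_range] at hb
  rw [show m + 1 - 1 - b = m - b by omega, show m - (m - b) = b by omega]
  simp only [map_mul, map_pow, hr0, hr1, hu]
  simp only [← MvPolynomial.algebraMap_eq, AlgHom.commutes]
  ring

/-! ### Traces of the generating functions -/

variable (d) in
/-- The trace operator `∂_q²`. -/
def traceOp : GenPoly d →ₗ[ℝ] GenPoly d :=
  ∑ i, (MvPolynomial.pderiv (0, i)).toLinearMap ∘ₗ (MvPolynomial.pderiv (0, i)).toLinearMap

theorem traceOp_apply (P : GenPoly d) : traceOp d P =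
    ∑ i, MvPolynomial.pderiv (0, i) (MvPolynomial.pderiv (0, i) P) := by
  simp [traceOp]

/-- The scalar product of gradients with respect to `q`. -/
def gradPair (P Q : GenPoly d) : GenPoly d :=
  ∑ i, MvPolynomial.pderiv (0, i) P * MvPolynomial.pderiv (0, i) Q

theorem traceOp_mul (P Q : GenPoly d) :
    traceOp d (P * Q) = traceOp d P * Q + 2 * gradPair P Q + P * traceOp d Q := by
  simp only [traceOp_apply, gradPair, Finset.mul_sum, Finset.sum_mul, ← Finset.sum_add_distrib,
    Derivation.leibniz, map_add, smul_eq_mul]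
  exact Finset.sum_congr rfl fun i _ => by ring

theorem traceOp_pow (P : GenPoly d) (n : ℕ) : traceOp d (P ^ n) =
    n * P ^ (n - 1) * traceOp d P + n * ((n : GenPoly d) - 1) * P ^ (n - 2) * gradPair P P := by
  simp only [traceOp_apply, gradPair, Finset.mul_sum, ← Finset.sum_add_distrib,
    Derivation.leibniz_pow, Derivation.leibniz, smul_eq_mul, nsmul_eq_mul, Derivation.map_natCast,
    mul_zero, add_zero]
  refine Finset.sum_congr rfl fun i _ => ?_
  rcases n with _ | _ | n
  · simp
  · simp
  · rw [show n + 1 + 1 - 1 = n + 1 by omega, show n + 1 + 1 - 2 = n by omega,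
      Nat.add_sub_cancel]
    push_cast
    ring

theorem gradPair_pow (P Q : GenPoly d) (a b : ℕ) : gradPair (P ^ a) (Q ^ b) =
    a * b * P ^ (a - 1) * Q ^ (b - 1) * gradPair P Q := by
  simp only [gradPair, Finset.mul_sum, Derivation.leibniz_pow, smul_eq_mul, nsmul_eq_mul]
  exact Finset.sum_congr rfl fun i _ => by ring

theorem gradPair_rhoSq_rhoSq : gradPair (rhoSq d 0) (rhoSq d 0) = 4 * (box d * rhoSq d 0) := by
  have : ∀ i : Fin d, (2 * (box d * MvPolynomial.X (0, i) - dot d 0 2 * MvPolynomial.X (2, i))) *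
      (2 * (box d * MvPolynomial.X (0, i) - dot d 0 2 * MvPolynomial.X (2, i))) =
      4 * (box d ^ 2 * (MvPolynomial.X (0, i) * MvPolynomial.X (0, i)) -
        2 * box d * dot d 0 2 * (MvPolynomial.X (0, i) * MvPolynomial.X (2, i)) +
        dot d 0 2 ^ 2 * (MvPolynomial.X (2, i) * MvPolynomial.X (2, i))) := fun i => by ring
  simp only [gradPair, pderiv_rhoSq_zero, this]
  rw [← Finset.mul_sum, Finset.sum_add_distrib, Finset.sum_sub_distrib, ← Finset.mul_sum,
    ← Finset.mul_sum, ← Finset.mul_sum, ← dot, ← dot, ← dot, ← box, rhoSq]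
  ring

theorem gradPair_tau_rhoSq : gradPair (tau d) (rhoSq d 0) = 2 * (box d * tau d) := by
  have : ∀ i : Fin d, (box d * MvPolynomial.X (1, i) - dot d 1 2 * MvPolynomial.X (2, i)) *
      (2 * (box d * MvPolynomial.X (0, i) - dot d 0 2 * MvPolynomial.X (2, i))) =
      2 * (box d ^ 2 * (MvPolynomial.X (0, i) * MvPolynomial.X (1, i)) -
        box d * dot d 0 2 * (MvPolynomial.X (1, i) * MvPolynomial.X (2, i)) -
        box d * dot d 1 2 * (MvPolynomial.X (0, i) * MvPolynomial.X (2, i)) +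
        dot d 0 2 * dot d 1 2 * (MvPolynomial.X (2, i) * MvPolynomial.X (2, i))) :=
    fun i => by ring
  simp only [gradPair, pderiv_tau, pderiv_rhoSq_zero, this]
  rw [← Finset.mul_sum, Finset.sum_add_distrib, Finset.sum_sub_distrib, Finset.sum_sub_distrib,
    ← Finset.mul_sum, ← Finset.mul_sum, ← Finset.mul_sum, ← Finset.mul_sum, ← dot, ← dot, ← dot,
    ← dot, ← box, tau]
  ring

theorem gradPair_tau_tau : gradPair (tau d) (tau d) = box d * rhoSq d 1 := by
  have : ∀ i : Fin d, (box d * MvPolynomial.X (1, i) - dot d 1 2 * MvPolynomial.X (2, i)) *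
      (box d * MvPolynomial.X (1, i) - dot d 1 2 * MvPolynomial.X (2, i)) =
      box d ^ 2 * (MvPolynomial.X (1, i) * MvPolynomial.X (1, i)) -
        2 * box d * dot d 1 2 * (MvPolynomial.X (1, i) * MvPolynomial.X (2, i)) +
        dot d 1 2 ^ 2 * (MvPolynomial.X (2, i) * MvPolynomial.X (2, i)) := fun i => by ring
  simp only [gradPair, pderiv_tau, this]
  rw [Finset.sum_add_distrib, Finset.sum_sub_distrib, ← Finset.mul_sum,
    ← Finset.mul_sum, ← Finset.mul_sum, ← dot, ← dot, ← dot, ← box, rhoSq]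
  ring

theorem traceOp_tau : traceOp d (tau d) = 0 := by
  rw [traceOp_apply]
  refine Finset.sum_eq_zero fun i _ => ?_
  rw [pderiv_tau, map_sub, Derivation.leibniz, Derivation.leibniz, pderiv_box, pderiv_dot,
    MvPolynomial.pderiv_X_of_ne (by simp), MvPolynomial.pderiv_X_of_ne (by simp)]
  simp

theorem traceOp_rhoSq_zero : traceOp d (rhoSq d 0) = 2 * ((d : GenPoly d) - 1) * box d := by
  have : ∀ i : Fin d, MvPolynomial.pderiv (0, i)
      (2 * (box d * MvPolynomial.X (0, i) - dot d 0 2 * MvPolynomial.X (2, i))) =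
      2 * (box d - MvPolynomial.X (2, i) * MvPolynomial.X (2, i)) := fun i => by
    rw [← map_ofNat (MvPolynomial.C (σ := Fin 3 × Fin d) (R := ℝ)) 2, Derivation.leibniz,
      MvPolynomial.pderiv_C, map_sub, Derivation.leibniz,
      Derivation.leibniz, pderiv_box, pderiv_dot, MvPolynomial.pderiv_X_self,
      MvPolynomial.pderiv_X_of_ne (by simp)]
    simp
  simp only [traceOp_apply, pderiv_rhoSq_zero, this]
  rw [← Finset.mul_sum, Finset.sum_sub_distrib, ← dot, ← box, Finset.sum_const, Finset.card_univ,
    Fintype.card_fin, nsmul_eq_mul]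
  ring

/-- The pairings of the gradients of `τ` and `ρ²` are again `□` times `ρ²`, `ρ'²` or `τ`, so the
trace maps monomials in these invariants to monomials times `□`. -/
theorem traceOp_monomial (a b c : ℕ) :
    traceOp d (tau d ^ a * rhoSq d 0 ^ b * rhoSq d 1 ^ c) = box d *
      (MvPolynomial.C ((a : ℝ) * (a - 1)) *
          (tau d ^ (a - 2) * rhoSq d 0 ^ b * rhoSq d 1 ^ (c + 1)) +
        MvPolynomial.C ((b : ℝ) * (4 * a + 4 * (b - 1) + 2 * (d - 1))) *
          (tau d ^ a * rhoSq d 0 ^ (b - 1) * rhoSq d 1 ^ c)) := by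
  have hY : ∀ i, MvPolynomial.pderiv (0, i) (rhoSq d 1 ^ c) = 0 := fun i => by
    rw [Derivation.leibniz_pow, pderiv_rhoSq_one, smul_zero, smul_zero]
  -- The truncated exponent at `a = 0` is harmless because of the factor `a`.
  have ht : (a : GenPoly d) * (tau d ^ (a - 1) * tau d) = a * tau d ^ a := by
    cases a with
    | zero => simp
    | succ a => rw [Nat.add_sub_cancel, pow_succ]
  have hr : (b : GenPoly d) * ((b : GenPoly d) - 1) * (rhoSq d 0 ^ (b - 2) * rhoSq d 0) =
      b * ((b : GenPoly d) - 1) * rhoSq d 0 ^ (b - 1) := by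
    rcases b with _ | _ | b
    · simp
    · simp
    · rw [show b + 1 + 1 - 2 = b by omega, show b + 1 + 1 - 1 = b + 1 by omega, pow_succ]
  have h0 : traceOp d (rhoSq d 1 ^ c) = 0 := by simp [traceOp_apply, hY]
  have h1 : gradPair (tau d ^ a * rhoSq d 0 ^ b) (rhoSq d 1 ^ c) = 0 := by simp [gradPair, hY]
  rw [traceOp_mul, h0, h1, traceOp_mul, traceOp_pow, traceOp_pow, gradPair_pow, traceOp_tau,
    traceOp_rhoSq_zero, gradPair_tau_tau, gradPair_rhoSq_rhoSq, gradPair_tau_rhoSq]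
  simp only [map_mul, map_add, map_sub, map_natCast, map_ofNat, map_one]
  linear_combination (4 * b * box d * rhoSq d 0 ^ (b - 1) * rhoSq d 1 ^ c) * ht +
    (4 * box d * tau d ^ a * rhoSq d 1 ^ c) * hr

/-- The coefficients of `undressedGen`. -/
def gegenbauerCoeff (ν : ℝ) (s k : ℕ) : ℝ :=
  (-1) ^ k * 2 ^ (s - 2 * k) / ((k.factorial : ℝ) * ((s - 2 * k).factorial : ℝ) *
    ∏ i ∈ Finset.range k, (ν + s - (i + 1)))

/-- The Gegenbauer differential equation, read as a recursion of coefficients; it balances lowering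
`τ` twice against lowering `ρ²` once. -/
theorem gegenbauerCoeff_succ {ν : ℝ} (hν : 0 ≤ ν) (j k : ℕ) :
    ((j + 2 * (k + 1) - 2 * k : ℕ) : ℝ) * (((j + 2 * (k + 1) - 2 * k : ℕ) : ℝ) - 1) *
      gegenbauerCoeff ν (j + 2 * (k + 1)) k =
    -(4 * (k + 1) * ((j + 2 * (k + 1) : ℕ) + ν - (k + 1)) *
      gegenbauerCoeff ν (j + 2 * (k + 1)) (k + 1)) := by
  rw [gegenbauerCoeff, gegenbauerCoeff, Nat.add_sub_cancel, Finset.prod_range_succ,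
    show j + 2 * (k + 1) - 2 * k = j + 1 + 1 by omega, Nat.factorial_succ, Nat.factorial_succ,
    Nat.factorial_succ]
  have hj : (0 : ℝ) ≤ j := by positivity
  have hk : (0 : ℝ) ≤ k := by positivity
  -- The spin is at least `2(k + 1)`, so the new factor in the denominator is positive even for `ν =
  -- 0`, that is `d = 3`.
  have h0 : ν + ((j + 2 * (k + 1) : ℕ) : ℝ) - (k + 1) ≠ 0 := by
    push_cast
    intro h
    linarith
  have e : ((j + 2 * (k + 1) : ℕ) : ℝ) + ν - (k + 1) = ν + ((j + 2 * (k + 1) : ℕ) : ℝ) - (k + 1) := by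
    ring
  rw [e]
  generalize ∏ i ∈ Finset.range k, (ν + ((j + 2 * (k + 1) : ℕ) : ℝ) - (i + 1)) = Q
  generalize ν + ((j + 2 * (k + 1) : ℕ) : ℝ) - (k + 1) = R at *
  by_cases hQ : Q = 0
  · simp [hQ]
  · have h1 : (j : ℝ) + 1 ≠ 0 := by positivity
    have h2 : (j : ℝ) + 1 + 1 ≠ 0 := by positivity
    have h3 : (k : ℝ) + 1 ≠ 0 := by positivity
    push_cast
    rw [pow_succ (-1 : ℝ), pow_succ, pow_succ]
    field_simp
    ring

variable (d) in
/-- `undressedGen` multiplied by powers of `ρ²` and `ρ'²`. -/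
def dressedMonomial (s b c : ℕ) : GenPoly d :=
  ∑ k ∈ Finset.range (s / 2 + 1), MvPolynomial.C (gegenbauerCoeff (((d : ℝ) - 3) / 2) s k) *
    (tau d ^ (s - 2 * k) * rhoSq d 0 ^ (b + k) * rhoSq d 1 ^ (c + k))

theorem traceOp_C_mul (a : ℝ) (P : GenPoly d) :
    traceOp d (MvPolynomial.C a * P) = MvPolynomial.C a * traceOp d P := by
  rw [← MvPolynomial.smul_eq_C_mul, map_smul, MvPolynomial.smul_eq_C_mul]

/-- The part of the trace already present without dressing cancels between neighbouring `k`, which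
expresses tracelessness of the undressed function. What remains is proportional to the dressing
order `b`. -/
theorem traceOp_dressedMonomial (hd : 2 < d) (s b c : ℕ) : traceOp d (dressedMonomial d s b c) =
    box d * ∑ k ∈ Finset.range (s / 2 + 1),
      MvPolynomial.C (4 * b * (b + s + ((d : ℝ) - 3) / 2) *
        gegenbauerCoeff (((d : ℝ) - 3) / 2) s k) *
          (tau d ^ (s - 2 * k) * rhoSq d 0 ^ (b + k - 1) * rhoSq d 1 ^ (c + k)) := by
  set ν := ((d : ℝ) - 3) / 2 with hν
  have hd3 : (3 : ℝ) ≤ d := by exact_mod_cast hd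
  have hν0 : 0 ≤ ν := by rw [hν]; linarith
  set f : ℕ → GenPoly d := fun k =>
    MvPolynomial.C (4 * k * (s + ν - k) * gegenbauerCoeff ν s k) *
      (tau d ^ (s - 2 * k) * rhoSq d 0 ^ (b + k - 1) * rhoSq d 1 ^ (c + k)) with hf
  set g : ℕ → GenPoly d := fun k =>
    MvPolynomial.C (((s - 2 * k : ℕ) : ℝ) * (((s - 2 * k : ℕ) : ℝ) - 1) * gegenbauerCoeff ν s k) *
      (tau d ^ (s - 2 * k - 2) * rhoSq d 0 ^ (b + k) * rhoSq d 1 ^ (c + k + 1)) with hg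
  -- Term `k` of `g` cancels term `k + 1` of `f`; at the ends, `f` vanishes for `k = 0`, and `g`
  -- vanishes when the exponent of `τ` is 0 or 1.
  have hfg : ∑ k ∈ Finset.range (s / 2 + 1), (g k + f k) = 0 := by
    have h0 : f 0 = 0 := by simp [hf]
    have hlast : g (s / 2) = 0 := by
      have : s - 2 * (s / 2) = 0 ∨ s - 2 * (s / 2) = 1 := by omega
      rcases this with h | h <;> simp [hg, h]
    rw [Finset.sum_add_distrib, Finset.sum_range_succ, Finset.sum_range_succ' f, h0, hlast, add_zero,
      add_zero, ← Finset.sum_add_distrib]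
    refine Finset.sum_eq_zero fun k hk => ?_
    rw [Finset.mem_range] at hk
    obtain ⟨j, rfl⟩ : ∃ j, s = j + 2 * (k + 1) := ⟨s - 2 * (k + 1), by omega⟩
    simp only [hf, hg]
    rw [gegenbauerCoeff_succ hν0, Nat.add_sub_cancel,
      show j + 2 * (k + 1) - 2 * k - 2 = j by omega, show b + (k + 1) - 1 = b + k by omega,
      ← add_assoc c k 1, map_neg]
    push_cast
    ring
  rw [dressedMonomial, map_sum, ← add_zero (box d * _), ← mul_zero (box d), ← hfg, ← mul_add,
    ← Finset.sum_add_distrib, Finset.mul_sum]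
  refine Finset.sum_congr rfl fun k hk => ?_
  rw [Finset.mem_range] at hk
  obtain ⟨j, rfl⟩ : ∃ j, s = j + 2 * k := ⟨s - 2 * k, by omega⟩
  rw [traceOp_C_mul, traceOp_monomial]
  simp only [hf, hg]
  rw [Nat.add_sub_cancel]
  -- With `2(d - 1) = 4ν + 4`, the factor splits into a part depending on `b`, which is kept, and a
  -- part independent of `b`, which belongs to `f`.
  have hcoef : (((b + k : ℕ) : ℝ) * (4 * j + 4 * ((b + k : ℕ) - 1) + 2 * (d - 1))) =
      4 * b * (b + (j + 2 * k : ℕ) + ν) + 4 * k * ((j + 2 * k : ℕ) + ν - k) := by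
    rw [hν]
    push_cast
    ring
  rw [hcoef]
  simp only [map_mul, map_add]
  ring

theorem coeff_deformedGen_eq_dressedMonomial (s m : ℕ) :
    PowerSeries.coeff m (deformedGen d s) = ∑ b ∈ Finset.range (m + 1), MvPolynomial.C
      (besselCoeff (s + ((d : ℝ) - 3) / 2) b * besselCoeff (s + ((d : ℝ) - 3) / 2) (m - b)) *
        dressedMonomial d s b (m - b) := by
  rw [coeff_deformedGen]
  refine Finset.sum_congr rfl fun b _ => ?_
  rw [mul_assoc, dressedMonomial, undressedGen]
  congr 1
  rw [Finset.mul_sum]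
  refine Finset.sum_congr rfl fun k _ => ?_
  rw [← gegenbauerCoeff, mul_pow]
  ring

/-- Bessel's equation for the power series of `z^(-l) J_l(z)`. -/
theorem besselCoeff_succ {l : ℝ} (hl : 0 ≤ l) (j : ℕ) :
    4 * (j + 1) * (j + 1 + l) * besselCoeff l (j + 1) = -besselCoeff l j := by
  have hG := Real.Gamma_add_one (show l + j + 1 ≠ 0 by positivity)
  have h1 : Real.Gamma (l + j + 1) ≠ 0 := (Real.Gamma_pos_of_pos (by positivity)).ne'
  have h2 : l + j + 1 ≠ 0 := by positivity
  have h3 : (j : ℝ) + 1 ≠ 0 := by positivity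
  have h4 : (2 : ℝ) ^ l ≠ 0 := by positivity
  have h5 : (j.factorial : ℝ) ≠ 0 := by positivity
  rw [besselCoeff, besselCoeff, Nat.factorial_succ]
  push_cast
  rw [show l + (j + 1) + 1 = l + j + 1 + 1 by ring, hG, pow_succ (-1 : ℝ), pow_succ (4 : ℝ)]
  field_simp
  ring

theorem deformedGen_trace_zero (hd : 2 < d) (s : ℕ) :
    traceOp d (PowerSeries.coeff 0 (deformedGen d s)) = 0 := by
  rw [coeff_deformedGen_eq_dressedMonomial, zero_add, Finset.sum_range_one, traceOp_C_mul,
    traceOp_dressedMonomial hd]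
  simp

/-- At dressing order `b + 1` the trace produces `4(b+1)(b+1+s+ν)`, which is the factor in the
Bessel recursion, so it gives `-□` times order `b`. Order 0 is traceless. -/
theorem deformedGen_trace_succ (hd : 2 < d) (s m : ℕ) :
    traceOp d (PowerSeries.coeff (m + 1) (deformedGen d s)) +
      box d * PowerSeries.coeff m (deformedGen d s) = 0 := by
  have hd3 : (3 : ℝ) ≤ d := by exact_mod_cast hd
  have hν0 : 0 ≤ (s : ℝ) + ((d : ℝ) - 3) / 2 :=
    add_nonneg (Nat.cast_nonneg s) (by linarith)
  rw [coeff_deformedGen_eq_dressedMonomial, coeff_deformedGen_eq_dressedMonomial,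
    Finset.sum_range_succ', map_add, map_sum, traceOp_C_mul _ (dressedMonomial d s 0 _),
    traceOp_dressedMonomial hd s 0]
  simp only [Nat.cast_zero, mul_zero, zero_mul, map_zero, Finset.sum_const_zero, add_zero]
  rw [Finset.mul_sum, ← Finset.sum_add_distrib]
  refine Finset.sum_eq_zero fun b _ => ?_
  rw [traceOp_C_mul, traceOp_dressedMonomial hd, Nat.add_sub_add_right, dressedMonomial,
    Finset.mul_sum, Finset.mul_sum, Finset.mul_sum, Finset.mul_sum, ← Finset.sum_add_distrib]
  refine Finset.sum_eq_zero fun k _ => ?_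
  have h := besselCoeff_succ hν0 b
  rw [show b + 1 + k - 1 = b + k by omega]
  have hC : MvPolynomial.C (besselCoeff (s + ((d : ℝ) - 3) / 2) (b + 1) *
        besselCoeff (s + ((d : ℝ) - 3) / 2) (m - b)) *
      MvPolynomial.C (4 * ((b + 1 : ℕ) : ℝ) * ((b + 1 : ℕ) + s + ((d : ℝ) - 3) / 2) *
        gegenbauerCoeff (((d : ℝ) - 3) / 2) s k) =
      -(MvPolynomial.C (besselCoeff (s + ((d : ℝ) - 3) / 2) b *
        besselCoeff (s + ((d : ℝ) - 3) / 2) (m - b)) *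
          MvPolynomial.C (gegenbauerCoeff (((d : ℝ) - 3) / 2) s k) : GenPoly d) := by
    rw [← map_mul, ← map_mul, ← map_neg]
    congr 1
    push_cast
    linear_combination (besselCoeff (s + ((d : ℝ) - 3) / 2) (m - b) *
      gegenbauerCoeff (((d : ℝ) - 3) / 2) s k) * h
  linear_combination (box d * (tau d ^ (s - 2 * k) * rhoSq d 0 ^ (b + k) *
    rhoSq d 1 ^ (m - b + k))) * hC

theorem isDeformedGaugeInvariant_deformedGen (hd : 2 < d) (s : ℕ) :
    IsDeformedGaugeInvariant (deformedGen d s) where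
  symm := deformedGen_symm s
  transverse m := (divergence_apply _).symm.trans (deformedGen_transverse s m)
  trace_zero := (traceOp_apply _).symm.trans (deformedGen_trace_zero hd s)
  trace_succ m := by
    rw [← traceOp_apply]
    exact deformedGen_trace_succ hd s m

/-! ### The main theorem -/

theorem IsFluctuation.exists_smoothSymbol {h : Symbol d} (hh : IsFluctuation h) :
    ∃ (f : smoothSymbols d) (C : Set (Phase d)), (f : Symbol d) = h ∧ IsCompact C ∧
      VanishesOff C f := by
  obtain ⟨C, hC, hv⟩ := hh.support
  exact ⟨⟨h, hh.smooth⟩, C, rfl, hC, hv⟩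

end QuantizedVolume

end

theorem mainTheorem4 (d : ℕ) (hd : 2 < d) :
    (∀ s : ℕ, QuantizedVolume.IsDeformedGaugeInvariant (QuantizedVolume.deformedGen d s)) ∧
    (Even d → ∃ α : ℕ → ℝ, (∀ s, α s ≠ 0) ∧
      ∀ h : QuantizedVolume.Symbol d, QuantizedVolume.IsFluctuation h → ∀ k : ℕ,
        Tendsto (fun D : ℝ => QuantizedVolume.quadraticAction D h k) (𝓝[>] 0)
          (𝓝 (QuantizedVolume.deformedSum α h k))) ∧
    (Odd d → ∀ h : QuantizedVolume.Symbol d, QuantizedVolume.IsFluctuation h → ∀ k : ℕ,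
      ∃ (N : ℕ) (b : ℕ → ℂ),
        Tendsto (fun D : ℝ => QuantizedVolume.quadraticAction D h k -
            ∑ j ∈ Finset.range N, b j * ((D ^ (-(j : ℝ) - 1 / 2) : ℝ) : ℂ)) (𝓝[>] 0)
          (𝓝 0)) := by
  refine ⟨QuantizedVolume.isDeformedGaugeInvariant_deformedGen hd, fun heven => ?_,
    fun hodd h hh k => ?_⟩
  · obtain ⟨l, hl⟩ := heven
    -- An even `d > 2` is at least 4, and `m = d/2 - 2` is the exponent of `□`. It also follows that
    -- `ν = (d-3)/2` is positive, as the addition theorem requires.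
    obtain ⟨m, rfl⟩ : ∃ m, l = m + 2 := ⟨l - 2, by omega⟩
    have hd' : d = 2 * (m + 2) := by omega
    refine ⟨QuantizedVolume.spinConstant d m, fun s => ?_, fun h hh k => ?_⟩
    · have hd3 : (3 : ℝ) < d := by exact_mod_cast (by omega : 3 < d)
      have hν : 0 < ((d : ℝ) - 3) / 2 := by linarith
      have hpi := Real.pi_pos
      exact mul_ne_zero (by positivity) (QuantizedVolume.spinWeight_ne_zero hν s)
    · obtain ⟨f, C, rfl, hC, hf⟩ := hh.exists_smoothSymbol
      rw [← QuantizedVolume.limit_eq_deformedSum hC hf hd' k]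
      exact QuantizedVolume.tendsto_quadraticAction hC hf hd' k
  · obtain ⟨f, C, rfl, hC, hf⟩ := hh.exists_smoothSymbol
    exact (QuantizedVolume.quadraticAction_hasHalfIntegerExpansion hC hf hodd k).exists_sum
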